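/- Let $U_q=U_q(\mathfrak{sl}_2)$ be the algebra over $\mathbb C(q)$ (or, for a number $q\in(0,1)$, over $\mathbb C$) generated by $E,F,K^{\pm1}$ with $KE=q^2EK$, $KF=q^{-2}FK$, $EF-FE=\frac{K-K^{-1}}{q-q^{-1}}$, with coproduct $\Delta K=K\otimes K$, $\Delta E=E\otimes K^{-1}+1\otimes E$, $\Delta F=F\otimes1+K\otimes F$, antipode $S$, and, for numerical $q$, the $*$-structure $K^*=K$, $E^*=qFK^{-1}$, $F^*=q^{-1}KE$. A finite-dimensional $U_q$-module is integrable if it is spanned by its weight spaces $V_n=\{v: Kv=q^nv\}$, $n\in\mathbb Z$. The functionals $c^V_{f,v}(X)=f(Xv)$ on $U_q$ ($V$ finite-dimensional integrable, $v\in V$, $f\in V^*$) are the matrix coefficients; their span is an algebra under the product dual to $\Delta$. For numerical $q\in(0,1)$ this algebra, with $a^*(X)=\overline{a(S(X)^*)}$, is the $*$-algebra $\mathcal O[\mathrm{SU}_q(2)]$. Let $[n]_q=\frac{q^n-q^{-n}}{q-q^{-1}}$ and $F^{(k)}=F^k/[k]_q!$. Over $\mathbb C(q)$, let $\mathbf A_0=\{g/h: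 g,h\in\mathbb C[q],\ h(0)\ne0\}$. The Kashiwara operators on an integrable $V$ are the linear maps with $\tilde E: F^{(k)}u\mapsto F^{(k-1)}u$ (for $F^{(k)}u\neq0$, with $F^{(-1)}u=0$) and $\tilde F:F^{(k)}u\mapsto F^{(k+1)}u$ for every weight vector $u$ with $Eu=0$. A crystal lattice in $V$ is a finitely generated $\mathbf A_0$-submodule $\mathcal L$ spanning $V$ over $\mathbb C(q)$, with $\mathcal L=\bigoplus_n(\mathcal L\cap V_n)$, $\tilde E\mathcal L\subset\mathcal L$ and $\tilde F\mathcal L\subset\mathcal L$. Let $\mathcal O_q^{\mathbf A_0}[\mathrm{SL}(2)]$ be the set of finite sums of matrix coefficients $c^V_{f,v}$ over $\mathbb C(q)$ with $v$ in some crystal lattice $\mathcal L$ of $V$ and $f(\mathcal L)\subset\mathbf A_0$. For $m\in\mathbb N$ let $V(m)$ be the irreducible integrable module of dimension $m+1$, with basis $v_k=F^{(k)}v_0$ ($0\le k\le m$) for a highest weight vector $v_0$ and dual basis $(f^k)$, and put $u^m_{ij}=c^{V(m)}_{f^i,v_j}$; use the same notation for numerical $q$, and write $\alpha=u^1_{00}$,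 $\gamma=u^1_{10}$. Let $(e_n)_{n\ge0}$ be the standard basis of $\ell^2(\mathbb N)$, $T$ the right shift $Te_n=e_{n+1}$ and $P_0$ the orthogonal projection onto $\mathbb Ce_0$. **Theorem.** For every number $q\in(0,1)$ there is a unique unital $*$-representation $\tilde\pi_q$ of $\mathcal O[\mathrm{SU}_q(2)]$ on $\ell^2(\mathbb N)$ with $$\tilde\pi_q(\alpha)e_n=\sqrt{1-q^{2n}}\,e_{n-1},\qquad \tilde\pi_q(\gamma)e_n=q^ne_n\qquad(n\ge0).$$ For every $u\in\mathcal O_q^{\mathbf A_0}[\mathrm{SL}(2)]$, the operators $\tilde\pi_q(u)$, obtained by evaluating $u$ at the number $q$ and applying $\tilde\pi_q$, are defined for all sufficiently small $q>0$ and converge in norm, as $q\to0^+$, to a (unique) bounded operator $\tilde\pi_0(u)$. Moreover, for all $m\in\mathbb N$ and $i,j\in\{0,\dots,m\}$ one has $u^m_{ij}\in\mathcal O_q^{\mathbf A_0}[\mathrm{SL}(2)]$ and $$\tilde\pi_0(u^m_{ij})=\begin{cases}T^jP_0T^{*(m-i)},&i>j,\\ T^iT^{*(m-i)},&i=j,\\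 0,&i<j.\end{cases}$$ -/

import Mathlib

open scoped TensorProduct InnerProductSpace

noncomputable section

namespace QSL2

/-! ### The Hopf algebra `U_q(sl₂)` over a field `k` with parameter `q : k` -/

/-- The generators of the quantized enveloping algebra; `K'` stands for the inverse of `K`. -/
inductive Gen : Type
  | E
  | F
  | K
  | K'

/-- The defining relations (the relation `K F = q⁻² F K` is written as `F K = q² K F`). -/
inductive Rel {k : Type} [Field k] (q : k) : FreeAlgebra k Gen → FreeAlgebra k Gen → Prop
  | K_K' : Rel q (FreeAlgebra.ι k Gen.K * FreeAlgebra.ι k Gen.K') 1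
  | K'_K : Rel q (FreeAlgebra.ι k Gen.K' * FreeAlgebra.ι k Gen.K) 1
  | K_E : Rel q (FreeAlgebra.ι k Gen.K * FreeAlgebra.ι k Gen.E)
      (q ^ 2 • (FreeAlgebra.ι k Gen.E * FreeAlgebra.ι k Gen.K))
  | F_K : Rel q (FreeAlgebra.ι k Gen.F * FreeAlgebra.ι k Gen.K)
      (q ^ 2 • (FreeAlgebra.ι k Gen.K * FreeAlgebra.ι k Gen.F))
  | E_F : Rel q
      (FreeAlgebra.ι k Gen.E * FreeAlgebra.ι k Gen.F -
        FreeAlgebra.ι k Gen.F * FreeAlgebra.ι k Gen.E)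
      ((q - q⁻¹)⁻¹ • (FreeAlgebra.ι k Gen.K - FreeAlgebra.ι k Gen.K'))

/-- The quantized enveloping algebra `U_q(sl₂)`. -/
def Uq {k : Type} [Field k] (q : k) : Type := RingQuot (Rel q)

instance instRingUq {k : Type} [Field k] (q : k) : Ring (Uq q) :=
  inferInstanceAs (Ring (RingQuot (Rel q)))

instance instAlgebraUq {k : Type} [Field k] (q : k) : Algebra k (Uq q) :=
  inferInstanceAs (Algebra k (RingQuot (Rel q)))

/-- The quotient map from the free algebra. -/
def mkU {k : Type} [Field k] (q : k) : FreeAlgebra k Gen →ₐ[k] Uq q :=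
  RingQuot.mkAlgHom k (Rel q)

theorem mkU_rel {k : Type} [Field k] {q : k} {x y : FreeAlgebra k Gen} (h : Rel q x y) :
    mkU q x = mkU q y :=
  RingQuot.mkAlgHom_rel k h

/-- The class of a generator in `U_q(sl₂)`. -/
def gen {k : Type} [Field k] (q : k) (g : Gen) : Uq q :=
  mkU q (FreeAlgebra.ι k g)

/-- The product in `U_q(sl₂)` of a finite word in the generators. -/
def word {k : Type} [Field k] (q : k) (w : List Gen) : Uq q := (w.map (gen q)).prod

section relations
variable {k : Type} [Field k] (q : k)

theorem gen_K_K' : gen q Gen.K * gen q Gen.K' = 1 := by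
  simpa [gen] using mkU_rel (Rel.K_K' (q := q))

theorem gen_K'_K : gen q Gen.K' * gen q Gen.K = 1 := by
  simpa [gen] using mkU_rel (Rel.K'_K (q := q))

theorem gen_K_E : gen q Gen.K * gen q Gen.E = q ^ 2 • (gen q Gen.E * gen q Gen.K) := by
  simpa only [gen, map_mul, map_smul] using mkU_rel (Rel.K_E (q := q))

theorem gen_F_K : gen q Gen.F * gen q Gen.K = q ^ 2 • (gen q Gen.K * gen q Gen.F) := by
  simpa only [gen, map_mul, map_smul] using mkU_rel (Rel.F_K (q := q))

theorem gen_E_F : gen q Gen.E * gen q Gen.F - gen q Gen.F * gen q Gen.E =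
    (q - q⁻¹)⁻¹ • (gen q Gen.K - gen q Gen.K') := by
  simpa only [gen, map_mul, map_smul, map_sub] using mkU_rel (Rel.E_F (q := q))

theorem gen_K'_E : gen q Gen.E * gen q Gen.K' = q ^ 2 • (gen q Gen.K' * gen q Gen.E) := by
  calc gen q Gen.E * gen q Gen.K'
      = (gen q Gen.K' * gen q Gen.K) * (gen q Gen.E * gen q Gen.K') := by
        rw [gen_K'_K, one_mul]
    _ = gen q Gen.K' * (gen q Gen.K * gen q Gen.E) * gen q Gen.K' := by simp only [mul_assoc]
    _ = q ^ 2 • (gen q Gen.K' * gen q Gen.E * (gen q Gen.K * gen q Gen.K')) := by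
        rw [gen_K_E]; simp only [mul_smul_comm, smul_mul_assoc, mul_assoc]
    _ = _ := by rw [gen_K_K', mul_one]

theorem gen_K'_F : gen q Gen.K' * gen q Gen.F = q ^ 2 • (gen q Gen.F * gen q Gen.K') := by
  calc gen q Gen.K' * gen q Gen.F
      = gen q Gen.K' * gen q Gen.F * (gen q Gen.K * gen q Gen.K') := by
        rw [gen_K_K', mul_one]
    _ = gen q Gen.K' * (gen q Gen.F * gen q Gen.K) * gen q Gen.K' := by simp only [mul_assoc]
    _ = q ^ 2 • ((gen q Gen.K' * gen q Gen.K) * (gen q Gen.F * gen q Gen.K')) := by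
        rw [gen_F_K]; simp only [mul_smul_comm, smul_mul_assoc, mul_assoc]
    _ = _ := by rw [gen_K'_K, one_mul]

end relations

/-- The images proposed for the generators. -/
def genMap {A : Type} (e f κ κ' : A) : Gen → A
  | Gen.E => e
  | Gen.F => f
  | Gen.K => κ
  | Gen.K' => κ'

/-- The algebra homomorphism out of `U_q(sl₂)` determined by images of the generators that satisfy
the defining relations. -/
def liftU {k : Type} [Field k] (q : k) {A : Type} [Ring A] [Algebra k A] (e f κ κ' : A)
    (h₁ : κ * κ' = 1) (h₂ : κ' * κ = 1) (h₃ : κ * e = q ^ 2 • (e * κ))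
    (h₄ : f * κ = q ^ 2 • (κ * f)) (h₅ : e * f - f * e = (q - q⁻¹)⁻¹ • (κ - κ')) :
    Uq q →ₐ[k] A :=
  RingQuot.liftAlgHom k ⟨FreeAlgebra.lift k (genMap e f κ κ'), by
    intro x y h
    cases h <;> simpa [genMap]⟩

theorem liftU_gen {k : Type} [Field k] (q : k) {A : Type} [Ring A] [Algebra k A] (e f κ κ' : A)
    (h₁ : κ * κ' = 1) (h₂ : κ' * κ = 1) (h₃ : κ * e = q ^ 2 • (e * κ))
    (h₄ : f * κ = q ^ 2 • (κ * f)) (h₅ : e * f - f * e = (q - q⁻¹)⁻¹ • (κ - κ')) (g : Gen) :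
    liftU q e f κ κ' h₁ h₂ h₃ h₄ h₅ (gen q g) = genMap e f κ κ' g := by
  refine (RingQuot.liftAlgHom_mkAlgHom_apply k _ _ _).trans ?_
  exact FreeAlgebra.lift_ι_apply _ _

theorem hom_ext {k : Type} [Field k] {q : k} {A : Type} [Ring A] [Algebra k A]
    {φ ψ : Uq q →ₐ[k] A} (h : ∀ g, φ (gen q g) = ψ (gen q g)) : φ = ψ := by
  refine RingQuot.ringQuot_ext' k φ ψ ?_
  apply FreeAlgebra.hom_ext
  funext g
  exact h g

/-- The coproduct: `Δ K = K ⊗ K`, `Δ E = E ⊗ K⁻¹ + 1 ⊗ E`, `Δ F = F ⊗ 1 + K ⊗ F`. -/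
def coprod {k : Type} [Field k] (q : k) : Uq q →ₐ[k] Uq q ⊗[k] Uq q :=
  liftU q
    (gen q Gen.E ⊗ₜ gen q Gen.K' + 1 ⊗ₜ gen q Gen.E)
    (gen q Gen.F ⊗ₜ 1 + gen q Gen.K ⊗ₜ gen q Gen.F)
    (gen q Gen.K ⊗ₜ gen q Gen.K)
    (gen q Gen.K' ⊗ₜ gen q Gen.K')
    (by simp [gen_K_K', Algebra.TensorProduct.one_def])
    (by simp [gen_K'_K, Algebra.TensorProduct.one_def])
    (by
      simp only [mul_add, add_mul, Algebra.TensorProduct.tmul_mul_tmul, gen_K_E, gen_K_K',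
        gen_K'_K, mul_one, one_mul, smul_add, TensorProduct.smul_tmul', TensorProduct.tmul_smul])
    (by
      simp only [mul_add, add_mul, Algebra.TensorProduct.tmul_mul_tmul, gen_F_K,
        mul_one, one_mul, smul_add, TensorProduct.smul_tmul', TensorProduct.tmul_smul])
    (by
      have hEF := gen_E_F q
      have key : ∀ a b c d : Uq q ⊗[k] Uq q, a - b = c - d → a = b + (c - d) := by
        intro a b c d h; rw [← h]; abel
      have h1 : gen q Gen.E * gen q Gen.F = gen q Gen.F * gen q Gen.E +
          (q - q⁻¹)⁻¹ • (gen q Gen.K - gen q Gen.K') := by rw [← hEF]; abel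
      simp only [mul_add, add_mul, Algebra.TensorProduct.tmul_mul_tmul, gen_K_E, gen_K'_F,
        mul_one, one_mul, TensorProduct.tmul_smul, ← TensorProduct.smul_tmul', h1,
        TensorProduct.add_tmul, TensorProduct.tmul_add, TensorProduct.sub_tmul,
        TensorProduct.tmul_sub, smul_sub]
      abel)

/-- The counit: `ε K = 1`, `ε E = ε F = 0`. -/
def counitHom {k : Type} [Field k] (q : k) : Uq q →ₐ[k] k :=
  liftU q 0 0 1 1 (by simp) (by simp) (by simp) (by simp) (by simp)

instance instBialgebra {k : Type} [Field k] (q : k) : Bialgebra k (Uq q) :=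
  Bialgebra.ofAlgHom (coprod q) (counitHom q)
    (by
      apply hom_ext
      intro g
      cases g <;>
        simp [coprod, liftU_gen, genMap, TensorProduct.add_tmul, TensorProduct.tmul_add,
          add_assoc, Algebra.TensorProduct.one_def])
    (by
      apply hom_ext
      intro g
      cases g <;> simp [coprod, counitHom, liftU_gen, genMap])
    (by
      apply hom_ext
      intro g
      cases g <;> simp [coprod, counitHom, liftU_gen, genMap])

/-- The antipode, an algebra homomorphism to the opposite algebra:
`S K = K⁻¹`, `S E = -E K`, `S F = -K⁻¹ F`. -/
def antipodeHom {k : Type} [Field k] (q : k) : Uq q →ₐ[k] (Uq q)ᵐᵒᵖ :=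
  liftU q
    (MulOpposite.op (-(gen q Gen.E * gen q Gen.K)))
    (MulOpposite.op (-(gen q Gen.K' * gen q Gen.F)))
    (MulOpposite.op (gen q Gen.K'))
    (MulOpposite.op (gen q Gen.K))
    (by rw [← MulOpposite.op_mul, gen_K_K', MulOpposite.op_one])
    (by rw [← MulOpposite.op_mul, gen_K'_K, MulOpposite.op_one])
    (by
      rw [← MulOpposite.op_mul, ← MulOpposite.op_mul, ← MulOpposite.op_smul]
      congr 1
      simp only [neg_mul, mul_neg, smul_neg]
      congr 1
      rw [mul_assoc, gen_K_K', mul_one, ← mul_assoc, ← smul_mul_assoc, ← gen_K'_E, mul_assoc,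
        gen_K'_K, mul_one])
    (by
      rw [← MulOpposite.op_mul, ← MulOpposite.op_mul, ← MulOpposite.op_smul]
      congr 1
      simp only [neg_mul, mul_neg, smul_neg]
      congr 1
      rw [mul_assoc (gen q Gen.K') (gen q Gen.F), ← mul_smul_comm, ← gen_K'_F])
    (by
      rw [← MulOpposite.op_mul, ← MulOpposite.op_mul, ← MulOpposite.op_sub, ← MulOpposite.op_sub,
        ← MulOpposite.op_smul]
      congr 1
      have h1 : gen q Gen.K' * gen q Gen.F * (gen q Gen.E * gen q Gen.K) =
          gen q Gen.F * gen q Gen.E := by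
        rw [gen_K'_F, smul_mul_assoc, mul_assoc, ← mul_assoc (gen q Gen.K'), ← mul_smul_comm,
          ← smul_mul_assoc, ← gen_K'_E, mul_assoc, gen_K'_K, mul_one]
      have h2 : gen q Gen.E * gen q Gen.K * (gen q Gen.K' * gen q Gen.F) =
          gen q Gen.E * gen q Gen.F := by
        rw [mul_assoc, ← mul_assoc (gen q Gen.K), gen_K_K', one_mul]
      rw [neg_mul_neg, neg_mul_neg, h1, h2, ← neg_sub, gen_E_F, ← smul_neg, neg_sub])

/-! ### Finite-dimensional integrable modules and matrix coefficients -/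

/-- Linear functionals on `U_q(sl₂)`, with the convolution product
`(a * b)(X) = (a ⊗ b)(Δ X)`. -/
abbrev Functional {k : Type} [Field k] (q : k) : Type := WithConv (Uq q →ₗ[k] k)

section modules
variable {k : Type} [Field k] {q : k} {V : Type} [AddCommGroup V] [Module k V]

/-- The weight space of weight `n : ℤ`. -/
def weightSpace (ρ : Uq q →ₐ[k] Module.End k V) (n : ℤ) : Submodule k V :=
  Module.End.eigenspace (ρ (gen q Gen.K)) (q ^ n)

/-- Finite-dimensional integrable (type 1) modules: finite-dimensional modules which are spanned
by their weight vectors. -/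
structure IsIntegrable (ρ : Uq q →ₐ[k] Module.End k V) : Prop where
  finite : Module.Finite k V
  iSup_weightSpace : ⨆ n : ℤ, weightSpace ρ n = ⊤

/-- The matrix coefficient `X ↦ f (X v)`. -/
def matrixCoeff (ρ : Uq q →ₐ[k] Module.End k V) (f : Module.Dual k V) (v : V) : Functional q :=
  WithConv.toConv (f ∘ₗ LinearMap.applyₗ v ∘ₗ ρ.toLinearMap)

@[simp]
theorem matrixCoeff_apply (ρ : Uq q →ₐ[k] Module.End k V) (f : Module.Dual k V) (v : V)
    (X : Uq q) : matrixCoeff ρ f v X = f (ρ X v) := rfl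

/-- The quantum integer `[n]_q`. -/
def qInt (q : k) (n : ℤ) : k := (q ^ n - q ^ (-n)) / (q - q⁻¹)

/-- The quantum factorial `[n]_q!`. -/
def qFactorial (q : k) (n : ℕ) : k := ∏ j ∈ Finset.range n, qInt q ((j : ℤ) + 1)

/-- The divided power `F⁽ⁿ⁾` acting on a module. -/
def divPowF (ρ : Uq q →ₐ[k] Module.End k V) (n : ℕ) : Module.End k V :=
  (qFactorial q n)⁻¹ • ρ (gen q Gen.F) ^ n

/-- `u` is a weight vector killed by `E`. -/
def IsSingular (ρ : Uq q →ₐ[k] Module.End k V) (u : V) : Prop :=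
  (∃ n : ℤ, u ∈ weightSpace ρ n) ∧ ρ (gen q Gen.E) u = 0

/-- `T` is the Kashiwara operator `Ẽ`: it maps `F⁽ⁿ⁾ u` to `F⁽ⁿ⁻¹⁾ u` (and `u` to `0`) for every
weight vector `u` killed by `E`. The rule is applied to non-zero vectors `F⁽ⁿ⁺¹⁾ u` only. -/
def IsKashiwaraE (ρ : Uq q →ₐ[k] Module.End k V) (T : Module.End k V) : Prop :=
  ∀ u, IsSingular ρ u → T u = 0 ∧
    ∀ n : ℕ, divPowF ρ (n + 1) u ≠ 0 → T (divPowF ρ (n + 1) u) = divPowF ρ n u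

/-- `T` is the Kashiwara operator `F̃`: it maps `F⁽ⁿ⁾ u` to `F⁽ⁿ⁺¹⁾ u` for every weight vector `u`
killed by `E`. -/
def IsKashiwaraF (ρ : Uq q →ₐ[k] Module.End k V) (T : Module.End k V) : Prop :=
  ∀ u, IsSingular ρ u → ∀ n : ℕ, T (divPowF ρ n u) = divPowF ρ (n + 1) u

end modules

/-! ### The irreducible modules `V(m)` and their matrix coefficients -/

section simple
variable {k : Type} [Field k]

/-- `E v_j = [m - j + 1] v_{j-1}` on `V(m)`, written on coordinate vectors. -/
def simpleE (q : k) (m : ℕ) : Module.End k (Fin (m + 1) → k) where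
  toFun w i := if h : (i : ℕ) + 1 < m + 1 then qInt q ((m : ℤ) - i) * w ⟨i + 1, h⟩ else 0
  map_add' w w' := by
    funext i
    simp only [Pi.add_apply]
    split_ifs <;> ring
  map_smul' c w := by
    funext i
    simp only [Pi.smul_apply, smul_eq_mul, RingHom.id_apply]
    split_ifs <;> ring

/-- `F v_j = [j + 1] v_{j+1}` on `V(m)`, written on coordinate vectors. -/
def simpleF (q : k) (m : ℕ) : Module.End k (Fin (m + 1) → k) where
  toFun w i := if 0 < (i : ℕ) then
    qInt q (i : ℤ) * w ⟨i - 1, lt_of_le_of_lt (Nat.sub_le _ _) i.isLt⟩ else 0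
  map_add' w w' := by
    funext i
    simp only [Pi.add_apply]
    split_ifs <;> ring
  map_smul' c w := by
    funext i
    simp only [Pi.smul_apply, smul_eq_mul, RingHom.id_apply]
    split_ifs <;> ring

/-- `K^ε v_j = q^{ε(m - 2j)} v_j` on `V(m)`. -/
def simpleK (q : k) (m : ℕ) (ε : ℤ) : Module.End k (Fin (m + 1) → k) where
  toFun w i := q ^ (ε * ((m : ℤ) - 2 * i)) * w i
  map_add' w w' := by ext i; simp [mul_add]
  map_smul' c w := by ext i; simp [mul_left_comm]

theorem simpleE_apply_pos (q : k) (m : ℕ) (w : Fin (m + 1) → k) (i : Fin (m + 1))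
    (h : (i : ℕ) + 1 < m + 1) :
    simpleE q m w i = qInt q ((m : ℤ) - i) * w ⟨i + 1, h⟩ := dif_pos h

theorem simpleE_apply_neg (q : k) (m : ℕ) (w : Fin (m + 1) → k) (i : Fin (m + 1))
    (h : ¬ (i : ℕ) + 1 < m + 1) : simpleE q m w i = 0 := dif_neg h

theorem simpleF_apply_pos (q : k) (m : ℕ) (w : Fin (m + 1) → k) (i : Fin (m + 1))
    (h : 0 < (i : ℕ)) : simpleF q m w i =
      qInt q (i : ℤ) * w ⟨i - 1, lt_of_le_of_lt (Nat.sub_le _ _) i.isLt⟩ := if_pos h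

theorem simpleF_apply_neg (q : k) (m : ℕ) (w : Fin (m + 1) → k) (i : Fin (m + 1))
    (h : ¬ 0 < (i : ℕ)) : simpleF q m w i = 0 := if_neg h

theorem simpleK_apply (q : k) (m : ℕ) (ε : ℤ) (w : Fin (m + 1) → k) (i : Fin (m + 1)) :
    simpleK q m ε w i = q ^ (ε * ((m : ℤ) - 2 * i)) * w i := rfl

theorem qInt_identity {q : k} (hq : q ≠ 0) (i m : ℤ) :
    qInt q (m - i) * qInt q (i + 1) - qInt q i * qInt q (m - i + 1) =
      (q - q⁻¹)⁻¹ * (q ^ (m - 2 * i) - q ^ (-(m - 2 * i))) := by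
  by_cases h : q - q⁻¹ = 0
  · simp [qInt, h]
  · have e1 : q ^ (m - 2 * i) = q ^ m / (q ^ i * q ^ i) := by
      rw [zpow_sub₀ hq, two_mul, zpow_add₀ hq]
    have e2 : q ^ (m - i) = q ^ m / q ^ i := zpow_sub₀ hq _ _
    have hi : q ^ i ≠ 0 := zpow_ne_zero _ hq
    have hm : q ^ m ≠ 0 := zpow_ne_zero _ hq
    have h' : q ^ 2 - 1 ≠ 0 := by
      intro h0; apply h; field_simp; rw [h0, mul_zero]
    simp only [qInt, zpow_neg, zpow_add₀ hq, zpow_one, e1, e2]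
    field_simp
    ring

/-- The irreducible module `V(m)` of dimension `m + 1`. Its standard basis is
`v_j = F⁽ʲ⁾ v_0`, `j = 0, …, m`, where `v_0` is a highest weight vector. -/
def simpleModule {q : k} (hq : q ≠ 0) (m : ℕ) :
    Uq q →ₐ[k] Module.End k (Fin (m + 1) → k) :=
  liftU q (simpleE q m) (simpleF q m) (simpleK q m 1) (simpleK q m (-1))
    (by
      refine LinearMap.ext fun w => funext fun i => ?_
      rw [Module.End.mul_apply, simpleK_apply, simpleK_apply, ← mul_assoc, ← zpow_add₀ hq]
      simp)
    (by
      refine LinearMap.ext fun w => funext fun i => ?_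
      rw [Module.End.mul_apply, simpleK_apply, simpleK_apply, ← mul_assoc, ← zpow_add₀ hq]
      simp)
    (by
      refine LinearMap.ext fun w => funext fun i => ?_
      rw [LinearMap.smul_apply, Pi.smul_apply, Module.End.mul_apply, Module.End.mul_apply,
        simpleK_apply, smul_eq_mul]
      by_cases h : (i : ℕ) + 1 < m + 1
      · have e : q ^ (1 * ((m : ℤ) - 2 * i)) =
            q ^ 2 * q ^ (1 * ((m : ℤ) - 2 * ((i + 1 : ℕ) : ℤ))) := by
          rw [← zpow_natCast, ← zpow_add₀ hq]; congr 1; push_cast; ring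
        rw [simpleE_apply_pos _ _ _ _ h, simpleE_apply_pos _ _ _ _ h, simpleK_apply, e]
        ring
      · rw [simpleE_apply_neg _ _ _ _ h, simpleE_apply_neg _ _ _ _ h, mul_zero, mul_zero])
    (by
      refine LinearMap.ext fun w => funext fun i => ?_
      rw [LinearMap.smul_apply, Pi.smul_apply, Module.End.mul_apply, Module.End.mul_apply,
        simpleK_apply, smul_eq_mul]
      by_cases h : 0 < (i : ℕ)
      · have e : q ^ (1 * ((m : ℤ) - 2 * ((i - 1 : ℕ) : ℤ))) =
            q ^ 2 * q ^ (1 * ((m : ℤ) - 2 * i)) := by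
          rw [← zpow_natCast, ← zpow_add₀ hq]
          congr 1
          rw [Nat.cast_sub h]
          push_cast
          ring
        rw [simpleF_apply_pos _ _ _ _ h, simpleF_apply_pos _ _ _ _ h, simpleK_apply, e]
        ring
      · rw [simpleF_apply_neg _ _ _ _ h, simpleF_apply_neg _ _ _ _ h, mul_zero, mul_zero])
    (by
      refine LinearMap.ext fun w => funext fun i => ?_
      have key := qInt_identity hq (i : ℤ) (m : ℤ)
      have hEF : simpleE q m (simpleF q m w) i =
          qInt q ((m : ℤ) - i) * qInt q ((i : ℤ) + 1) * w i := by
        by_cases h : (i : ℕ) + 1 < m + 1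
        · rw [simpleE_apply_pos _ _ _ _ h, simpleF_apply_pos _ _ _ _ (Nat.succ_pos _), mul_assoc]
          push_cast
          rfl
        · have : (m : ℤ) - i = 0 := by have := i.isLt; omega
          rw [simpleE_apply_neg _ _ _ _ h, this]
          simp [qInt]
      have hFE : simpleF q m (simpleE q m w) i =
          qInt q (i : ℤ) * qInt q ((m : ℤ) - i + 1) * w i := by
        by_cases h : 0 < (i : ℕ)
        · have h1 : (i : ℕ) - 1 + 1 = i := Nat.sub_add_cancel h
          have h2 : (i : ℕ) - 1 + 1 < m + 1 := by have := i.isLt; omega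
          have h3 : (m : ℤ) - ((i - 1 : ℕ) : ℤ) = (m : ℤ) - i + 1 := by omega
          rw [simpleF_apply_pos _ _ _ _ h, simpleE_apply_pos _ _ _ _ h2, mul_assoc]
          simp only [h1, h3]
        · have : (i : ℤ) = 0 := by omega
          rw [simpleF_apply_neg _ _ _ _ h, this]
          simp [qInt]
      rw [LinearMap.sub_apply, Pi.sub_apply, Module.End.mul_apply, Module.End.mul_apply, hEF, hFE,
        LinearMap.smul_apply, Pi.smul_apply, LinearMap.sub_apply, Pi.sub_apply, simpleK_apply,
        simpleK_apply, smul_eq_mul, one_mul, neg_one_mul]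
      linear_combination w i * key)

/-- The matrix coefficient `u^m_{ij} : X ↦ f^i (X v_j)` of `V(m)`, where `(f^i)` is the basis
dual to `(v_j)`. -/
def uCoeff {q : k} (hq : q ≠ 0) (m : ℕ) (i j : Fin (m + 1)) : Functional q :=
  matrixCoeff (simpleModule hq m) (LinearMap.proj i) (Pi.single j 1)

end simple

/-! ### The quantized coordinate ring -/

section coordinateRing
variable {k : Type} [Field k]

/-- The set of matrix coefficients of finite-dimensional integrable modules. -/
def matrixCoeffs (q : k) : Set (Functional q) :=
  {a | ∃ (V : Type) (_ : AddCommGroup V) (_ : Module k V) (ρ : Uq q →ₐ[k] Module.End k V)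
    (f : Module.Dual k V) (v : V), IsIntegrable ρ ∧ a = matrixCoeff ρ f v}

/-- The action on a tensor product of modules, through the coproduct. -/
def tensorModule {q : k} {V W : Type} [AddCommGroup V] [Module k V] [AddCommGroup W] [Module k W]
    (ρ : Uq q →ₐ[k] Module.End k V) (σ : Uq q →ₐ[k] Module.End k W) :
    Uq q →ₐ[k] Module.End k (V ⊗[k] W) :=
  (Module.endTensorEndAlgHom (R := k) (S := k) (A := k) (M := V) (N := W)).comp
    ((Algebra.TensorProduct.map ρ σ).comp (coprod q))

theorem tensorModule_K {q : k} {V W : Type} [AddCommGroup V] [Module k V] [AddCommGroup W]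
    [Module k W] (ρ : Uq q →ₐ[k] Module.End k V) (σ : Uq q →ₐ[k] Module.End k W) (v : V) (w : W) :
    tensorModule ρ σ (gen q Gen.K) (v ⊗ₜ w) = ρ (gen q Gen.K) v ⊗ₜ σ (gen q Gen.K) w := by
  simp only [tensorModule, coprod, AlgHom.comp_apply, liftU_gen, genMap,
    Algebra.TensorProduct.map_tmul]
  rfl

theorem IsIntegrable.tensor {q : k} (hq : q ≠ 0) {V W : Type} [AddCommGroup V] [Module k V]
    [AddCommGroup W] [Module k W] {ρ : Uq q →ₐ[k] Module.End k V} {σ : Uq q →ₐ[k] Module.End k W}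
    (hρ : IsIntegrable ρ) (hσ : IsIntegrable σ) : IsIntegrable (tensorModule ρ σ) := by
  have := hρ.finite
  have := hσ.finite
  refine ⟨inferInstance, ?_⟩
  rw [eq_top_iff, ← TensorProduct.span_tmul_eq_top, Submodule.span_le]
  rintro _ ⟨v, w, rfl⟩
  have hv : v ∈ ⨆ n : ℤ, weightSpace ρ n := by rw [hρ.iSup_weightSpace]; trivial
  have hw : w ∈ ⨆ n : ℤ, weightSpace σ n := by rw [hσ.iSup_weightSpace]; trivial
  rw [SetLike.mem_coe]
  induction hv using Submodule.iSup_induction' with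
  | zero => rw [TensorProduct.zero_tmul]; exact Submodule.zero_mem _
  | add x y _ _ hx hy => rw [TensorProduct.add_tmul]; exact Submodule.add_mem _ hx hy
  | mem n v hv =>
    induction hw using Submodule.iSup_induction' with
    | zero => rw [TensorProduct.tmul_zero]; exact Submodule.zero_mem _
    | add x y _ _ hx hy => rw [TensorProduct.tmul_add]; exact Submodule.add_mem _ hx hy
    | mem p w hw =>
      refine Submodule.mem_iSup_of_mem (n + p) ?_
      rw [weightSpace, Module.End.mem_eigenspace_iff] at hv hw ⊢
      rw [tensorModule_K, hv, hw, zpow_add₀ hq, TensorProduct.smul_tmul_smul]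

theorem matrixCoeff_mul {q : k} {V W : Type} [AddCommGroup V] [Module k V] [AddCommGroup W]
    [Module k W] (ρ : Uq q →ₐ[k] Module.End k V) (σ : Uq q →ₐ[k] Module.End k W)
    (f : Module.Dual k V) (g : Module.Dual k W) (v : V) (w : W) :
    matrixCoeff ρ f v * matrixCoeff σ g w =
      matrixCoeff (tensorModule ρ σ) (LinearMap.mul' k k ∘ₗ TensorProduct.map f g) (v ⊗ₜ w) := by
  refine WithConv.ext (LinearMap.ext fun X => ?_)
  change LinearMap.mul' k k (TensorProduct.map (matrixCoeff ρ f v).ofConv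
      (matrixCoeff σ g w).ofConv (coprod q X)) =
    LinearMap.mul' k k (TensorProduct.map f g
      (Module.endTensorEndAlgHom (R := k) (S := k) (A := k) (M := V) (N := W)
        (Algebra.TensorProduct.map ρ σ (coprod q X)) (v ⊗ₜ w)))
  induction coprod q X using TensorProduct.induction_on with
  | zero => simp
  | tmul x y => rfl
  | add x y hx hy => simp only [map_add, hx, hy, LinearMap.add_apply]

/-- The trivial module. -/
def trivialModule (q : k) : Uq q →ₐ[k] Module.End k k :=
  (Algebra.lmul k k).comp (counitHom q)

theorem isIntegrable_trivialModule (q : k) : IsIntegrable (trivialModule q) := by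
  refine ⟨inferInstance, ?_⟩
  rw [eq_top_iff]
  intro x _
  refine Submodule.mem_iSup_of_mem 0 ?_
  rw [weightSpace, Module.End.mem_eigenspace_iff]
  simp [trivialModule, counitHom, liftU_gen, genMap]

/-- The quantized coordinate ring: the span of the matrix coefficients of finite-dimensional
integrable `U_q(sl₂)`-modules, with the product dual to the coproduct. -/
def coordRing {q : k} (hq : q ≠ 0) : Subalgebra k (Functional q) :=
  (Submodule.span k (matrixCoeffs q)).toSubalgebra
    (by
      refine Submodule.subset_span ⟨k, inferInstance, inferInstance, trivialModule q,
        LinearMap.id, 1, isIntegrable_trivialModule q, ?_⟩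
      refine WithConv.ext (LinearMap.ext fun X => ?_)
      change counitHom q X = counitHom q X * 1
      rw [mul_one])
    (by
      intro a b ha hb
      refine Submodule.mul_le.mpr ?_ (Submodule.mul_mem_mul ha hb) |> id
      intro a ha b hb
      induction ha using Submodule.span_induction with
      | zero => rw [zero_mul]; exact Submodule.zero_mem _
      | add x y _ _ hx hy => rw [add_mul]; exact Submodule.add_mem _ hx hy
      | smul c x _ hx => rw [smul_mul_assoc]; exact Submodule.smul_mem _ _ hx
      | mem a ha =>
        induction hb using Submodule.span_induction with
        | zero => rw [mul_zero]; exact Submodule.zero_mem _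
        | add x y _ _ hx hy => rw [mul_add]; exact Submodule.add_mem _ hx hy
        | smul c x _ hx => rw [mul_smul_comm]; exact Submodule.smul_mem _ _ hx
        | mem b hb =>
          obtain ⟨V, _, _, ρ, f, v, hρ, rfl⟩ := ha
          obtain ⟨W, _, _, σ, g, w, hσ, rfl⟩ := hb
          exact Submodule.subset_span ⟨V ⊗[k] W, inferInstance, inferInstance, tensorModule ρ σ,
            _, _, hρ.tensor hq hσ, matrixCoeff_mul ρ σ f g v w⟩)

end coordinateRing

/-! ### The form over `A₀` of the coordinate ring over `ℂ(q)` -/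

/-- The field `ℂ(q)`. -/
abbrev Cq : Type := RatFunc ℂ

/-- The indeterminate `q`. -/
abbrev qX : Cq := RatFunc.X

/-- The ring `A₀ = {g / h : g, h ∈ ℂ[q], h(0) ≠ 0}`. -/
def A₀ : Subring Cq where
  carrier := {x | ∃ g h : Polynomial ℂ, h.eval 0 ≠ 0 ∧
    x = algebraMap (Polynomial ℂ) Cq g / algebraMap (Polynomial ℂ) Cq h}
  zero_mem' := ⟨0, 1, by simp, by simp⟩
  one_mem' := ⟨1, 1, by simp, by simp⟩
  neg_mem' := by
    rintro _ ⟨g, h, hh, rfl⟩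
    exact ⟨-g, h, hh, by rw [map_neg]; exact (neg_div _ _).symm⟩
  mul_mem' := by
    rintro _ _ ⟨g, h, hh, rfl⟩ ⟨g', h', hh', rfl⟩
    exact ⟨g * g', h * h', by simp [hh, hh'], by rw [map_mul, map_mul, div_mul_div_comm]⟩
  add_mem' := by
    rintro _ _ ⟨g, h, hh, rfl⟩ ⟨g', h', hh', rfl⟩
    have ne : ∀ p : Polynomial ℂ, p.eval 0 ≠ 0 → algebraMap (Polynomial ℂ) Cq p ≠ 0 := by
      intro p hp h0
      apply hp
      rw [(map_eq_zero_iff _ (IsFractionRing.injective (Polynomial ℂ) Cq)).mp h0,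
        Polynomial.eval_zero]
    refine ⟨g * h' + h * g', h * h', by simp [hh, hh'], ?_⟩
    rw [div_add_div _ _ (ne h hh) (ne h' hh')]
    simp only [map_add, map_mul]

/-- The restriction of scalars to a subring. -/
abbrev subringModule {R M : Type} [Ring R] [AddCommGroup M] [Module R M] (S : Subring R) :
    Module S M := inferInstance

instance instModuleA₀Cq : Module A₀ Cq := subringModule A₀

instance instSMulA₀Cq : SMul A₀ Cq := (subringModule A₀ : Module A₀ Cq).toSMul

/-- Crystal lattices in an integrable module `V` over `ℂ(q)`. -/
structure IsCrystalLattice {V : Type} [AddCommGroup V] [Module Cq V]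
    (ρ : Uq qX →ₐ[Cq] Module.End Cq V) (L : Submodule A₀ V) : Prop where
  fg : L.FG
  span_eq_top : Submodule.span Cq (L : Set V) = ⊤
  weight : L = ⨆ n : ℤ, L ⊓ (weightSpace ρ n).restrictScalars A₀
  kashiwaraE : ∃ T, IsKashiwaraE ρ T ∧ ∀ v ∈ L, T v ∈ L
  kashiwaraF : ∃ T, IsKashiwaraF ρ T ∧ ∀ v ∈ L, T v ∈ L

/-- The `A₀`-form `O_q^{A₀}[SL(2)]`: sums of matrix coefficients `X ↦ f (X v)` where `v` belongs
to a crystal lattice `L` of a finite-dimensional integrable module, and `f` belongs to the dual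
lattice, that is, `f` maps `L` to `A₀`. -/
def crystalForm : Submodule A₀ (Functional qX) :=
  Submodule.span A₀ {a | ∃ (V : Type) (_ : AddCommGroup V) (_ : Module Cq V)
    (ρ : Uq qX →ₐ[Cq] Module.End Cq V) (L : Submodule A₀ V) (f : Module.Dual Cq V) (v : V),
    IsIntegrable ρ ∧ IsCrystalLattice ρ L ∧ v ∈ L ∧ (∀ w ∈ L, f w ∈ A₀) ∧ a = matrixCoeff ρ f v}

/-! ### Specialization and the `*`-structure at a numerical parameter `t ∈ (0, 1)` -/

/-- `a` is the specialization of `u` at `q = t`: on every word in the generators the value of `u`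
is a rational function regular at `t`, and the value of `a` is its evaluation at `t`. -/
def IsSpecialization (t : ℂ) (u : Functional qX) (a : Functional t) : Prop :=
  ∀ w : List Gen, (u (word qX w)).denom.eval t ≠ 0 ∧
    a (word t w) = (u (word qX w)).eval (RingHom.id ℂ) t

/-- The interval `(0, 1)` of numerical parameters. -/
abbrev Param : Type := Set.Ioo (0 : ℝ) 1

/-- A numerical parameter as a complex number. -/
abbrev Param.c (t : Param) : ℂ := ((t : ℝ) : ℂ)

theorem Param.c_ne_zero (t : Param) : t.c ≠ 0 := Complex.ofReal_ne_zero.mpr t.2.1.ne'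

/-- The opposite algebra with the conjugate scalar multiplication. -/
def ConjOp (A : Type) : Type := Aᵐᵒᵖ

instance (A : Type) [Ring A] : Ring (ConjOp A) := inferInstanceAs (Ring Aᵐᵒᵖ)

instance (A : Type) [Ring A] [Algebra ℂ A] : Algebra ℂ (ConjOp A) :=
  RingHom.toAlgebra' ((algebraMap ℂ Aᵐᵒᵖ).comp (starRingEnd ℂ))
    (fun c x => Algebra.commutes (A := Aᵐᵒᵖ) (starRingEnd ℂ c) x)

/-- An element as an element of the conjugate opposite algebra. -/
def ConjOp.mk {A : Type} (x : A) : ConjOp A := MulOpposite.op x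

/-- The underlying element. -/
def ConjOp.out {A : Type} (x : ConjOp A) : A := MulOpposite.unop x

theorem ConjOp.mk_mul {A : Type} [Ring A] (x y : A) :
    ConjOp.mk x * ConjOp.mk y = ConjOp.mk (y * x) := rfl

theorem ConjOp.mk_sub {A : Type} [Ring A] (x y : A) :
    ConjOp.mk x - ConjOp.mk y = ConjOp.mk (x - y) := rfl

theorem ConjOp.smul_mk {A : Type} [Ring A] [Algebra ℂ A] (c : ℂ) (x : A) :
    c • ConjOp.mk x = ConjOp.mk (starRingEnd ℂ c • x) := by
  change MulOpposite.op (algebraMap ℂ A (starRingEnd ℂ c)) * MulOpposite.op x = _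
  rw [← MulOpposite.op_mul, ← Algebra.commutes, ← Algebra.smul_def]
  rfl

theorem ConjOp.out_smul {A : Type} [Ring A] [Algebra ℂ A] (c : ℂ) (x : ConjOp A) :
    (c • x).out = starRingEnd ℂ c • x.out :=
  congrArg ConjOp.out (ConjOp.smul_mk c x.out)

/-- The `*`-structure of `U_q(su₂)`: `K* = K`, `E* = q F K⁻¹`, `F* = q⁻¹ K E`, as an algebra
homomorphism to the conjugate opposite algebra. -/
def starHom (t : Param) : Uq t.c →ₐ[ℂ] ConjOp (Uq t.c) :=
  liftU t.c
    (ConjOp.mk (t.c • (gen t.c Gen.F * gen t.c Gen.K')))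
    (ConjOp.mk (t.c⁻¹ • (gen t.c Gen.K * gen t.c Gen.E)))
    (ConjOp.mk (gen t.c Gen.K))
    (ConjOp.mk (gen t.c Gen.K'))
    (by rw [ConjOp.mk_mul, gen_K'_K]; rfl)
    (by rw [ConjOp.mk_mul, gen_K_K']; rfl)
    (by
      rw [ConjOp.mk_mul, ConjOp.mk_mul, ConjOp.smul_mk]
      congr 1
      rw [map_pow, Complex.conj_ofReal, smul_mul_assoc, mul_smul_comm, smul_comm, mul_assoc,
        gen_K'_K, mul_one, ← mul_assoc, ← smul_mul_assoc, ← gen_F_K, mul_assoc, gen_K_K', mul_one])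
    (by
      rw [ConjOp.mk_mul, ConjOp.mk_mul, ConjOp.smul_mk]
      congr 1
      rw [map_pow, Complex.conj_ofReal, smul_mul_assoc, mul_smul_comm, smul_comm, mul_assoc,
        ← mul_smul_comm (t.c ^ 2), ← gen_K_E])
    (by
      rw [ConjOp.mk_mul, ConjOp.mk_mul, ConjOp.mk_sub, ConjOp.mk_sub, ConjOp.smul_mk]
      congr 1
      have h0 := t.c_ne_zero
      have h1 : gen t.c Gen.K * gen t.c Gen.E * (gen t.c Gen.F * gen t.c Gen.K') =
          gen t.c Gen.E * gen t.c Gen.F := by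
        rw [gen_K_E, smul_mul_assoc, mul_assoc, ← mul_assoc (gen t.c Gen.K), ← mul_smul_comm,
          ← smul_mul_assoc, ← gen_F_K, mul_assoc, gen_K_K', mul_one]
      have h2 : gen t.c Gen.F * gen t.c Gen.K' * (gen t.c Gen.K * gen t.c Gen.E) =
          gen t.c Gen.F * gen t.c Gen.E := by
        rw [mul_assoc, ← mul_assoc (gen t.c Gen.K'), gen_K'_K, one_mul]
      rw [smul_mul_smul_comm, smul_mul_smul_comm, h1, h2, inv_mul_cancel₀ h0, mul_inv_cancel₀ h0,
        one_smul, one_smul, gen_E_F, map_inv₀, map_sub, map_inv₀, Complex.conj_ofReal])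

/-- The adjoint `X*` in `U_q(su₂)`. -/
def adj (t : Param) (X : Uq t.c) : Uq t.c := (starHom t X).out

/-- The antipode `S`. -/
def antipode (t : Param) (X : Uq t.c) : Uq t.c := (antipodeHom t.c X).unop

/-- The `*`-structure on functionals: `a*(X) = conj (a (S(X)*))`. -/
def starFunctional (t : Param) (a : Functional t.c) : Functional t.c :=
  WithConv.toConv
    { toFun := fun X => starRingEnd ℂ (a (adj t (antipode t X)))
      map_add' := by
        intro X Y
        have h : adj t (antipode t (X + Y)) =
            adj t (antipode t X) + adj t (antipode t Y) := by
          simp only [adj, antipode, map_add, MulOpposite.unop_add]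
          rfl
        rw [h, map_add, map_add]
      map_smul' := by
        intro c X
        have h : adj t (antipode t (c • X)) =
            starRingEnd ℂ c • adj t (antipode t X) := by
          simp only [adj, antipode, map_smul, MulOpposite.unop_smul, ConjOp.out_smul]
        rw [h, map_smul, smul_eq_mul, map_mul, Complex.conj_conj]
        rfl }

/-! ### The Hilbert space `ℓ²(ℕ)` and the standard representation -/

/-- The Hilbert space `ℓ²(ℕ)`. -/
abbrev H : Type := lp (fun _ : ℕ => ℂ) 2

/-- The bounded operators on `ℓ²(ℕ)`. -/
abbrev BH : Type := H →L[ℂ] H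

/-- The standard basis of `ℓ²(ℕ)`. -/
def e (n : ℕ) : H := lp.single 2 n (1 : ℂ)

theorem orthonormal_e : Orthonormal ℂ e := by
  rw [orthonormal_iff_ite]
  intro i j
  rw [e, e, lp.inner_single_left]
  by_cases h : i = j
  · subst h; simp
  · simp [h, lp.single_apply]

/-- The right shift `T e_n = e_{n+1}`. -/
def T : BH :=
  ((orthonormal_e.comp Nat.succ Nat.succ_injective).orthogonalFamily.linearIsometry).toContinuousLinearMap

theorem T_e (n : ℕ) : T (e n) = e (n + 1) := by
  have h := (orthonormal_e.comp Nat.succ Nat.succ_injective).orthogonalFamily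
  exact (h.linearIsometry_apply_single (i := n) (1 : ℂ)).trans (one_smul ℂ _)

/-- The orthogonal projection onto `ℂ e_0`. -/
def P₀ : BH := (Submodule.span ℂ {e 0}).starProjection

/-- The coordinate `*`-algebra `O[SU_t(2)]` at a numerical parameter `t`. -/
abbrev OSU (t : Param) : Subalgebra ℂ (Functional t.c) := coordRing t.c_ne_zero

/-- `π` is the standard representation of `O[SU_t(2)]`: it is a `*`-representation with
`π(α) e_n = √(1 - t^{2n}) e_{n-1}` and `π(γ) e_n = t^n e_n`, where `α = u¹₀₀` and `γ = u¹₁₀`. -/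
structure IsStandardRep (t : Param) (π : OSU t →ₐ[ℂ] BH) : Prop where
  map_star : ∀ a b : OSU t, (b : Functional t.c) = starFunctional t a →
    π b = ContinuousLinearMap.adjoint (π a)
  map_alpha : ∀ a : OSU t, (a : Functional t.c) = uCoeff t.c_ne_zero 1 0 0 →
    ∀ n : ℕ, π a (e n) = (Real.sqrt (1 - (t : ℝ) ^ (2 * n)) : ℂ) • e (n - 1)
  map_gamma : ∀ a : OSU t, (a : Functional t.c) = uCoeff t.c_ne_zero 1 1 0 →
    ∀ n : ℕ, π a (e n) = ((t : ℝ) ^ n : ℂ) • e n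

/-- The operators `π_t(u)`, obtained by specializing `u` at `q = t` and applying `π_t`, are defined
for all sufficiently small `t > 0` and converge in norm to `L` as `t → 0⁺`. -/
def HasCrystalLimit (π : (t : Param) → OSU t →ₐ[ℂ] BH) (u : Functional qX) (L : BH) : Prop :=
  ∀ ε > 0, ∃ δ > 0, ∀ t : Param, (t : ℝ) < δ →
    ∃ a : OSU t, IsSpecialization t.c u a ∧ ‖π t a - L‖ < ε

end QSL2

end

/-!
The argument rests on recursions for the matrix coefficients `u^m_{ij}` of `V(m)`. The vectors
`F⁽ʲ⁾(v_0 ⊗ v_0) = q^j v_0 ⊗ v_j + v_1 ⊗ v_{j-1}` span a copy of `V(m+1)` in `V(1) ⊗ V(m)`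
(`isString_cgVec`), and comparing coefficients there expresses `u^{m+1}_{ij}` through the generators
`α, β, γ, δ` (the entries of `u^1`) and the coefficients of `V(m)`; for instance
`u^{m+1}_{i+1,j+1} = q^{j+1} γ u^m_{i,j+1} + δ u^m_{ij}` (`matCoeff_succ_succ`). No negative power
of `q` occurs in the recursions needed, so they survive the limit `q → 0⁺`.

*Generation.* In a finite-dimensional integrable module every weight vector is a sum of vectors
`F⁽ⁱ⁾ u_i` with `u_i` singular (`exists_string_decomposition`), and a singular vector generates a
copy of some `V(m)`. Hence the `u^m_{ij}` span the coordinate ring, and by the recursions the ring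
is generated by `α, β, γ, δ` (`coordRing_eq_adjoin`). Over `ℂ(q)`, the Kashiwara operators extract
the `u_i` from the sum without leaving a crystal lattice, so the form over `A₀` is the `A₀`-span of
the `u^m_{ij}` (`crystalForm_le`, `crystalCoeff_mem_crystalForm`).

*The standard representation.* Uniqueness is clear from generation, as `δ = α*` and
`β = -q γ*`. For existence, consider the algebra of pairs (function, operator) generated by the four
generators paired with their prescribed operators. It is the graph of a map: right multiplication by
a power of `α` turns any pair into a combination of ordered monomials `α^a γ^c β^b`
(`SLRelations.exists_mul_alpha_pow_mem`); these are linearly independent as functionals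
(`linearIndependent_monomial`, by pairing with `F^c K^n E^b`), and the powers of `π(α)` have dense
range, so a pair with first component zero is zero (`eq_zero_of_zero_mem_repGraph`). The graph is
stable under the involutions, which gives a `*`-representation.

*The limit.* As `t → 0⁺`, the operators of `α, β, γ, δ` converge in norm to `T*, 0, P₀, T`, and the
recursions give the limits of all `π_t(u^m_{ij})` by induction on `m` (`tendsto_ringCoeff`). Since
elements of `A₀` have limits at `0`, convergence extends to the whole form
(`exists_specializationTendsto`). A specialization is determined by its values on words in the
generators (`IsSpecialization.unique`), so the limit is unique.
-/

namespace QSL2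

noncomputable section

/-! ### Strings and matrix coefficients -/

section strings

variable {k : Type} [Field k] {q : k}

theorem Uq_induction {P : Uq q → Prop} (hgen : ∀ g, P (gen q g))
    (hscal : ∀ c : k, P (algebraMap k (Uq q) c))
    (hadd : ∀ X Y, P X → P Y → P (X + Y)) (hmul : ∀ X Y, P X → P Y → P (X * Y)) (X : Uq q) :
    P X := by
  obtain ⟨x, rfl⟩ := RingQuot.mkAlgHom_surjective k (Rel q) X
  change P (mkU q x)
  induction x using FreeAlgebra.induction with
  | grade0 c => rw [AlgHom.commutes]; exact hscal c
  | grade1 g => exact hgen g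
  | mul a b ha hb => rw [map_mul]; exact hmul _ _ ha hb
  | add a b ha hb => rw [map_add]; exact hadd _ _ ha hb

variable {V W : Type} [AddCommGroup V] [Module k V] [AddCommGroup W] [Module k W]

theorem apply_K_K' (ρ : Uq q →ₐ[k] Module.End k V) (v : V) :
    ρ (gen q Gen.K) (ρ (gen q Gen.K') v) = v := by
  rw [← Module.End.mul_apply, ← map_mul, gen_K_K', map_one, Module.End.one_apply]

theorem apply_K'_K (ρ : Uq q →ₐ[k] Module.End k V) (v : V) :
    ρ (gen q Gen.K') (ρ (gen q Gen.K) v) = v := by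
  rw [← Module.End.mul_apply, ← map_mul, gen_K'_K, map_one, Module.End.one_apply]

/-- A linear map commuting with `E`, `F` and `K` is a module map. -/
theorem intertwines_of_gen {ρ : Uq q →ₐ[k] Module.End k V} {σ : Uq q →ₐ[k] Module.End k W}
    (Θ : V →ₗ[k] W) (hE : ∀ v, Θ (ρ (gen q Gen.E) v) = σ (gen q Gen.E) (Θ v))
    (hF : ∀ v, Θ (ρ (gen q Gen.F) v) = σ (gen q Gen.F) (Θ v))
    (hK : ∀ v, Θ (ρ (gen q Gen.K) v) = σ (gen q Gen.K) (Θ v)) (X : Uq q) :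
    ∀ v, Θ (ρ X v) = σ X (Θ v) := by
  induction X using Uq_induction with
  | hgen g =>
    cases g with
    | E => exact hE
    | F => exact hF
    | K => exact hK
    | K' =>
      intro v
      rw [← apply_K'_K σ (Θ (ρ (gen q Gen.K') v)), ← hK, apply_K_K']
  | hscal c => intro v; simp [Algebra.algebraMap_eq_smul_one]
  | hadd X Y hX hY => intro v; simp [hX, hY]
  | hmul X Y hX hY => intro v; simp [hX, hY]

/-- The basis vector `v_j` of `V(m)`, indexed by all `j : ℕ` and zero for `j > m`. -/
def basisVec (k : Type) [Field k] (m j : ℕ) : Fin (m + 1) → k :=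
  fun i => if (i : ℕ) = j then 1 else 0

/-- The coordinate function `f^i` on `V(m)`, indexed by all `i : ℕ` and zero for `i > m`. -/
def coord (k : Type) [Field k] (m i : ℕ) : Module.Dual k (Fin (m + 1) → k) :=
  if h : i < m + 1 then LinearMap.proj ⟨i, h⟩ else 0

theorem coord_val (m : ℕ) (i : Fin (m + 1)) : coord k m i = LinearMap.proj i :=
  dif_pos i.isLt

theorem basisVec_val (m : ℕ) (i : Fin (m + 1)) : basisVec k m i = Pi.single i 1 := by
  ext j
  simp [basisVec, Pi.single_apply, Fin.ext_iff]

theorem basisVec_of_lt {m j : ℕ} (h : m < j) : basisVec k m j = 0 := by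
  ext i
  have := i.isLt
  simp [basisVec, show (i : ℕ) ≠ j by omega]

theorem coord_of_lt {m i : ℕ} (h : m < i) : coord k m i = 0 := by
  simp [coord, show ¬ i < m + 1 by omega]

theorem coord_basisVec (m i j : ℕ) :
    coord k m i (basisVec k m j) = if i = j ∧ i ≤ m then 1 else 0 := by
  by_cases h : i < m + 1
  · simp [coord, basisVec, h, Nat.lt_succ_iff.mp h]
  · simp [coord, h, show ¬ i ≤ m by omega]

theorem sum_coord_smul_basisVec (m : ℕ) (w : Fin (m + 1) → k) :
    ∑ i ∈ Finset.range (m + 1), coord k m i w • basisVec k m i = w := by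
  rw [Finset.sum_range]
  simp only [coord_val, basisVec_val, LinearMap.proj_apply]
  exact (pi_eq_sum_univ' w).symm

theorem linearMap_ext_basisVec {m : ℕ} {f g : (Fin (m + 1) → k) →ₗ[k] V}
    (h : ∀ j ≤ m, f (basisVec k m j) = g (basisVec k m j)) : f = g := by
  refine LinearMap.pi_ext' fun i => LinearMap.ext_ring ?_
  have := h i (by omega)
  simpa [basisVec_val] using this

theorem simpleModule_gen (hq : q ≠ 0) (m : ℕ) (g : Gen) : simpleModule hq m (gen q g) =
    genMap (simpleE q m) (simpleF q m) (simpleK q m 1) (simpleK q m (-1)) g :=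
  liftU_gen ..

theorem simpleModule_E_zero (hq : q ≠ 0) (m : ℕ) :
    simpleModule hq m (gen q Gen.E) (basisVec k m 0) = 0 := by
  rw [simpleModule_gen]
  ext i
  by_cases h : (i : ℕ) + 1 < m + 1
  · simp [genMap, simpleE_apply_pos _ _ _ _ h, basisVec]
  · simp [genMap, simpleE_apply_neg _ _ _ _ h]

theorem simpleModule_E_succ (hq : q ≠ 0) (m j : ℕ) :
    simpleModule hq m (gen q Gen.E) (basisVec k m (j + 1)) =
      qInt q ((m : ℤ) - j) • basisVec k m j := by
  rw [simpleModule_gen]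
  ext i
  by_cases h : (i : ℕ) + 1 < m + 1
  · by_cases hij : (i : ℕ) = j <;> simp [genMap, simpleE_apply_pos _ _ _ _ h, basisVec, hij]
  · by_cases hij : (i : ℕ) = j
    · have : j = m := by omega
      simp [genMap, simpleE_apply_neg _ _ _ _ h, this, qInt]
    · simp [genMap, simpleE_apply_neg _ _ _ _ h, basisVec, hij]

theorem simpleModule_F (hq : q ≠ 0) (m j : ℕ) :
    simpleModule hq m (gen q Gen.F) (basisVec k m j) =
      qInt q ((j : ℤ) + 1) • basisVec k m (j + 1) := by
  rw [simpleModule_gen]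
  ext i
  by_cases h : 0 < (i : ℕ)
  · by_cases hij : (i : ℕ) = j + 1
    · have : (i : ℕ) - 1 = j := by omega
      simp [genMap, simpleF_apply_pos _ _ _ _ h, basisVec, hij]
    · have : (i : ℕ) - 1 ≠ j := by omega
      simp [genMap, simpleF_apply_pos _ _ _ _ h, basisVec, hij, this]
  · have : (i : ℕ) = 0 := by omega
    simp [genMap, simpleF_apply_neg _ _ _ _ h, basisVec, this]

theorem simpleModule_K (hq : q ≠ 0) (m j : ℕ) :
    simpleModule hq m (gen q Gen.K) (basisVec k m j) =
      q ^ ((m : ℤ) - 2 * j) • basisVec k m j := by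
  rw [simpleModule_gen]
  ext i
  by_cases hij : (i : ℕ) = j <;> simp [genMap, simpleK_apply, basisVec, hij]

theorem simpleModule_K' (hq : q ≠ 0) (m j : ℕ) :
    simpleModule hq m (gen q Gen.K') (basisVec k m j) =
      q ^ (-((m : ℤ) - 2 * j)) • basisVec k m j := by
  rw [simpleModule_gen]
  ext i
  by_cases hij : (i : ℕ) = j
  · simp [genMap, simpleK_apply, basisVec, hij]
  · simp [genMap, simpleK_apply, basisVec, hij]

/-- The matrix coefficient `u^m_{ij}`, indexed by all `i j : ℕ` and zero out of range. -/
def matCoeff (hq : q ≠ 0) (m i j : ℕ) : Functional q :=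
  matrixCoeff (simpleModule hq m) (coord k m i) (basisVec k m j)

theorem uCoeff_eq (hq : q ≠ 0) (m : ℕ) (i j : Fin (m + 1)) :
    uCoeff hq m i j = matCoeff hq m i j := by
  rw [matCoeff, coord_val, basisVec_val, uCoeff]

theorem matCoeff_of_lt_left (hq : q ≠ 0) {m i : ℕ} (j : ℕ) (h : m < i) :
    matCoeff hq m i j = 0 := by
  rw [matCoeff, coord_of_lt h]; rfl

theorem matCoeff_of_lt_right (hq : q ≠ 0) {m j : ℕ} (i : ℕ) (h : m < j) :
    matCoeff hq m i j = 0 := by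
  refine WithConv.ext (LinearMap.ext fun X => ?_)
  change coord k m i (simpleModule hq m X (basisVec k m j)) = 0
  rw [basisVec_of_lt h, map_zero, map_zero]

/-- The sequence `x` satisfies the relations of the standard basis `v_0, …, v_m, 0, …` of `V(m)`:
`x 0` is singular of weight `m` and `x j = F⁽ʲ⁾ (x 0)`. -/
structure IsString (ρ : Uq q →ₐ[k] Module.End k V) (m : ℕ) (x : ℕ → V) : Prop where
  E_zero : ρ (gen q Gen.E) (x 0) = 0
  E_succ : ∀ j < m, ρ (gen q Gen.E) (x (j + 1)) = qInt q ((m : ℤ) - j) • x j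
  F_apply : ∀ j ≤ m, ρ (gen q Gen.F) (x j) = qInt q ((j : ℤ) + 1) • x (j + 1)
  K_apply : ∀ j ≤ m, ρ (gen q Gen.K) (x j) = q ^ ((m : ℤ) - 2 * j) • x j
  last : x (m + 1) = 0

/-- The linear map from `V(m)` sending `v_j` to `x j`. -/
def stringMap (m : ℕ) (x : ℕ → V) : (Fin (m + 1) → k) →ₗ[k] V :=
  ∑ i ∈ Finset.range (m + 1), (coord k m i).smulRight (x i)

theorem stringMap_basisVec (m : ℕ) (x : ℕ → V) {j : ℕ} (hj : j ≤ m) :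
    stringMap m x (basisVec k m j) = x j := by
  rw [stringMap, LinearMap.sum_apply, Finset.sum_eq_single j]
  · simp [coord_basisVec, hj]
  · intro b _ hb
    simp [coord_basisVec, hb]
  · intro h
    exact absurd (Finset.mem_range.mpr (by omega)) h

theorem IsString.intertwines (hq : q ≠ 0) {ρ : Uq q →ₐ[k] Module.End k V} {m : ℕ} {x : ℕ → V}
    (hx : IsString ρ m x) (X : Uq q) (w : Fin (m + 1) → k) :
    stringMap m x (simpleModule hq m X w) = ρ X (stringMap m x w) := by
  have key : ∀ g, (∀ j ≤ m, stringMap m x (simpleModule hq m (gen q g) (basisVec k m j)) =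
      ρ (gen q g) (x j)) → ∀ w, stringMap m x (simpleModule hq m (gen q g) w) =
      ρ (gen q g) (stringMap m x w) := by
    intro g h
    have he : stringMap m x ∘ₗ simpleModule hq m (gen q g) = ρ (gen q g) ∘ₗ stringMap m x := by
      refine linearMap_ext_basisVec fun j hj => ?_
      simp only [LinearMap.comp_apply, h j hj, stringMap_basisVec m x hj]
    exact LinearMap.congr_fun he
  refine intertwines_of_gen (stringMap m x) (key _ ?_) (key _ ?_) (key _ ?_) X w
  · intro j hj
    cases j with
    | zero => rw [simpleModule_E_zero, map_zero, hx.E_zero]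
    | succ j =>
      rw [simpleModule_E_succ, map_smul, stringMap_basisVec m x (by omega), hx.E_succ j (by omega)]
  · intro j hj
    rw [simpleModule_F, map_smul, hx.F_apply j hj]
    rcases Nat.lt_or_ge j m with h | h
    · rw [stringMap_basisVec m x (by omega)]
    · obtain rfl : j = m := by omega
      rw [basisVec_of_lt (Nat.lt_succ_self j), map_zero, hx.last]
  · intro j hj
    rw [simpleModule_K, map_smul, stringMap_basisVec m x hj, hx.K_apply j hj]

/-- A matrix coefficient at a vector of a string is a combination of the `u^m_{ij}`. -/
theorem IsString.matrixCoeff_eq_sum (hq : q ≠ 0) {ρ : Uq q →ₐ[k] Module.End k V} {m : ℕ}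
    {x : ℕ → V} (hx : IsString ρ m x) (f : Module.Dual k V) {j : ℕ} (hj : j ≤ m) :
    matrixCoeff ρ f (x j) = ∑ i ∈ Finset.range (m + 1), f (x i) • matCoeff hq m i j := by
  have hsum : ∀ X, (∑ i ∈ Finset.range (m + 1), f (x i) • matCoeff hq m i j : Functional q) X =
      ∑ i ∈ Finset.range (m + 1), f (x i) * matCoeff hq m i j X := by
    intro X
    induction Finset.range (m + 1) using Finset.induction_on with
    | empty => rfl
    | insert a s ha ih =>
      rw [Finset.sum_insert ha, Finset.sum_insert ha, ← ih]
      rfl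
  refine WithConv.ext (LinearMap.ext fun X => ?_)
  refine Eq.trans ?_ (hsum X).symm
  change f (ρ X (x j)) = _
  rw [← stringMap_basisVec (k := k) m x hj, ← hx.intertwines hq, stringMap, LinearMap.sum_apply,
    map_sum]
  refine Finset.sum_congr rfl fun i _ => ?_
  rw [LinearMap.smulRight_apply, map_smul, smul_eq_mul, mul_comm]
  rfl

end strings

/-! ### Relations between the matrix coefficients -/

section relations

variable {k : Type} [Field k] {q : k}
variable {V W : Type} [AddCommGroup V] [Module k V] [AddCommGroup W] [Module k W]

theorem tensorModule_E (ρ : Uq q →ₐ[k] Module.End k V) (σ : Uq q →ₐ[k] Module.End k W)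
    (v : V) (w : W) : tensorModule ρ σ (gen q Gen.E) (v ⊗ₜ w) =
      ρ (gen q Gen.E) v ⊗ₜ σ (gen q Gen.K') w + v ⊗ₜ σ (gen q Gen.E) w := by
  simp only [tensorModule, coprod, AlgHom.comp_apply, liftU_gen, genMap, map_add,
    Algebra.TensorProduct.map_tmul, map_one]
  rfl

theorem tensorModule_F (ρ : Uq q →ₐ[k] Module.End k V) (σ : Uq q →ₐ[k] Module.End k W)
    (v : V) (w : W) : tensorModule ρ σ (gen q Gen.F) (v ⊗ₜ w) =
      ρ (gen q Gen.F) v ⊗ₜ w + ρ (gen q Gen.K) v ⊗ₜ σ (gen q Gen.F) w := by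
  simp only [tensorModule, coprod, AlgHom.comp_apply, liftU_gen, genMap, map_add,
    Algebra.TensorProduct.map_tmul, map_one]
  rfl

theorem matrixCoeff_add_right (ρ : Uq q →ₐ[k] Module.End k V) (f : Module.Dual k V) (v w : V) :
    matrixCoeff ρ f (v + w) = matrixCoeff ρ f v + matrixCoeff ρ f w := by
  refine WithConv.ext (LinearMap.ext fun X => ?_)
  change f (ρ X (v + w)) = f (ρ X v) + f (ρ X w)
  rw [map_add, map_add]

theorem matrixCoeff_smul_right (ρ : Uq q →ₐ[k] Module.End k V) (f : Module.Dual k V) (c : k)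
    (v : V) : matrixCoeff ρ f (c • v) = c • matrixCoeff ρ f v := by
  refine WithConv.ext (LinearMap.ext fun X => ?_)
  change f (ρ X (c • v)) = c • f (ρ X v)
  rw [map_smul, map_smul]

/-- `f ⊗ g` as a functional on a tensor product. -/
def tensorDual (f : Module.Dual k V) (g : Module.Dual k W) : Module.Dual k (V ⊗[k] W) :=
  LinearMap.mul' k k ∘ₗ TensorProduct.map f g

theorem tensorDual_tmul (f : Module.Dual k V) (g : Module.Dual k W) (v : V) (w : W) :
    tensorDual f g (v ⊗ₜ w) = f v * g w := rfl

theorem matrixCoeff_tensorDual (ρ : Uq q →ₐ[k] Module.End k V) (σ : Uq q →ₐ[k] Module.End k W)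
    (f : Module.Dual k V) (g : Module.Dual k W) (v : V) (w : W) :
    matrixCoeff (tensorModule ρ σ) (tensorDual f g) (v ⊗ₜ w) =
      matrixCoeff ρ f v * matrixCoeff σ g w :=
  (matrixCoeff_mul ρ σ f g v w).symm

theorem qInt_succ (hq : q ≠ 0) (h2 : q - q⁻¹ ≠ 0) (s : ℤ) :
    q * qInt q s + q ^ (-s) = qInt q (s + 1) := by
  rw [qInt, qInt, eq_div_iff h2, add_mul, mul_assoc, div_mul_cancel₀ _ h2, neg_add,
    zpow_add₀ hq, zpow_add₀ hq, zpow_neg_one, zpow_one]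
  ring

theorem qInt_succ' (hq : q ≠ 0) (h2 : q - q⁻¹ ≠ 0) (s : ℤ) :
    q ^ s + q⁻¹ * qInt q s = qInt q (s + 1) := by
  rw [qInt, qInt, eq_div_iff h2, add_mul, mul_assoc, div_mul_cancel₀ _ h2, neg_add,
    zpow_add₀ hq, zpow_add₀ hq, zpow_neg_one, zpow_one]
  ring

theorem qInt_one (h2 : q - q⁻¹ ≠ 0) : qInt q 1 = 1 := by
  simp [qInt, div_self h2]

theorem qInt_zero : qInt q 0 = 0 := by
  simp [qInt]

/-- The vectors `F⁽ʲ⁾(v_0 ⊗ v_0) = q^j v_0 ⊗ v_j + v_1 ⊗ v_{j-1}` of `V(1) ⊗ V(m)`, which span a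
copy of `V(m + 1)`; the second summand is absent for `j = 0`. -/
def cgVec (q : k) (m : ℕ) : ℕ → (Fin 2 → k) ⊗[k] (Fin (m + 1) → k)
  | 0 => basisVec k 1 0 ⊗ₜ basisVec k m 0
  | j + 1 => q ^ (j + 1) • (basisVec k 1 0 ⊗ₜ basisVec k m (j + 1)) +
      basisVec k 1 1 ⊗ₜ basisVec k m j

theorem isString_cgVec (hq : q ≠ 0) (h2 : q - q⁻¹ ≠ 0) (m : ℕ) :
    IsString (tensorModule (simpleModule hq 1) (simpleModule hq m)) (m + 1) (cgVec q m) := by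
  have e10 : simpleModule hq 1 (gen q Gen.E) (basisVec k 1 0) = 0 := simpleModule_E_zero hq 1
  have e11 : simpleModule hq 1 (gen q Gen.E) (basisVec k 1 1) = basisVec k 1 0 := by
    simpa [qInt_one h2] using simpleModule_E_succ hq 1 0
  have f10 : simpleModule hq 1 (gen q Gen.F) (basisVec k 1 0) = basisVec k 1 1 := by
    simpa [qInt_one h2] using simpleModule_F hq 1 0
  have f11 : simpleModule hq 1 (gen q Gen.F) (basisVec k 1 1) = 0 := by
    rw [simpleModule_F, basisVec_of_lt (by norm_num), smul_zero]
  have k10 : simpleModule hq 1 (gen q Gen.K) (basisVec k 1 0) = q • basisVec k 1 0 := by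
    simpa using simpleModule_K hq 1 0
  have k11 : simpleModule hq 1 (gen q Gen.K) (basisVec k 1 1) = q⁻¹ • basisVec k 1 1 := by
    simpa using simpleModule_K hq 1 1
  refine ⟨?_, ?_, ?_, ?_, ?_⟩
  · rw [cgVec, tensorModule_E, e10, simpleModule_E_zero, TensorProduct.zero_tmul,
      TensorProduct.tmul_zero, add_zero]
  · intro j _
    rw [cgVec, map_add, map_smul, tensorModule_E, tensorModule_E, e10, e11, simpleModule_E_succ,
      simpleModule_K' hq m j, TensorProduct.zero_tmul, zero_add]
    have key := qInt_succ hq h2 ((m : ℤ) - j)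
    have hs : qInt q (((m + 1 : ℕ) : ℤ) - j) = qInt q ((m : ℤ) - j + 1) := by
      congr 1; push_cast; ring
    cases j with
    | zero =>
      rw [simpleModule_E_zero, cgVec, hs, ← key]
      simp [TensorProduct.tmul_smul, smul_smul, add_smul]
    | succ j =>
      have e3 : q ^ (-((m : ℤ) - 2 * ((j + 1 : ℕ) : ℤ))) =
          q ^ (j + 1) * q ^ (-((m : ℤ) - ((j + 1 : ℕ) : ℤ))) := by
        rw [← zpow_natCast, ← zpow_add₀ hq]; congr 1; push_cast; ring
      have hs2 : qInt q ((m : ℤ) - j) = qInt q ((m : ℤ) - ((j + 1 : ℕ) : ℤ) + 1) := by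
        congr 1; push_cast; ring
      rw [simpleModule_E_succ, cgVec, hs, hs2, ← key, e3, TensorProduct.tmul_smul,
        TensorProduct.tmul_smul, TensorProduct.tmul_smul]
      module
  · intro j _
    cases j with
    | zero =>
      simp only [cgVec, tensorModule_F, f10, k10, simpleModule_F, TensorProduct.tmul_smul,
        ← TensorProduct.smul_tmul']
      simp [qInt_one h2, add_comm]
    | succ j =>
      have key := qInt_succ' hq h2 ((j : ℤ) + 1)
      have e3 : q ^ ((j : ℤ) + 1) = q ^ (j + 1) := by rw [← zpow_natCast]; push_cast; rfl
      simp only [cgVec, map_add, map_smul, tensorModule_F, f10, f11, k10, k11, simpleModule_F,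
        TensorProduct.tmul_smul, ← TensorProduct.smul_tmul', TensorProduct.zero_tmul]
      push_cast
      rw [← key, e3]
      module
  · intro j _
    cases j with
    | zero =>
      simp only [cgVec, tensorModule_K, k10, simpleModule_K, TensorProduct.tmul_smul,
        ← TensorProduct.smul_tmul', smul_smul]
      congr 1
      rw [← zpow_add_one₀ hq]
      congr 1
    | succ j =>
      simp only [cgVec, map_add, map_smul, tensorModule_K, k10, k11, simpleModule_K,
        TensorProduct.tmul_smul, ← TensorProduct.smul_tmul', smul_smul, smul_add]
      have e1 : q ^ (((m + 1 : ℕ) : ℤ) - 2 * ((j + 1 : ℕ) : ℤ)) =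
          q ^ ((m : ℤ) - 2 * ((j + 1 : ℕ) : ℤ)) * q := by
        rw [← zpow_add_one₀ hq]; congr 1; push_cast; ring
      have e2 : q ^ (((m + 1 : ℕ) : ℤ) - 2 * ((j + 1 : ℕ) : ℤ)) =
          q ^ ((m : ℤ) - 2 * (j : ℤ)) * q⁻¹ := by
        rw [← zpow_sub_one₀ hq]; congr 1; push_cast; ring
      congr 2
      · rw [e1]; ring
      · rw [e2]
  · rw [cgVec, basisVec_of_lt (j := m + 1 + 1) (by omega), basisVec_of_lt (j := m + 1) (by omega)]
    simp

theorem tensorDual_zero_cgVec (m i j : ℕ) : tensorDual (coord k 1 0) (coord k m i) (cgVec q m j) =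
    if i = j ∧ i ≤ m then q ^ j else 0 := by
  cases j <;> simp [cgVec, tensorDual_tmul, coord_basisVec]

theorem tensorDual_one_cgVec (m i j : ℕ) : tensorDual (coord k 1 1) (coord k m i) (cgVec q m j) =
    if i + 1 = j ∧ i ≤ m then 1 else 0 := by
  cases j <;> simp [cgVec, tensorDual_tmul, coord_basisVec]

theorem sum_ite_smul {M : Type} [AddCommGroup M] [Module k M] (n a : ℕ) (p : Prop) [Decidable p]
    (h : p → a < n) (c : ℕ → k) (x : ℕ → M) :
    ∑ i ∈ Finset.range n, (if a = i ∧ p then c i else 0) • x i = if p then c a • x a else 0 := by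
  by_cases hp : p
  · rw [Finset.sum_eq_single a]
    · simp [hp]
    · intro b _ hb; simp [hb.symm]
    · intro hn; exact absurd (Finset.mem_range.mpr (h hp)) hn
  · simp [hp]

/-- The functional `f^0 ⊗ f^i` restricts to `q^i f^i` on the copy of `V(m + 1)` in
`V(1) ⊗ V(m)`. -/
theorem matCoeff_row_zero (hq : q ≠ 0) (h2 : q - q⁻¹ ≠ 0) {m i j : ℕ} (hi : i ≤ m)
    (hj : j ≤ m + 1) :
    q ^ i • matCoeff hq (m + 1) i j =
      matrixCoeff (tensorModule (simpleModule hq 1) (simpleModule hq m))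
        (tensorDual (coord k 1 0) (coord k m i)) (cgVec q m j) := by
  rw [(isString_cgVec hq h2 m).matrixCoeff_eq_sum hq _ hj]
  simp only [tensorDual_zero_cgVec]
  rw [sum_ite_smul _ i (i ≤ m) (fun h => by omega) (fun j => q ^ j), if_pos hi]

/-- The functional `f^1 ⊗ f^i` restricts to `f^{i+1}` on the copy of `V(m + 1)` in
`V(1) ⊗ V(m)`. -/
theorem matCoeff_row_one (hq : q ≠ 0) (h2 : q - q⁻¹ ≠ 0) {m i j : ℕ} (hi : i ≤ m)
    (hj : j ≤ m + 1) :
    matCoeff hq (m + 1) (i + 1) j =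
      matrixCoeff (tensorModule (simpleModule hq 1) (simpleModule hq m))
        (tensorDual (coord k 1 1) (coord k m i)) (cgVec q m j) := by
  rw [(isString_cgVec hq h2 m).matrixCoeff_eq_sum hq _ hj]
  simp only [tensorDual_one_cgVec]
  rw [sum_ite_smul _ (i + 1) (i ≤ m) (fun h => by omega) (fun _ => 1), if_pos hi, one_smul]

theorem matCoeff_low_zero (hq : q ≠ 0) (h2 : q - q⁻¹ ≠ 0) {m i : ℕ} (hi : i ≤ m) :
    q ^ i • matCoeff hq (m + 1) i 0 = matCoeff hq 1 0 0 * matCoeff hq m i 0 := by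
  rw [matCoeff_row_zero hq h2 hi (Nat.zero_le _), cgVec]
  exact matrixCoeff_tensorDual ..

theorem matCoeff_low_succ (hq : q ≠ 0) (h2 : q - q⁻¹ ≠ 0) {m i j : ℕ} (hi : i ≤ m) (hj : j ≤ m) :
    q ^ i • matCoeff hq (m + 1) i (j + 1) = q ^ (j + 1) •
      (matCoeff hq 1 0 0 * matCoeff hq m i (j + 1)) + matCoeff hq 1 0 1 * matCoeff hq m i j := by
  rw [matCoeff_row_zero hq h2 hi (by omega), cgVec, matrixCoeff_add_right, matrixCoeff_smul_right]
  rw [matrixCoeff_tensorDual, matrixCoeff_tensorDual]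
  rfl

theorem matCoeff_succ_zero (hq : q ≠ 0) (h2 : q - q⁻¹ ≠ 0) {m i : ℕ} (hi : i ≤ m) :
    matCoeff hq (m + 1) (i + 1) 0 = matCoeff hq 1 1 0 * matCoeff hq m i 0 := by
  rw [matCoeff_row_one hq h2 hi (Nat.zero_le _), cgVec]
  exact matrixCoeff_tensorDual ..

theorem matCoeff_succ_succ (hq : q ≠ 0) (h2 : q - q⁻¹ ≠ 0) {m i j : ℕ} (hi : i ≤ m) (hj : j ≤ m) :
    matCoeff hq (m + 1) (i + 1) (j + 1) = q ^ (j + 1) •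
      (matCoeff hq 1 1 0 * matCoeff hq m i (j + 1)) + matCoeff hq 1 1 1 * matCoeff hq m i j := by
  rw [matCoeff_row_one hq h2 hi (by omega), cgVec, matrixCoeff_add_right, matrixCoeff_smul_right]
  rw [matrixCoeff_tensorDual, matrixCoeff_tensorDual]
  rfl

theorem matCoeff_zero (hq : q ≠ 0) : matCoeff hq 0 0 0 = 1 := by
  have key : ∀ X : Uq q, simpleModule hq 0 X (basisVec k 0 0) = counitHom q X • basisVec k 0 0 := by
    have hg : ∀ g, simpleModule hq 0 (gen q g) (basisVec k 0 0) =
        counitHom q (gen q g) • basisVec k 0 0 := by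
      intro g
      have hc : counitHom q (gen q g) = genMap 0 0 1 1 g := liftU_gen ..
      cases g
      · rw [simpleModule_E_zero, hc]; simp [genMap]
      · rw [simpleModule_F, hc, basisVec_of_lt (by norm_num)]; simp [genMap]
      · rw [simpleModule_K, hc]; simp [genMap]
      · rw [simpleModule_K', hc]; simp [genMap]
    intro X
    induction X using Uq_induction with
    | hgen g => exact hg g
    | hscal c => simp [Algebra.algebraMap_eq_smul_one]
    | hadd X Y hX hY => rw [map_add, LinearMap.add_apply, hX, hY, map_add, add_smul]
    | hmul X Y hX hY =>
      rw [map_mul, Module.End.mul_apply, hY, map_smul, hX, map_mul, smul_smul, mul_comm]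
  refine WithConv.ext (LinearMap.ext fun X => ?_)
  change coord k 0 0 (simpleModule hq 0 X (basisVec k 0 0)) = counitHom q X
  rw [key, map_smul, coord_basisVec]
  simp

/-- The invariant vector `v_0 ⊗ v_1 - q v_1 ⊗ v_0` of `V(1) ⊗ V(1)`, followed by zeros. -/
def invariantVec (q : k) : ℕ → (Fin 2 → k) ⊗[k] (Fin 2 → k)
  | 0 => basisVec k 1 0 ⊗ₜ basisVec k 1 1 + (-q) • (basisVec k 1 1 ⊗ₜ basisVec k 1 0)
  | _ + 1 => 0

theorem isString_invariantVec (hq : q ≠ 0) (h2 : q - q⁻¹ ≠ 0) :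
    IsString (tensorModule (simpleModule hq 1) (simpleModule hq 1)) 0 (invariantVec q) := by
  have e10 : simpleModule hq 1 (gen q Gen.E) (basisVec k 1 0) = 0 := simpleModule_E_zero hq 1
  have e11 : simpleModule hq 1 (gen q Gen.E) (basisVec k 1 1) = basisVec k 1 0 := by
    simpa [qInt_one h2] using simpleModule_E_succ hq 1 0
  have f10 : simpleModule hq 1 (gen q Gen.F) (basisVec k 1 0) = basisVec k 1 1 := by
    simpa [qInt_one h2] using simpleModule_F hq 1 0
  have f11 : simpleModule hq 1 (gen q Gen.F) (basisVec k 1 1) = 0 := by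
    rw [simpleModule_F, basisVec_of_lt (by norm_num), smul_zero]
  have k10 : simpleModule hq 1 (gen q Gen.K) (basisVec k 1 0) = q • basisVec k 1 0 := by
    simpa using simpleModule_K hq 1 0
  have k11 : simpleModule hq 1 (gen q Gen.K) (basisVec k 1 1) = q⁻¹ • basisVec k 1 1 := by
    simpa using simpleModule_K hq 1 1
  have k10' : simpleModule hq 1 (gen q Gen.K') (basisVec k 1 0) = q⁻¹ • basisVec k 1 0 := by
    simpa using simpleModule_K' hq 1 0
  refine ⟨?_, fun j hj => absurd hj (by omega), ?_, ?_, rfl⟩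
  · simp only [invariantVec, map_add, map_smul, tensorModule_E, e10, e11, k10',
      TensorProduct.zero_tmul, TensorProduct.tmul_zero, TensorProduct.tmul_smul, add_zero, zero_add]
    rw [smul_smul, neg_mul, mul_inv_cancel₀ hq]
    module
  · intro j hj
    obtain rfl : j = 0 := by omega
    simp only [invariantVec, map_add, map_smul, tensorModule_F, f10, f11, k11, smul_zero,
      TensorProduct.zero_tmul, TensorProduct.tmul_zero, ← TensorProduct.smul_tmul', add_zero,
      zero_add]
    rw [smul_smul, neg_mul, mul_inv_cancel₀ hq]
    module
  · intro j hj
    obtain rfl : j = 0 := by omega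
    simp only [invariantVec, map_add, map_smul, tensorModule_K, k10, k11,
      TensorProduct.tmul_smul, ← TensorProduct.smul_tmul', smul_smul, mul_inv_cancel₀ hq,
      inv_mul_cancel₀ hq]
    simp only [Nat.cast_zero, mul_zero, sub_zero, zpow_zero, one_smul, mul_one]

/-- The matrix coefficients at an invariant vector are multiples of the unit. The four choices of
`i, j` include the commutation relation of `α` and `β` and the determinant relations. -/
theorem matCoeff_one_invariant (hq : q ≠ 0) (h2 : q - q⁻¹ ≠ 0) (i j : ℕ) :
    matCoeff hq 1 i 0 * matCoeff hq 1 j 1 - q • (matCoeff hq 1 i 1 * matCoeff hq 1 j 0) =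
      tensorDual (coord k 1 i) (coord k 1 j) (invariantVec q 0) • (1 : Functional q) := by
  have key := (isString_invariantVec hq h2).matrixCoeff_eq_sum hq
    (tensorDual (coord k 1 i) (coord k 1 j)) (j := 0) le_rfl
  rw [Finset.sum_range_one, matCoeff_zero] at key
  rw [← key, invariantVec, sub_eq_add_neg, ← neg_smul,
    matrixCoeff_add_right, matrixCoeff_smul_right, matrixCoeff_tensorDual, matrixCoeff_tensorDual]
  rfl

/-- `αβ = qβα`. -/
theorem alpha_mul_beta (hq : q ≠ 0) (h2 : q - q⁻¹ ≠ 0) :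
    matCoeff hq 1 0 0 * matCoeff hq 1 0 1 = q • (matCoeff hq 1 0 1 * matCoeff hq 1 0 0) := by
  have := matCoeff_one_invariant hq h2 0 0
  rw [show tensorDual (coord k 1 0) (coord k 1 0) (invariantVec q 0) = 0 by
    simp [invariantVec, tensorDual_tmul, coord_basisVec], zero_smul, sub_eq_zero] at this
  exact this

/-- `δα = 1 + q⁻¹γβ`. -/
theorem delta_mul_alpha (hq : q ≠ 0) (h2 : q - q⁻¹ ≠ 0) :
    matCoeff hq 1 1 1 * matCoeff hq 1 0 0 = 1 + q⁻¹ • (matCoeff hq 1 1 0 * matCoeff hq 1 0 1) := by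
  have := matCoeff_one_invariant hq h2 1 0
  rw [show tensorDual (coord k 1 1) (coord k 1 0) (invariantVec q 0) = -q by
    simp [invariantVec, tensorDual_tmul, coord_basisVec]] at this
  rw [sub_eq_iff_eq_add.mp this, smul_add, smul_smul, smul_smul, mul_neg, inv_mul_cancel₀ hq]
  module

/-- `αδ = 1 + qβγ`. -/
theorem alpha_mul_delta (hq : q ≠ 0) (h2 : q - q⁻¹ ≠ 0) :
    matCoeff hq 1 0 0 * matCoeff hq 1 1 1 = 1 + q • (matCoeff hq 1 0 1 * matCoeff hq 1 1 0) := by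
  have := matCoeff_one_invariant hq h2 0 1
  rw [show tensorDual (coord k 1 0) (coord k 1 1) (invariantVec q 0) = 1 by
    simp [invariantVec, tensorDual_tmul, coord_basisVec], one_smul] at this
  rw [← this]; abel

/-- `αγ = qγα`. -/
theorem alpha_mul_gamma (hq : q ≠ 0) (h2 : q - q⁻¹ ≠ 0) :
    matCoeff hq 1 0 0 * matCoeff hq 1 1 0 = q • (matCoeff hq 1 1 0 * matCoeff hq 1 0 0) := by
  rw [← matCoeff_low_zero hq h2 le_rfl, ← matCoeff_succ_zero hq h2 (Nat.zero_le _), pow_one]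

/-- `βγ = γβ`. -/
theorem beta_mul_gamma (hq : q ≠ 0) (h2 : q - q⁻¹ ≠ 0) (h3 : q * q + 1 ≠ 0) :
    matCoeff hq 1 0 1 * matCoeff hq 1 1 0 = matCoeff hq 1 1 0 * matCoeff hq 1 0 1 := by
  -- Compare the two recursions for `u²₁₁`.
  have e1 := matCoeff_low_succ hq h2 (m := 1) (i := 1) (j := 0) le_rfl (Nat.zero_le _)
  have e2 := matCoeff_succ_succ hq h2 (m := 1) (i := 0) (j := 0) (Nat.zero_le _) (Nat.zero_le _)
  rw [zero_add] at e1 e2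
  rw [e2, alpha_mul_delta hq h2, delta_mul_alpha hq h2, pow_one] at e1
  set x := matCoeff hq 1 0 1 * matCoeff hq 1 1 0
  set y := matCoeff hq 1 1 0 * matCoeff hq 1 0 1
  have e3 : (q * q + 1) • (x - y) = 0 := by
    calc (q * q + 1) • (x - y) = (q • (1 + q • x) + x) -
        (q • (q • y + (1 + q⁻¹ • y)) + (1 - q * q⁻¹) • y) := by module
      _ = 0 := by rw [← e1, mul_inv_cancel₀ hq, sub_self, zero_smul, add_zero, sub_self]
  exact sub_eq_zero.mp ((smul_eq_zero.mp e3).resolve_left h3)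

end relations

/-! ### Finite-dimensional integrable modules -/

section integrable

variable {k : Type} [Field k] {q : k}

/-- The parameter `q` is non-zero and not a root of unity. -/
structure IsGeneric (q : k) : Prop where
  ne_zero : q ≠ 0
  pow_ne_one : ∀ n : ℕ, 0 < n → q ^ n ≠ 1

namespace IsGeneric

theorem zpow_ne_one (h : IsGeneric q) {n : ℤ} (hn : n ≠ 0) : q ^ n ≠ 1 := by
  obtain ⟨m, rfl | rfl⟩ := n.eq_nat_or_neg
  · rw [zpow_natCast]; exact h.pow_ne_one m (by omega)
  · rw [zpow_neg, zpow_natCast, Ne, inv_eq_one]; exact h.pow_ne_one m (by omega)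

theorem zpow_injective (h : IsGeneric q) : Function.Injective fun n : ℤ => q ^ n := by
  intro a b hab
  by_contra hne
  refine h.zpow_ne_one (sub_ne_zero.mpr hne) ?_
  rw [zpow_sub₀ h.ne_zero]
  exact div_eq_one_iff_eq (zpow_ne_zero _ h.ne_zero) |>.mpr hab

theorem sub_inv_ne_zero (h : IsGeneric q) : q - q⁻¹ ≠ 0 := by
  intro h0
  have : q ^ (1 : ℤ) = q ^ (-1 : ℤ) := by rw [zpow_one, zpow_neg_one]; exact sub_eq_zero.mp h0
  exact absurd (h.zpow_injective this) (by norm_num)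

theorem qInt_ne_zero (h : IsGeneric q) {n : ℤ} (hn : n ≠ 0) : qInt q n ≠ 0 := by
  refine div_ne_zero (fun h0 => ?_) h.sub_inv_ne_zero
  exact absurd (h.zpow_injective (sub_eq_zero.mp h0)) (by omega)

end IsGeneric

variable {V : Type} [AddCommGroup V] [Module k V] {ρ : Uq q →ₐ[k] Module.End k V}

theorem mem_weightSpace {n : ℤ} {v : V} :
    v ∈ weightSpace ρ n ↔ ρ (gen q Gen.K) v = q ^ n • v :=
  Module.End.mem_eigenspace_iff

theorem E_mem_weightSpace (hq : q ≠ 0) {n : ℤ} {v : V} (hv : v ∈ weightSpace ρ n) :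
    ρ (gen q Gen.E) v ∈ weightSpace ρ (n + 2) := by
  rw [mem_weightSpace] at *
  rw [← Module.End.mul_apply, ← map_mul, gen_K_E, map_smul, map_mul, LinearMap.smul_apply,
    Module.End.mul_apply, hv, map_smul, smul_smul, zpow_add₀ hq, mul_comm]
  norm_cast

theorem F_mem_weightSpace (hq : q ≠ 0) {n : ℤ} {v : V} (hv : v ∈ weightSpace ρ n) :
    ρ (gen q Gen.F) v ∈ weightSpace ρ (n - 2) := by
  rw [mem_weightSpace] at *
  have h : q ^ 2 • ρ (gen q Gen.K) (ρ (gen q Gen.F) v) = q ^ n • ρ (gen q Gen.F) v := by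
    rw [← map_smul (ρ (gen q Gen.F)), ← hv, ← Module.End.mul_apply, ← Module.End.mul_apply,
      ← map_mul, ← map_mul, gen_F_K, map_smul, LinearMap.smul_apply]
  rw [zpow_sub₀ hq, div_eq_inv_mul, ← smul_smul, ← h, smul_smul]
  have : (q ^ (2 : ℤ))⁻¹ * q ^ 2 = 1 := by
    rw [← zpow_natCast]; exact inv_mul_cancel₀ (zpow_ne_zero 2 hq)
  rw [this, one_smul]

theorem K'_apply_of_mem (hq : q ≠ 0) {n : ℤ} {v : V} (hv : v ∈ weightSpace ρ n) :
    ρ (gen q Gen.K') v = q ^ (-n) • v := by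
  rw [mem_weightSpace] at hv
  have := apply_K'_K ρ v
  rw [hv, map_smul] at this
  calc ρ (gen q Gen.K') v = q ^ (-n) • q ^ n • ρ (gen q Gen.K') v := by
        rw [smul_smul, ← zpow_add₀ hq, neg_add_cancel, zpow_zero, one_smul]
    _ = _ := by rw [this]

theorem E_F_apply (hq : q ≠ 0) {n : ℤ} {v : V} (hv : v ∈ weightSpace ρ n) :
    ρ (gen q Gen.E) (ρ (gen q Gen.F) v) =
      ρ (gen q Gen.F) (ρ (gen q Gen.E) v) + qInt q n • v := by
  have h := congrArg (fun X => ρ X v) (gen_E_F q)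
  simp only [map_sub, map_smul, map_mul, LinearMap.sub_apply, LinearMap.smul_apply,
    Module.End.mul_apply] at h
  rw [K'_apply_of_mem hq hv, mem_weightSpace.mp hv, ← sub_smul, smul_smul] at h
  rw [qInt, div_eq_inv_mul, ← h]
  abel

theorem F_pow_mem_weightSpace (hq : q ≠ 0) {n : ℤ} {v : V} (hv : v ∈ weightSpace ρ n) (j : ℕ) :
    (ρ (gen q Gen.F) ^ j) v ∈ weightSpace ρ (n - 2 * j) := by
  induction j with
  | zero => simpa using hv
  | succ j ih =>
    rw [pow_succ', Module.End.mul_apply]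
    have := F_mem_weightSpace hq ih
    rwa [show n - 2 * (j : ℤ) - 2 = n - 2 * ((j + 1 : ℕ) : ℤ) by push_cast; ring] at this

theorem E_F_pow_apply (hq : q ≠ 0) {n : ℤ} {v : V} (hv : v ∈ weightSpace ρ n) (j : ℕ) :
    ρ (gen q Gen.E) ((ρ (gen q Gen.F) ^ (j + 1)) v) =
      (ρ (gen q Gen.F) ^ (j + 1)) (ρ (gen q Gen.E) v) +
        (qInt q ((j : ℤ) + 1) * qInt q (n - j)) • (ρ (gen q Gen.F) ^ j) v := by
  induction j with
  | zero =>
    have h1 : qInt q 1 • qInt q n • v = qInt q n • v := by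
      by_cases h2 : q - q⁻¹ = 0
      · simp [qInt, h2]
      · rw [qInt_one h2, one_smul]
    simp [E_F_apply hq hv, ← smul_smul, h1]
  | succ j ih =>
    have key := qInt_identity hq ((j : ℤ) + 1) n
    rw [pow_succ' _ (j + 1), Module.End.mul_apply, E_F_apply hq (F_pow_mem_weightSpace hq hv _),
      ih, map_add, map_smul, Module.End.mul_apply, add_assoc,
      ← Module.End.mul_apply _ (ρ (gen q Gen.F) ^ j) v, ← pow_succ', ← add_smul]
    congr 2
    have e : qInt q (n - 2 * ((j + 1 : ℕ) : ℤ)) = (q - q⁻¹)⁻¹ *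
        (q ^ (n - 2 * ((j : ℤ) + 1)) - q ^ (-(n - 2 * ((j : ℤ) + 1)))) := by
      rw [qInt, div_eq_inv_mul]; push_cast; rfl
    rw [e, ← key]
    push_cast
    rw [show n - ((j : ℤ) + 1) + 1 = n - j by ring]
    ring

theorem divPowF_zero (ρ : Uq q →ₐ[k] Module.End k V) (v : V) : divPowF ρ 0 v = v := by
  simp [divPowF, qFactorial]

theorem F_divPowF (h : IsGeneric q) (ρ : Uq q →ₐ[k] Module.End k V) (j : ℕ) (v : V) :
    ρ (gen q Gen.F) (divPowF ρ j v) = qInt q ((j : ℤ) + 1) • divPowF ρ (j + 1) v := by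
  have h1 := h.qInt_ne_zero (n := (j : ℤ) + 1) (by omega)
  rw [divPowF, divPowF, LinearMap.smul_apply, LinearMap.smul_apply, map_smul, pow_succ',
    Module.End.mul_apply, smul_smul, qFactorial, qFactorial, Finset.prod_range_succ, mul_inv,
    mul_comm _ (qInt q ((j : ℤ) + 1))⁻¹, ← mul_assoc, mul_inv_cancel₀ h1, one_mul]

theorem divPowF_mem_weightSpace (hq : q ≠ 0) {n : ℤ} {v : V} (hv : v ∈ weightSpace ρ n) (j : ℕ) :
    divPowF ρ j v ∈ weightSpace ρ (n - 2 * j) :=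
  Submodule.smul_mem _ _ (F_pow_mem_weightSpace hq hv j)

theorem E_divPowF (h : IsGeneric q) {n : ℤ} {v : V} (hv : v ∈ weightSpace ρ n)
    (hE : ρ (gen q Gen.E) v = 0) (j : ℕ) :
    ρ (gen q Gen.E) (divPowF ρ (j + 1) v) = qInt q (n - j) • divPowF ρ j v := by
  have h1 := h.qInt_ne_zero (n := (j : ℤ) + 1) (by omega)
  rw [divPowF, divPowF, LinearMap.smul_apply, LinearMap.smul_apply, map_smul,
    E_F_pow_apply h.ne_zero hv, hE, map_zero, zero_add, smul_smul, smul_smul]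
  congr 1
  rw [qFactorial, qFactorial, Finset.prod_range_succ, mul_inv]
  field_simp

/-- Only finitely many weights occur. -/
theorem exists_weightSpace_eq_bot (h : IsGeneric q) [Module.Finite k V]
    (ρ : Uq q →ₐ[k] Module.End k V) : ∃ M : ℕ, ∀ n : ℤ, M ≤ n.natAbs → weightSpace ρ n = ⊥ := by
  have hfin : {n : ℤ | weightSpace ρ n ≠ ⊥}.Finite := by
    refine Set.Finite.of_finite_image (f := fun n : ℤ => q ^ n) ?_ h.zpow_injective.injOn
    refine (Module.End.finite_hasEigenvalue (ρ (gen q Gen.K))).subset ?_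
    rintro _ ⟨n, hn, rfl⟩
    exact hn
  obtain ⟨M, hM⟩ := (hfin.image fun n => n.natAbs).bddAbove
  refine ⟨M + 1, fun n hn => ?_⟩
  by_contra hne
  have := hM ⟨n, hne, rfl⟩
  simp only at this
  omega

theorem exists_F_pow_eq_zero (h : IsGeneric q) [Module.Finite k V] {n : ℤ} {v : V}
    (hv : v ∈ weightSpace ρ n) : ∃ N : ℕ, (ρ (gen q Gen.F) ^ N) v = 0 := by
  obtain ⟨M, hM⟩ := exists_weightSpace_eq_bot h ρ
  refine ⟨M + n.natAbs, ?_⟩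
  have := F_pow_mem_weightSpace h.ne_zero hv (M + n.natAbs)
  rw [hM _ (by omega)] at this
  exact (Submodule.mem_bot k).mp this

/-- A non-zero singular vector has a natural number `m` as its weight and generates a copy of
`V(m)`. -/
theorem exists_isString (h : IsGeneric q) [Module.Finite k V] {p : ℤ} {u : V}
    (hu : u ∈ weightSpace ρ p) (hE : ρ (gen q Gen.E) u = 0) (h0 : u ≠ 0) :
    ∃ m : ℕ, p = m ∧ IsString ρ m fun j => divPowF ρ j u := by
  have hex : ∃ N, divPowF ρ N u = 0 := by
    obtain ⟨N, hN⟩ := exists_F_pow_eq_zero h hu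
    exact ⟨N, by rw [divPowF, LinearMap.smul_apply, hN, smul_zero]⟩
  classical
  obtain ⟨m, hm⟩ : ∃ m, Nat.find hex = m + 1 := Nat.exists_eq_succ_of_ne_zero fun hz => by
    have := Nat.find_spec hex
    rw [hz, divPowF_zero] at this
    exact h0 this
  have hlast : divPowF ρ (m + 1) u = 0 := hm ▸ Nat.find_spec hex
  have hne : divPowF ρ m u ≠ 0 := Nat.find_min hex (by omega)
  have hpm : p = m := by
    have := E_divPowF h hu hE m
    rw [hlast, map_zero] at this
    by_contra hp
    exact (smul_ne_zero (h.qInt_ne_zero (sub_ne_zero.mpr hp)) hne) this.symm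
  refine ⟨m, hpm, ⟨?_, fun j _ => ?_, fun j _ => F_divPowF h ρ j u, fun j _ => ?_, hlast⟩⟩
  · rw [divPowF_zero, hE]
  · rw [E_divPowF h hu hE, hpm]
  · rw [mem_weightSpace.mp (divPowF_mem_weightSpace h.ne_zero hu j), hpm]

/-- On a negative weight space the operator `FE` is injective. -/
theorem eq_zero_of_F_E_eq_zero (h : IsGeneric q) [Module.Finite k V] {n : ℤ} (hn : n < 0) {w : V}
    (hw : w ∈ weightSpace ρ n) (hFE : ρ (gen q Gen.F) (ρ (gen q Gen.E) w) = 0) : w = 0 := by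
  by_contra h0
  obtain ⟨N, hN⟩ := exists_F_pow_eq_zero h hw
  -- `E F^{j+1} w` is a non-zero multiple of `F^j w`, so no power of `F` kills `w`.
  have hne : ∀ j, (ρ (gen q Gen.F) ^ j) w ≠ 0 := by
    intro j
    induction j with
    | zero => simpa using h0
    | succ j ih =>
      intro hz
      have := E_F_pow_apply h.ne_zero hw j
      rw [hz, map_zero, pow_succ, Module.End.mul_apply, hFE, map_zero, zero_add] at this
      exact smul_ne_zero (mul_ne_zero (h.qInt_ne_zero (by omega)) (h.qInt_ne_zero (by omega))) ih
        this.symm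
  exact hne N hN

/-- Every weight vector is a sum of vectors `F⁽ⁱ⁾ u_i` with `u_i` singular; moreover
`F⁽ⁱ⁾ u_i ≠ 0` whenever `u_i ≠ 0`. -/
theorem exists_string_decomposition (h : IsGeneric q) [Module.Finite k V] {n : ℤ} {v : V}
    (hv : v ∈ weightSpace ρ n) : ∃ (N : ℕ) (u : ℕ → V),
      (∀ i : ℕ, u i ∈ weightSpace ρ (n + 2 * i) ∧ ρ (gen q Gen.E) (u i) = 0 ∧
        (u i ≠ 0 → divPowF ρ i (u i) ≠ 0)) ∧
      v = ∑ i ∈ Finset.range N, divPowF ρ i (u i) := by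
  obtain ⟨M, hM⟩ := exists_weightSpace_eq_bot h ρ
  obtain ⟨d, hd⟩ : ∃ d : ℕ, (M : ℤ) ≤ n + 2 * d := ⟨M + n.natAbs, by omega⟩
  induction d generalizing n v with
  | zero =>
    rw [hM n (by omega), Submodule.mem_bot] at hv
    exact ⟨0, fun _ => 0, by simp, by simp [hv]⟩
  | succ d ih =>
    obtain ⟨N, u, hu, hsum⟩ := ih (E_mem_weightSpace h.ne_zero hv) (by push_cast at hd; omega)
    -- The claim holds for `E v`, whose weight is closer to the upper bound of the weights.
    -- Lift each summand of `E v` to `F⁽ⁱ⁺¹⁾ x_i`; this is possible unless `n + 2 + i = 0`.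
    let x : ℕ → V := fun i => (qInt q (n + 2 + i))⁻¹ • u i
    have hxw : ∀ i : ℕ, x i ∈ weightSpace ρ (n + 2 + 2 * i) :=
      fun i => Submodule.smul_mem _ _ (hu i).1
    have hxE : ∀ i, ρ (gen q Gen.E) (x i) = 0 := fun i => by
      simp only [x, map_smul, (hu i).2.1, smul_zero]
    have hEx : ∀ i, ρ (gen q Gen.E) (divPowF ρ (i + 1) (x i)) =
        if n + 2 + i = 0 then 0 else divPowF ρ i (u i) := by
      intro i
      rw [E_divPowF h (hxw i) (hxE i), show n + 2 + 2 * (i : ℤ) - i = n + 2 + i by ring]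
      split_ifs with hi
      · rw [hi, qInt_zero, zero_smul]
      · simp only [x, map_smul]
        rw [smul_smul, mul_inv_cancel₀ (h.qInt_ne_zero hi), one_smul]
    set w : V := v - ∑ i ∈ Finset.range N, divPowF ρ (i + 1) (x i) with hw
    have hww : w ∈ weightSpace ρ n := by
      refine Submodule.sub_mem _ hv (Submodule.sum_mem _ fun i _ => ?_)
      have := divPowF_mem_weightSpace h.ne_zero (hxw i) (i + 1)
      rwa [show n + 2 + 2 * (i : ℤ) - 2 * ((i + 1 : ℕ) : ℤ) = n by push_cast; ring] at this
    have hEw : ρ (gen q Gen.E) w =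
        ∑ i ∈ Finset.range N, if n + 2 + i = 0 then divPowF ρ i (u i) else 0 := by
      rw [hw, map_sub, hsum, map_sum, ← Finset.sum_sub_distrib]
      refine Finset.sum_congr rfl fun i _ => ?_
      rw [hEx]
      split_ifs <;> simp
    -- What is left of `E w` are ends of strings, which `F` kills.
    have hFEw : ρ (gen q Gen.F) (ρ (gen q Gen.E) w) = 0 := by
      rw [hEw, map_sum]
      refine Finset.sum_eq_zero fun i _ => ?_
      split_ifs with hi
      · by_cases hui : u i = 0
        · rw [hui, map_zero, map_zero]
        · obtain ⟨m, hm, hstr⟩ := exists_isString h (hu i).1 (hu i).2.1 hui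
          obtain rfl : i = m := by omega
          rw [hstr.F_apply i le_rfl, hstr.last, smul_zero]
      · exact map_zero _
    have hEw0 : ρ (gen q Gen.E) w = 0 := by
      by_cases hn : n < 0
      · rw [eq_zero_of_F_E_eq_zero h hn hww hFEw, map_zero]
      · rw [hEw]
        exact Finset.sum_eq_zero fun i _ => if_neg (by omega)
    refine ⟨N + 1, fun i => Nat.casesOn i w x, ?_, ?_⟩
    · intro i
      cases i with
      | zero => exact ⟨by simpa using hww, hEw0, fun hne => by rwa [divPowF_zero]⟩
      | succ i =>
        refine ⟨?_, hxE i, fun hne hz => ?_⟩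
        · have := hxw i
          rwa [show n + 2 + 2 * (i : ℤ) = n + 2 * ((i + 1 : ℕ) : ℤ) by push_cast; ring] at this
        · have hne' : x i ≠ 0 := hne
          have hi : n + 2 + i ≠ 0 := fun hi => hne' (by
            simp only [x]; rw [hi, qInt_zero, inv_zero, zero_smul])
          have hui : u i ≠ 0 := fun hui => hne' (by simp only [x]; rw [hui, smul_zero])
          have := hEx i
          rw [if_neg hi, show divPowF ρ (i + 1) (x i) = 0 from hz, map_zero] at this
          exact (hu i).2.2 hui this.symm
    · rw [Finset.sum_range_succ']
      simp only [divPowF_zero]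
      change v = _ + w
      rw [hw]; abel

end integrable

/-! ### Generators of the coordinate ring -/

section generators

variable {k : Type} [Field k] {q : k}
variable {V : Type} [AddCommGroup V] [Module k V] {ρ : Uq q →ₐ[k] Module.End k V}

/-- A matrix coefficient at `F⁽ʲ⁾ u`, with `u` singular, is a combination of the `u^m_{ij}`; its
coefficients are the values of the functional on the vectors `F⁽ⁱ⁾ u`. -/
theorem matrixCoeff_divPowF (h : IsGeneric q) [Module.Finite k V] {p : ℤ} {u : V}
    (hu : u ∈ weightSpace ρ p) (hE : ρ (gen q Gen.E) u = 0) (f : Module.Dual k V) (j : ℕ) :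
    ∃ m : ℕ, matrixCoeff ρ f (divPowF ρ j u) =
      ∑ i ∈ Finset.range (m + 1), f (divPowF ρ i u) • matCoeff h.ne_zero m i j := by
  have hz : matrixCoeff ρ f 0 = 0 := by
    simpa using matrixCoeff_smul_right ρ f 0 0
  by_cases h0 : u = 0
  · exact ⟨0, by simp [h0, hz]⟩
  · obtain ⟨m, -, hstr⟩ := exists_isString h hu hE h0
    refine ⟨m, ?_⟩
    by_cases hj : j ≤ m
    · exact hstr.matrixCoeff_eq_sum h.ne_zero f hj
    · have hdiv : ∀ i, divPowF ρ (m + 1 + i) u = 0 := by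
        intro i
        induction i with
        | zero => exact hstr.last
        | succ i ih =>
          have := F_divPowF h ρ (m + 1 + i) u
          rw [ih, map_zero] at this
          exact (smul_eq_zero.mp this.symm).resolve_left (h.qInt_ne_zero (by omega))
      obtain ⟨i, rfl⟩ := Nat.exists_eq_add_of_lt (not_le.mp hj)
      rw [show m + i + 1 = m + 1 + i by ring, hdiv, hz]
      refine (Finset.sum_eq_zero fun l _ => ?_).symm
      rw [matCoeff_of_lt_right _ _ (by omega), smul_zero]

theorem matrixCoeff_mem_span (h : IsGeneric q) (hρ : IsIntegrable ρ) (f : Module.Dual k V)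
    (v : V) : matrixCoeff ρ f v ∈ Submodule.span k
      (Set.range fun x : ℕ × ℕ × ℕ => matCoeff h.ne_zero x.1 x.2.1 x.2.2) := by
  have := hρ.finite
  have hz : matrixCoeff ρ f 0 = 0 := by
    simpa using matrixCoeff_smul_right ρ f 0 0
  have hv : v ∈ ⨆ n : ℤ, weightSpace ρ n := by rw [hρ.iSup_weightSpace]; trivial
  induction hv using Submodule.iSup_induction' with
  | zero => rw [hz]; exact Submodule.zero_mem _
  | add x y _ _ hx hy => rw [matrixCoeff_add_right]; exact Submodule.add_mem _ hx hy
  | mem n v hv =>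
    obtain ⟨N, u, hu, rfl⟩ := exists_string_decomposition h hv
    clear hv
    induction N with
    | zero => rw [Finset.sum_range_zero, hz]; exact Submodule.zero_mem _
    | succ N ih =>
      rw [Finset.sum_range_succ, matrixCoeff_add_right]
      refine Submodule.add_mem _ ih ?_
      obtain ⟨m, hm⟩ := matrixCoeff_divPowF h (hu N).1 (hu N).2.1 f N
      rw [hm]
      exact Submodule.sum_mem _ fun i _ =>
        Submodule.smul_mem _ _ (Submodule.subset_span ⟨(m, i, N), rfl⟩)

theorem isIntegrable_simpleModule (hq : q ≠ 0) (m : ℕ) : IsIntegrable (simpleModule hq m) := by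
  refine ⟨inferInstance, ?_⟩
  rw [eq_top_iff]
  intro w _
  rw [← sum_coord_smul_basisVec m w]
  refine Submodule.sum_mem _ fun i _ => Submodule.smul_mem _ _ ?_
  exact Submodule.mem_iSup_of_mem ((m : ℤ) - 2 * i) (mem_weightSpace.mpr (simpleModule_K hq m i))

theorem matCoeff_mem_coordRing (hq : q ≠ 0) (m i j : ℕ) : matCoeff hq m i j ∈ coordRing hq :=
  Submodule.subset_span ⟨_, inferInstance, inferInstance, simpleModule hq m, _, _,
    isIntegrable_simpleModule hq m, rfl⟩

/-- The four generators `α, β, γ, δ`. -/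
def generators (hq : q ≠ 0) : Set (Functional q) :=
  {matCoeff hq 1 0 0, matCoeff hq 1 0 1, matCoeff hq 1 1 0, matCoeff hq 1 1 1}

/-- By the recursions for the matrix coefficients of `V(m + 1)`, the coefficients `α, β, γ, δ`
generate all the others. -/
theorem matCoeff_mem_adjoin (hq : q ≠ 0) (h2 : q - q⁻¹ ≠ 0) (m i j : ℕ) :
    matCoeff hq m i j ∈ Algebra.adjoin k (generators hq) := by
  have hα : matCoeff hq 1 0 0 ∈ Algebra.adjoin k (generators hq) :=
    Algebra.subset_adjoin (by simp [generators])
  have hβ : matCoeff hq 1 0 1 ∈ Algebra.adjoin k (generators hq) :=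
    Algebra.subset_adjoin (by simp [generators])
  have hγ : matCoeff hq 1 1 0 ∈ Algebra.adjoin k (generators hq) :=
    Algebra.subset_adjoin (by simp [generators])
  have hδ : matCoeff hq 1 1 1 ∈ Algebra.adjoin k (generators hq) :=
    Algebra.subset_adjoin (by simp [generators])
  induction m generalizing i j with
  | zero =>
    rcases Nat.eq_zero_or_pos i with rfl | hi
    · rcases Nat.eq_zero_or_pos j with rfl | hj
      · rw [matCoeff_zero]; exact Subalgebra.one_mem _
      · rw [matCoeff_of_lt_right _ _ hj]; exact Subalgebra.zero_mem _
    · rw [matCoeff_of_lt_left _ _ hi]; exact Subalgebra.zero_mem _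
  | succ m ih =>
    by_cases hi : m + 1 < i
    · rw [matCoeff_of_lt_left _ _ hi]; exact Subalgebra.zero_mem _
    by_cases hj : m + 1 < j
    · rw [matCoeff_of_lt_right _ _ hj]; exact Subalgebra.zero_mem _
    rcases i with _ | i <;> rcases j with _ | j
    · have := matCoeff_low_zero hq h2 (Nat.zero_le m)
      rw [pow_zero, one_smul] at this
      rw [this]; exact Subalgebra.mul_mem _ hα (ih _ _)
    · have := matCoeff_low_succ hq h2 (Nat.zero_le m) (j := j) (by omega)
      rw [pow_zero, one_smul] at this
      rw [this]
      exact Subalgebra.add_mem _ (Subalgebra.smul_mem _ (Subalgebra.mul_mem _ hα (ih _ _)) _)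
        (Subalgebra.mul_mem _ hβ (ih _ _))
    · rw [matCoeff_succ_zero hq h2 (by omega)]
      exact Subalgebra.mul_mem _ hγ (ih _ _)
    · rw [matCoeff_succ_succ hq h2 (by omega) (by omega)]
      exact Subalgebra.add_mem _ (Subalgebra.smul_mem _ (Subalgebra.mul_mem _ hγ (ih _ _)) _)
        (Subalgebra.mul_mem _ hδ (ih _ _))

theorem coordRing_eq_adjoin (h : IsGeneric q) :
    coordRing h.ne_zero = Algebra.adjoin k (generators h.ne_zero) := by
  refine le_antisymm (fun a ha => ?_) (Algebra.adjoin_le ?_)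
  · refine (Submodule.span_le (p := Subalgebra.toSubmodule
      (Algebra.adjoin k (generators h.ne_zero)))).mpr ?_ (show a ∈ Submodule.span k _ from ha)
    rintro _ ⟨V, _, _, ρ, f, v, hρ, rfl⟩
    refine (Submodule.span_le (p := Subalgebra.toSubmodule
      (Algebra.adjoin k (generators h.ne_zero)))).mpr ?_ (matrixCoeff_mem_span h hρ f v)
    rintro _ ⟨x, rfl⟩
    exact matCoeff_mem_adjoin _ h.sub_inv_ne_zero _ _ _
  · rintro x (rfl | rfl | rfl | rfl) <;> exact matCoeff_mem_coordRing _ _ _ _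

end generators

/-! ### The involution on functionals -/

section involution

variable (t : Param)

theorem Param.isGeneric : IsGeneric t.c := by
  refine ⟨t.c_ne_zero, fun n hn h => ?_⟩
  have h1 : (t : ℝ) ^ n = 1 := by exact_mod_cast h
  exact absurd h1 (pow_lt_one₀ t.2.1.le t.2.2 hn.ne').ne

/-- The conjugate-linear map `X ↦ S(X)*`, which enters the definition of the involution on
functionals. -/
def starAntipode : Uq t.c →ₛₗ[starRingEnd ℂ] Uq t.c where
  toFun X := adj t (antipode t X)
  map_add' X Y := by
    simp only [adj, antipode, map_add, MulOpposite.unop_add]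
    rfl
  map_smul' c X := by
    simp only [adj, antipode, map_smul, MulOpposite.unop_smul, ConjOp.out_smul]

theorem starAntipode_mul (X Y : Uq t.c) :
    starAntipode t (X * Y) = starAntipode t X * starAntipode t Y := by
  change adj t (antipode t (X * Y)) = adj t (antipode t X) * adj t (antipode t Y)
  simp only [adj, antipode, map_mul, MulOpposite.unop_mul]
  rfl

theorem adj_mul (X Y : Uq t.c) : adj t (X * Y) = adj t Y * adj t X := by
  simp only [adj, map_mul]
  rfl

theorem adj_neg (X : Uq t.c) : adj t (-X) = -adj t X := by
  simp only [adj, map_neg]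
  rfl

theorem adj_gen (g : Gen) : adj t (gen t.c g) =
    genMap (t.c • (gen t.c Gen.F * gen t.c Gen.K')) (t.c⁻¹ • (gen t.c Gen.K * gen t.c Gen.E))
      (gen t.c Gen.K) (gen t.c Gen.K') g := by
  rw [adj, starHom, liftU_gen]
  cases g <;> rfl

theorem antipode_gen (g : Gen) : antipode t (gen t.c g) =
    genMap (-(gen t.c Gen.E * gen t.c Gen.K)) (-(gen t.c Gen.K' * gen t.c Gen.F))
      (gen t.c Gen.K') (gen t.c Gen.K) g := by
  rw [antipode, antipodeHom, liftU_gen]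
  cases g <;> rfl

theorem starAntipode_gen (g : Gen) : starAntipode t (gen t.c g) =
    genMap (-(t.c⁻¹ • gen t.c Gen.F)) (-(t.c • gen t.c Gen.E)) (gen t.c Gen.K') (gen t.c Gen.K)
      g := by
  have h0 := t.c_ne_zero
  change adj t (antipode t (gen t.c g)) = _
  rw [antipode_gen]
  cases g with
  | E =>
    have h : gen t.c Gen.K * (gen t.c Gen.F * gen t.c Gen.K') = (t.c ^ 2)⁻¹ • gen t.c Gen.F := by
      rw [eq_inv_smul_iff₀ (pow_ne_zero 2 h0), ← mul_assoc, ← smul_mul_assoc, ← gen_F_K,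
        mul_assoc, gen_K_K', mul_one]
    simp only [genMap, adj_neg, adj_mul, adj_gen, mul_smul_comm, h, smul_smul]
    congr 2
    field_simp
  | F =>
    have h : gen t.c Gen.K * gen t.c Gen.E * gen t.c Gen.K' = t.c ^ 2 • gen t.c Gen.E := by
      rw [gen_K_E, smul_mul_assoc, mul_assoc, gen_K_K', mul_one]
    simp only [genMap, adj_neg, adj_mul, adj_gen, smul_mul_assoc, h, smul_smul]
    congr 2
    field_simp
  | K => simp only [genMap, adj_gen]
  | K' => simp only [genMap, adj_gen]

/-- The conjugate-linear map `X ⊗ Y ↦ S(Y)* ⊗ S(X)*`. -/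
def starAntipodeSwap : Uq t.c ⊗[ℂ] Uq t.c →ₛₗ[starRingEnd ℂ] Uq t.c ⊗[ℂ] Uq t.c :=
  (TensorProduct.map (starAntipode t) (starAntipode t)).comp
    (TensorProduct.comm ℂ (Uq t.c) (Uq t.c)).toLinearMap

theorem starAntipodeSwap_tmul (X Y : Uq t.c) :
    starAntipodeSwap t (X ⊗ₜ Y) = starAntipode t Y ⊗ₜ starAntipode t X := rfl

theorem starAntipodeSwap_mul (x y : Uq t.c ⊗[ℂ] Uq t.c) :
    starAntipodeSwap t (x * y) = starAntipodeSwap t x * starAntipodeSwap t y := by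
  induction x using TensorProduct.induction_on with
  | zero => simp
  | add x x' hx hx' => rw [add_mul, map_add, map_add, add_mul, hx, hx']
  | tmul a b =>
    induction y using TensorProduct.induction_on with
    | zero => simp
    | add y y' hy hy' => rw [mul_add, map_add, map_add, mul_add, hy, hy']
    | tmul c d =>
      simp only [Algebra.TensorProduct.tmul_mul_tmul, starAntipodeSwap_tmul, starAntipode_mul]

theorem starAntipode_one : starAntipode t 1 = 1 := by
  change adj t (antipode t 1) = 1
  simp only [adj, antipode, map_one, MulOpposite.unop_one]
  rfl

theorem starAntipode_algebraMap (c : ℂ) :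
    starAntipode t (algebraMap ℂ (Uq t.c) c) = algebraMap ℂ (Uq t.c) (starRingEnd ℂ c) := by
  rw [Algebra.algebraMap_eq_smul_one, LinearMap.map_smulₛₗ, starAntipode_one,
    Algebra.algebraMap_eq_smul_one]

/-- The map `X ↦ S(X)*` reverses the coproduct. -/
theorem coprod_starAntipode (X : Uq t.c) :
    coprod t.c (starAntipode t X) = starAntipodeSwap t (coprod t.c X) := by
  induction X using Uq_induction with
  | hgen g =>
    have hc : ∀ g, coprod t.c (gen t.c g) = genMap
      (gen t.c Gen.E ⊗ₜ gen t.c Gen.K' + 1 ⊗ₜ gen t.c Gen.E)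
      (gen t.c Gen.F ⊗ₜ 1 + gen t.c Gen.K ⊗ₜ gen t.c Gen.F)
      (gen t.c Gen.K ⊗ₜ gen t.c Gen.K) (gen t.c Gen.K' ⊗ₜ gen t.c Gen.K') g :=
      fun g => liftU_gen ..
    cases g <;>
      simp only [hc, starAntipode_gen, genMap, map_neg, map_smul, map_add, starAntipodeSwap_tmul,
        starAntipode_one, TensorProduct.tmul_neg, TensorProduct.neg_tmul, TensorProduct.tmul_smul,
        ← TensorProduct.smul_tmul', smul_add, neg_add]
    all_goals exact add_comm _ _
  | hscal c =>
    rw [starAntipode_algebraMap, AlgHom.commutes, AlgHom.commutes, Algebra.algebraMap_eq_smul_one,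
      Algebra.algebraMap_eq_smul_one, LinearMap.map_smulₛₗ, Algebra.TensorProduct.one_def,
      starAntipodeSwap_tmul, starAntipode_one]
  | hadd X Y hX hY => simp only [map_add, hX, hY]
  | hmul X Y hX hY => rw [starAntipode_mul, map_mul, map_mul, hX, hY, starAntipodeSwap_mul]

theorem starFunctional_add (a b : Functional t.c) :
    starFunctional t (a + b) = starFunctional t a + starFunctional t b :=
  WithConv.ext (LinearMap.ext fun X => map_add (starRingEnd ℂ) (a (starAntipode t X)) _)

theorem starFunctional_smul (c : ℂ) (a : Functional t.c) :
    starFunctional t (c • a) = starRingEnd ℂ c • starFunctional t a :=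
  WithConv.ext (LinearMap.ext fun X => map_mul (starRingEnd ℂ) c (a (starAntipode t X)))

theorem starFunctional_mul (a b : Functional t.c) :
    starFunctional t (a * b) = starFunctional t b * starFunctional t a := by
  refine WithConv.ext (LinearMap.ext fun X => ?_)
  change starRingEnd ℂ (LinearMap.mul' ℂ ℂ (TensorProduct.map a.ofConv b.ofConv
      (coprod t.c (starAntipode t X)))) =
    LinearMap.mul' ℂ ℂ (TensorProduct.map (starFunctional t b).ofConv (starFunctional t a).ofConv
      (coprod t.c X))
  rw [coprod_starAntipode]
  induction coprod t.c X using TensorProduct.induction_on with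
  | zero => simp
  | add x y hx hy => simp only [map_add, hx, hy]
  | tmul x y =>
    refine (map_mul (starRingEnd ℂ) (a (starAntipode t y)) (b (starAntipode t x))).trans ?_
    exact mul_comm _ _

theorem starFunctional_one : starFunctional t 1 = 1 := by
  refine WithConv.ext (LinearMap.ext fun X => ?_)
  change starRingEnd ℂ (counitHom t.c (starAntipode t X)) = counitHom t.c X
  have hc : ∀ g, counitHom t.c (gen t.c g) = genMap 0 0 1 1 g := fun g => liftU_gen ..
  induction X using Uq_induction with
  | hgen g => cases g <;> simp [starAntipode_gen, hc, genMap, -Complex.coe_smul]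
  | hscal c =>
    rw [starAntipode_algebraMap, AlgHom.commutes, AlgHom.commutes]
    exact Complex.conj_conj c
  | hadd X Y hX hY => simp only [map_add, hX, hY]
  | hmul X Y hX hY => rw [starAntipode_mul, map_mul, map_mul, map_mul, hX, hY]

/-- The conjugate-linear map `J` of `V(1)` with `J v_0 = v_1` and `J v_1 = -t v_0`. -/
def quaternionic : (Fin 2 → ℂ) →ₛₗ[starRingEnd ℂ] (Fin 2 → ℂ) where
  toFun w := ![-t.c * starRingEnd ℂ (w 1), starRingEnd ℂ (w 0)]
  map_add' v w := by ext i; fin_cases i; (· simp; ring); simp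
  map_smul' c w := by ext i; fin_cases i; (· simp; ring); simp

/-- `J` intertwines the actions of `X` and `S(X)*`; this computes the involution on the matrix
coefficients of `V(1)`. -/
theorem quaternionic_apply (X : Uq t.c) (w : Fin 2 → ℂ) :
    quaternionic t (simpleModule t.c_ne_zero 1 X w) =
      simpleModule t.c_ne_zero 1 (starAntipode t X) (quaternionic t w) := by
  have h0 := t.c_ne_zero
  have h1 : qInt t.c 1 = 1 := qInt_one t.isGeneric.sub_inv_ne_zero
  have hE : ∀ w, simpleModule t.c_ne_zero 1 (gen t.c Gen.E) w = ![w 1, 0] := by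
    intro w
    rw [simpleModule_gen]
    ext i
    fin_cases i
    · refine (simpleE_apply_pos _ _ _ _ (by simp)).trans ?_
      simp [h1]
    · exact simpleE_apply_neg _ _ _ _ (by simp)
  have hF : ∀ w, simpleModule t.c_ne_zero 1 (gen t.c Gen.F) w = ![0, w 0] := by
    intro w
    rw [simpleModule_gen]
    ext i
    fin_cases i
    · exact simpleF_apply_neg _ _ _ _ (by simp)
    · refine (simpleF_apply_pos _ _ _ _ (by simp)).trans ?_
      simp [h1]
  have hK : ∀ w, simpleModule t.c_ne_zero 1 (gen t.c Gen.K) w = ![t.c * w 0, t.c⁻¹ * w 1] := by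
    intro w
    rw [simpleModule_gen]
    ext i
    fin_cases i <;> simp [genMap, simpleK_apply]
  have hK' : ∀ w, simpleModule t.c_ne_zero 1 (gen t.c Gen.K') w =
      ![t.c⁻¹ * w 0, t.c * w 1] := by
    intro w
    rw [simpleModule_gen]
    ext i
    fin_cases i <;> simp [genMap, simpleK_apply]
  have hQ : ∀ w, quaternionic t w = ![-t.c * starRingEnd ℂ (w 1), starRingEnd ℂ (w 0)] :=
    fun w => rfl
  induction X using Uq_induction generalizing w with
  | hgen g =>
    cases g <;> ext i <;> fin_cases i <;>
      simp [starAntipode_gen, genMap, hE, hF, hK, hK', hQ, h0, -Complex.coe_smul]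
  | hscal c =>
    rw [starAntipode_algebraMap, AlgHom.commutes, AlgHom.commutes]
    exact LinearMap.map_smulₛₗ _ _ _
  | hadd X Y hX hY => simp only [map_add, hX, hY, LinearMap.add_apply]
  | hmul X Y hX hY => simp only [map_mul, Module.End.mul_apply, hX, hY, starAntipode_mul]

theorem quaternionic_basisVec_zero : quaternionic t (basisVec ℂ 1 0) = basisVec ℂ 1 1 := by
  ext i; fin_cases i <;> simp [quaternionic, basisVec]

theorem quaternionic_basisVec_one : quaternionic t (basisVec ℂ 1 1) = -t.c • basisVec ℂ 1 0 := by
  ext i; fin_cases i <;> simp [quaternionic, basisVec]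

theorem coord_zero_quaternionic (w : Fin 2 → ℂ) :
    coord ℂ 1 0 (quaternionic t w) = -t.c * starRingEnd ℂ (coord ℂ 1 1 w) := rfl

theorem coord_one_quaternionic (w : Fin 2 → ℂ) :
    coord ℂ 1 1 (quaternionic t w) = starRingEnd ℂ (coord ℂ 1 0 w) := rfl

theorem starFunctional_beta :
    starFunctional t (matCoeff t.c_ne_zero 1 0 1) = -t.c • matCoeff t.c_ne_zero 1 1 0 := by
  refine WithConv.ext (LinearMap.ext fun X => ?_)
  change starRingEnd ℂ (coord ℂ 1 0 (simpleModule _ 1 (starAntipode t X) (basisVec ℂ 1 1))) =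
    -t.c * coord ℂ 1 1 (simpleModule _ 1 X (basisVec ℂ 1 0))
  rw [← quaternionic_basisVec_zero t, ← quaternionic_apply, coord_zero_quaternionic, map_mul,
    Complex.conj_conj, map_neg, Complex.conj_ofReal]

theorem starFunctional_delta :
    starFunctional t (matCoeff t.c_ne_zero 1 1 1) = matCoeff t.c_ne_zero 1 0 0 := by
  refine WithConv.ext (LinearMap.ext fun X => ?_)
  change starRingEnd ℂ (coord ℂ 1 1 (simpleModule _ 1 (starAntipode t X) (basisVec ℂ 1 1))) =
    coord ℂ 1 0 (simpleModule _ 1 X (basisVec ℂ 1 0))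
  rw [← quaternionic_basisVec_zero t, ← quaternionic_apply, coord_one_quaternionic,
    Complex.conj_conj]

theorem starFunctional_alpha :
    starFunctional t (matCoeff t.c_ne_zero 1 0 0) = matCoeff t.c_ne_zero 1 1 1 := by
  refine WithConv.ext (LinearMap.ext fun X => ?_)
  change starRingEnd ℂ (coord ℂ 1 0 (simpleModule _ 1 (starAntipode t X) (basisVec ℂ 1 0))) =
    coord ℂ 1 1 (simpleModule _ 1 X (basisVec ℂ 1 1))
  have h0 : -t.c ≠ 0 := neg_ne_zero.mpr t.c_ne_zero
  have h1 : basisVec ℂ 1 0 = (-t.c)⁻¹ • quaternionic t (basisVec ℂ 1 1) := by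
    rw [quaternionic_basisVec_one, smul_smul, inv_mul_cancel₀ h0, one_smul]
  rw [h1, map_smul, ← quaternionic_apply, map_smul, coord_zero_quaternionic, smul_eq_mul,
    inv_mul_cancel_left₀ h0, Complex.conj_conj]

theorem starFunctional_gamma :
    starFunctional t (matCoeff t.c_ne_zero 1 1 0) = (-t.c)⁻¹ • matCoeff t.c_ne_zero 1 0 1 := by
  refine WithConv.ext (LinearMap.ext fun X => ?_)
  change starRingEnd ℂ (coord ℂ 1 1 (simpleModule _ 1 (starAntipode t X) (basisVec ℂ 1 0))) =
    (-t.c)⁻¹ * coord ℂ 1 0 (simpleModule _ 1 X (basisVec ℂ 1 1))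
  have h0 : -t.c ≠ 0 := neg_ne_zero.mpr t.c_ne_zero
  have h1 : basisVec ℂ 1 0 = (-t.c)⁻¹ • quaternionic t (basisVec ℂ 1 1) := by
    rw [quaternionic_basisVec_one, smul_smul, inv_mul_cancel₀ h0, one_smul]
  rw [h1, map_smul, ← quaternionic_apply, map_smul, coord_one_quaternionic, smul_eq_mul, map_mul,
    Complex.conj_conj, map_inv₀, map_neg, Complex.conj_ofReal]

end involution

/-! ### Ordered monomials -/

section monomials

variable {k : Type} [Field k] {R : Type} [Ring R] [Algebra k R]

theorem mul_pow_of_mul_eq_smul {c : k} {x y : R} (h : x * y = c • (y * x)) (n : ℕ) :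
    x * y ^ n = c ^ n • (y ^ n * x) := by
  induction n with
  | zero => simp
  | succ n ih =>
    rw [pow_succ y, ← mul_assoc, ih, smul_mul_assoc, mul_assoc, h, mul_smul_comm, smul_smul,
      pow_succ, mul_assoc]

theorem pow_mul_of_mul_eq_smul {c : k} {x y : R} (h : x * y = c • (y * x)) (n : ℕ) :
    x ^ n * y = c ^ n • (y * x ^ n) := by
  induction n with
  | zero => simp
  | succ n ih =>
    rw [pow_succ' x, mul_assoc, ih, mul_smul_comm, ← mul_assoc, h, smul_mul_assoc, smul_smul,
      pow_succ c, mul_assoc]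

/-- The ordered monomial `α^a γ^c β^b`. -/
def monomial (α β γ : R) (x : ℕ × ℕ × ℕ) : R := α ^ x.1 * (γ ^ x.2.1 * β ^ x.2.2)

/-- The relations of `O[SL_q(2)]` that are used to bring elements into an ordered form. -/
structure SLRelations (q : k) (α β γ δ : R) : Prop where
  beta_alpha : β * α = q⁻¹ • (α * β)
  gamma_alpha : γ * α = q⁻¹ • (α * γ)
  beta_gamma : β * γ = γ * β
  delta_alpha : δ * α = 1 + q⁻¹ • (γ * β)

variable {q : k} {α β γ δ : R}

namespace SLRelations

theorem alpha_mul_monomial (a c b : ℕ) :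
    α * monomial α β γ (a, c, b) = monomial α β γ (a + 1, c, b) := by
  simp only [monomial, pow_succ', mul_assoc]

theorem gamma_mul_monomial (h : SLRelations q α β γ δ) (a c b : ℕ) :
    γ * monomial α β γ (a, c, b) = q⁻¹ ^ a • monomial α β γ (a, c + 1, b) := by
  simp only [monomial]
  rw [← mul_assoc, mul_pow_of_mul_eq_smul h.gamma_alpha, smul_mul_assoc, pow_succ' γ]
  simp only [mul_assoc]

theorem beta_mul_monomial (h : SLRelations q α β γ δ) (a c b : ℕ) :
    β * monomial α β γ (a, c, b) = q⁻¹ ^ a • monomial α β γ (a, c, b + 1) := by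
  have hc : Commute β (γ ^ c) := Commute.pow_right h.beta_gamma c
  simp only [monomial]
  rw [← mul_assoc, mul_pow_of_mul_eq_smul h.beta_alpha, smul_mul_assoc, mul_assoc,
    ← mul_assoc β, hc.eq, pow_succ' β]
  simp only [mul_assoc]

theorem monomial_mul_alpha (h : SLRelations q α β γ δ) (a c b : ℕ) :
    monomial α β γ (a, c, b) * α = (q⁻¹ ^ b * q⁻¹ ^ c) • monomial α β γ (a + 1, c, b) := by
  simp only [monomial]
  rw [mul_assoc, mul_assoc, pow_mul_of_mul_eq_smul h.beta_alpha, mul_smul_comm, ← mul_assoc (γ ^ c),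
    pow_mul_of_mul_eq_smul h.gamma_alpha, smul_mul_assoc, smul_smul, mul_smul_comm, pow_succ α]
  simp only [mul_assoc]

theorem delta_mul_monomial (h : SLRelations q α β γ δ) (a c b : ℕ) :
    δ * monomial α β γ (a + 1, c, b) = monomial α β γ (a, c, b) +
      (q⁻¹ * q⁻¹ ^ a * q⁻¹ ^ a) • monomial α β γ (a, c + 1, b + 1) := by
  rw [← alpha_mul_monomial, ← mul_assoc, h.delta_alpha, add_mul, one_mul, smul_mul_assoc,
    mul_assoc, h.beta_mul_monomial, mul_smul_comm, h.gamma_mul_monomial, smul_smul, smul_smul,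
    mul_assoc]

/-- The span of the ordered monomials. -/
abbrev monomialSpan (k : Type) [Field k] {R : Type} [Ring R] [Algebra k R] (α β γ : R) :
    Submodule k R :=
  Submodule.span k (Set.range (monomial α β γ))

theorem mul_alpha_pow_mem (h : SLRelations q α β γ δ) {x : R} (hx : x ∈ monomialSpan k α β γ)
    (N : ℕ) : x * α ^ N ∈ monomialSpan k α β γ := by
  induction N with
  | zero => simpa using hx
  | succ N ih =>
    rw [pow_succ, ← mul_assoc]
    generalize x * α ^ N = y at ih
    induction ih using Submodule.span_induction with
    | zero => rw [zero_mul]; exact Submodule.zero_mem _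
    | add x y _ _ hx hy => rw [add_mul]; exact Submodule.add_mem _ hx hy
    | smul c x _ hx => rw [smul_mul_assoc]; exact Submodule.smul_mem _ _ hx
    | mem x hx =>
      obtain ⟨⟨a, c, b⟩, rfl⟩ := hx
      rw [h.monomial_mul_alpha]
      exact Submodule.smul_mem _ _ (Submodule.subset_span ⟨_, rfl⟩)

/-- Only the left multiplication by `δ` leaves the span of the ordered monomials; a factor `α` on
the right prevents this, as `δα = 1 + q⁻¹γβ`. -/
theorem generator_mul_alpha_mem (h : SLRelations q α β γ δ) {g x : R}
    (hg : g ∈ ({α, β, γ, δ} : Set R)) (hx : x ∈ monomialSpan k α β γ) :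
    g * (x * α) ∈ monomialSpan k α β γ := by
  induction hx using Submodule.span_induction with
  | zero => rw [zero_mul, mul_zero]; exact Submodule.zero_mem _
  | add x y _ _ hx hy => rw [add_mul, mul_add]; exact Submodule.add_mem _ hx hy
  | smul c x _ hx => rw [smul_mul_assoc, mul_smul_comm]; exact Submodule.smul_mem _ _ hx
  | mem x hx =>
    obtain ⟨⟨a, c, b⟩, rfl⟩ := hx
    rw [h.monomial_mul_alpha, mul_smul_comm]
    refine Submodule.smul_mem _ _ ?_
    rcases hg with rfl | rfl | rfl | rfl
    · rw [alpha_mul_monomial]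
      exact Submodule.subset_span ⟨_, rfl⟩
    · rw [h.beta_mul_monomial]
      exact Submodule.smul_mem _ _ (Submodule.subset_span ⟨_, rfl⟩)
    · rw [h.gamma_mul_monomial]
      exact Submodule.smul_mem _ _ (Submodule.subset_span ⟨_, rfl⟩)
    · rw [h.delta_mul_monomial]
      exact Submodule.add_mem _ (Submodule.subset_span ⟨_, rfl⟩)
        (Submodule.smul_mem _ _ (Submodule.subset_span ⟨_, rfl⟩))

/-- Right multiplication by a power of `α` removes all factors `δ`: every element becomes a
combination of ordered monomials in `α, γ, β`. -/
theorem exists_mul_alpha_pow_mem (h : SLRelations q α β γ δ) {x : R}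
    (hx : x ∈ Algebra.adjoin k ({α, β, γ, δ} : Set R)) :
    ∃ N : ℕ, x * α ^ N ∈ monomialSpan k α β γ := by
  suffices H : ∀ y : R, (∃ N : ℕ, y * α ^ N ∈ monomialSpan k α β γ) →
      ∃ N : ℕ, x * y * α ^ N ∈ monomialSpan k α β γ by
    have h1 : (1 : R) ∈ monomialSpan k α β γ :=
      Submodule.subset_span ⟨(0, 0, 0), by simp [monomial]⟩
    simpa using H 1 ⟨0, by simpa using h1⟩
  induction hx using Algebra.adjoin_induction with
  | mem g hg =>
    rintro y ⟨N, hN⟩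
    refine ⟨N + 1, ?_⟩
    rw [pow_succ, mul_assoc, ← mul_assoc y]
    exact h.generator_mul_alpha_mem hg hN
  | algebraMap r =>
    rintro y ⟨N, hN⟩
    refine ⟨N, ?_⟩
    rw [mul_assoc, ← Algebra.smul_def]
    exact Submodule.smul_mem _ _ hN
  | add x x' _ _ hx hx' =>
    intro y hy
    obtain ⟨N, hN⟩ := hx y hy
    obtain ⟨M, hM⟩ := hx' y hy
    refine ⟨N + M, ?_⟩
    rw [add_mul, add_mul]
    refine Submodule.add_mem _ ?_ ?_
    · rw [pow_add, ← mul_assoc]; exact h.mul_alpha_pow_mem hN M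
    · rw [add_comm, pow_add, ← mul_assoc]; exact h.mul_alpha_pow_mem hM N
  | mul x x' _ _ hx hx' =>
    intro y hy
    simp only [mul_assoc x x']
    exact hx _ (hx' y hy)

end SLRelations

theorem slRelations_matCoeff {q : k} (h : IsGeneric q) (h3 : q * q + 1 ≠ 0) :
    SLRelations q (matCoeff h.ne_zero 1 0 0) (matCoeff h.ne_zero 1 0 1) (matCoeff h.ne_zero 1 1 0)
      (matCoeff h.ne_zero 1 1 1) where
  beta_alpha := by
    rw [alpha_mul_beta _ h.sub_inv_ne_zero, smul_smul, inv_mul_cancel₀ h.ne_zero, one_smul]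
  gamma_alpha := by
    rw [alpha_mul_gamma _ h.sub_inv_ne_zero, smul_smul, inv_mul_cancel₀ h.ne_zero, one_smul]
  beta_gamma := beta_mul_gamma _ h.sub_inv_ne_zero h3
  delta_alpha := delta_mul_alpha _ h.sub_inv_ne_zero

end monomials

/-! ### Linear independence of the ordered monomials -/

section independence

variable {k : Type} [Field k] {q : k}

/-- The operator `ψ ↦ ψ(· X)` on functionals. The operator for `E` acts as a twisted derivation
that lowers the exponent of `β` in an ordered monomial. -/
def rightTranslate (X : Uq q) : Functional q →ₗ[k] Functional q where
  toFun ψ := WithConv.toConv (ψ.ofConv ∘ₗ LinearMap.mulRight k X)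
  map_add' _ _ := rfl
  map_smul' _ _ := rfl

/-- The operator `ψ ↦ ψ(X ·)` on functionals. The operator for `F` acts as a twisted derivation
that lowers the exponent of `γ` in an ordered monomial. -/
def leftTranslate (X : Uq q) : Functional q →ₗ[k] Functional q where
  toFun ψ := WithConv.toConv (ψ.ofConv ∘ₗ LinearMap.mulLeft k X)
  map_add' _ _ := rfl
  map_smul' _ _ := rfl

theorem rightTranslate_apply (X Y : Uq q) (ψ : Functional q) :
    rightTranslate X ψ Y = ψ (Y * X) := rfl

theorem leftTranslate_apply (X Y : Uq q) (ψ : Functional q) :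
    leftTranslate X ψ Y = ψ (X * Y) := rfl

theorem mul_functional_apply (a b : Functional q) (X : Uq q) : (a * b) X =
    LinearMap.mul' k k (TensorProduct.map a.ofConv b.ofConv (coprod q X)) := rfl

theorem functional_ext {a b : Functional q} (h : ∀ X : Uq q, a X = b X) : a = b :=
  WithConv.ext (LinearMap.ext h)

theorem coprod_gen (g : Gen) : coprod q (gen q g) = genMap
    (gen q Gen.E ⊗ₜ gen q Gen.K' + 1 ⊗ₜ gen q Gen.E)
    (gen q Gen.F ⊗ₜ 1 + gen q Gen.K ⊗ₜ gen q Gen.F)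
    (gen q Gen.K ⊗ₜ gen q Gen.K) (gen q Gen.K' ⊗ₜ gen q Gen.K') g :=
  liftU_gen ..

theorem rightTranslate_E_mul (a b : Functional q) : rightTranslate (gen q Gen.E) (a * b) =
    rightTranslate (gen q Gen.E) a * rightTranslate (gen q Gen.K') b +
      a * rightTranslate (gen q Gen.E) b := by
  refine functional_ext fun Y => ?_
  change (a * b) (Y * gen q Gen.E) = (rightTranslate (gen q Gen.E) a *
    rightTranslate (gen q Gen.K') b) Y + (a * rightTranslate (gen q Gen.E) b) Y
  rw [mul_functional_apply, mul_functional_apply, mul_functional_apply, map_mul, coprod_gen]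
  induction coprod q Y using TensorProduct.induction_on with
  | zero => simp
  | add x y hx hy => rw [add_mul, map_add, map_add, hx, hy]; simp only [map_add]; abel
  | tmul x y =>
    simp only [genMap, mul_add, Algebra.TensorProduct.tmul_mul_tmul, map_add, mul_one]
    rfl

theorem rightTranslate_K'_mul (a b : Functional q) : rightTranslate (gen q Gen.K') (a * b) =
    rightTranslate (gen q Gen.K') a * rightTranslate (gen q Gen.K') b := by
  refine functional_ext fun Y => ?_
  rw [rightTranslate_apply, mul_functional_apply, mul_functional_apply, map_mul, coprod_gen]
  induction coprod q Y using TensorProduct.induction_on with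
  | zero => simp
  | add x y hx hy => rw [add_mul, map_add, map_add, hx, hy]; simp only [map_add]
  | tmul x y =>
    simp only [genMap, Algebra.TensorProduct.tmul_mul_tmul]
    rfl

theorem leftTranslate_F_mul (a b : Functional q) : leftTranslate (gen q Gen.F) (a * b) =
    leftTranslate (gen q Gen.F) a * b +
      leftTranslate (gen q Gen.K) a * leftTranslate (gen q Gen.F) b := by
  refine functional_ext fun Y => ?_
  change (a * b) (gen q Gen.F * Y) = (leftTranslate (gen q Gen.F) a * b) Y +
    (leftTranslate (gen q Gen.K) a * leftTranslate (gen q Gen.F) b) Y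
  rw [mul_functional_apply, mul_functional_apply, mul_functional_apply, map_mul, coprod_gen]
  induction coprod q Y using TensorProduct.induction_on with
  | zero => simp
  | add x y hx hy => rw [mul_add, map_add, map_add, hx, hy]; simp only [map_add]; abel
  | tmul x y =>
    simp only [genMap, add_mul, Algebra.TensorProduct.tmul_mul_tmul, map_add, one_mul]
    rfl

theorem one_functional_apply (X : Uq q) : (1 : Functional q) X = counitHom q X := rfl

theorem counitHom_gen (g : Gen) : counitHom q (gen q g) = genMap 0 0 1 1 g := liftU_gen ..

theorem rightTranslate_E_one : rightTranslate (gen q Gen.E) (1 : Functional q) = 0 :=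
  functional_ext fun Y => by
    rw [rightTranslate_apply, one_functional_apply, map_mul, counitHom_gen]
    exact mul_zero _

theorem rightTranslate_K'_one : rightTranslate (gen q Gen.K') (1 : Functional q) = 1 :=
  functional_ext fun Y => by
    rw [rightTranslate_apply, one_functional_apply, one_functional_apply, map_mul, counitHom_gen]
    exact mul_one _

theorem leftTranslate_F_one : leftTranslate (gen q Gen.F) (1 : Functional q) = 0 :=
  functional_ext fun Y => by
    rw [leftTranslate_apply, one_functional_apply, map_mul, counitHom_gen]
    exact zero_mul _

theorem rightTranslate_matCoeff (hq : q ≠ 0) (X : Uq q) (m i j : ℕ) :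
    rightTranslate X (matCoeff hq m i j) = matrixCoeff (simpleModule hq m) (coord k m i)
      (simpleModule hq m X (basisVec k m j)) :=
  functional_ext fun Y => by
    change coord k m i (simpleModule hq m (Y * X) (basisVec k m j)) = _
    rw [map_mul]
    rfl

theorem leftTranslate_matCoeff (hq : q ≠ 0) (X : Uq q) (m i j : ℕ) :
    leftTranslate X (matCoeff hq m i j) = matrixCoeff (simpleModule hq m)
      (coord k m i ∘ₗ simpleModule hq m X) (basisVec k m j) :=
  functional_ext fun Y => by
    change coord k m i (simpleModule hq m (X * Y) (basisVec k m j)) = _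
    rw [map_mul]
    rfl

theorem matrixCoeff_smul_left {V : Type} [AddCommGroup V] [Module k V]
    (ρ : Uq q →ₐ[k] Module.End k V) (c : k) (f : Module.Dual k V) (v : V) :
    matrixCoeff ρ (c • f) v = c • matrixCoeff ρ f v := rfl

theorem matrixCoeff_zero_right {V : Type} [AddCommGroup V] [Module k V]
    (ρ : Uq q →ₐ[k] Module.End k V) (f : Module.Dual k V) : matrixCoeff ρ f 0 = 0 := by
  simpa using matrixCoeff_smul_right ρ f 0 0

theorem rightTranslate_E_alpha (hq : q ≠ 0) :
    rightTranslate (gen q Gen.E) (matCoeff hq 1 0 0) = 0 := by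
  rw [rightTranslate_matCoeff, simpleModule_E_zero, matrixCoeff_zero_right]

theorem rightTranslate_E_gamma (hq : q ≠ 0) :
    rightTranslate (gen q Gen.E) (matCoeff hq 1 1 0) = 0 := by
  rw [rightTranslate_matCoeff, simpleModule_E_zero, matrixCoeff_zero_right]

theorem rightTranslate_E_beta (h : IsGeneric q) :
    rightTranslate (gen q Gen.E) (matCoeff h.ne_zero 1 0 1) = matCoeff h.ne_zero 1 0 0 := by
  rw [rightTranslate_matCoeff, simpleModule_E_succ h.ne_zero 1 0, matrixCoeff_smul_right]
  simp [qInt_one h.sub_inv_ne_zero, matCoeff]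

theorem rightTranslate_K'_beta (hq : q ≠ 0) :
    rightTranslate (gen q Gen.K') (matCoeff hq 1 0 1) = q • matCoeff hq 1 0 1 := by
  rw [rightTranslate_matCoeff, simpleModule_K', matrixCoeff_smul_right, matCoeff]
  norm_num

theorem leftTranslate_F_low (hq : q ≠ 0) (j : ℕ) :
    leftTranslate (gen q Gen.F) (matCoeff hq 1 0 j) = 0 := by
  have : coord k 1 0 ∘ₗ simpleModule hq 1 (gen q Gen.F) = 0 :=
    linearMap_ext_basisVec fun j _ => by
      rw [LinearMap.comp_apply, simpleModule_F, map_smul, coord_basisVec]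
      simp
  rw [leftTranslate_matCoeff, this]
  rfl

theorem leftTranslate_F_gamma (h : IsGeneric q) :
    leftTranslate (gen q Gen.F) (matCoeff h.ne_zero 1 1 0) = matCoeff h.ne_zero 1 0 0 := by
  have : coord k 1 1 ∘ₗ simpleModule h.ne_zero 1 (gen q Gen.F) = coord k 1 0 :=
    linearMap_ext_basisVec fun j _ => by
      rw [LinearMap.comp_apply, simpleModule_F, map_smul, coord_basisVec, coord_basisVec]
      rcases Nat.eq_zero_or_pos j with rfl | hj
      · simp [qInt_one h.sub_inv_ne_zero]
      · simp [hj.ne, hj.ne']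
  rw [leftTranslate_matCoeff, this, matCoeff]

theorem leftTranslate_K_matCoeff (hq : q ≠ 0) (m i j : ℕ) :
    leftTranslate (gen q Gen.K) (matCoeff hq m i j) =
      q ^ ((m : ℤ) - 2 * i) • matCoeff hq m i j := by
  have : coord k m i ∘ₗ simpleModule hq m (gen q Gen.K) = q ^ ((m : ℤ) - 2 * i) • coord k m i :=
    linearMap_ext_basisVec fun j _ => by
      rw [LinearMap.comp_apply, simpleModule_K, map_smul, LinearMap.smul_apply, coord_basisVec]
      by_cases hij : i = j
      · rw [hij]
      · simp [hij]
  rw [leftTranslate_matCoeff, this, matrixCoeff_smul_left, matCoeff]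

theorem rightTranslate_E_mul_of_eq_zero {a : Functional q}
    (ha : rightTranslate (gen q Gen.E) a = 0) (n : ℕ) (b : Functional q) :
    rightTranslate (gen q Gen.E) (a ^ n * b) = a ^ n * rightTranslate (gen q Gen.E) b := by
  induction n with
  | zero => simp
  | succ n ih =>
    rw [pow_succ', mul_assoc, rightTranslate_E_mul, ha, zero_mul, zero_add, ih, mul_assoc]

theorem rightTranslate_K'_beta_pow (hq : q ≠ 0) (b : ℕ) :
    rightTranslate (gen q Gen.K') (matCoeff hq 1 0 1 ^ b) = q ^ b • matCoeff hq 1 0 1 ^ b := by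
  induction b with
  | zero => simp [rightTranslate_K'_one]
  | succ b ih =>
    rw [pow_succ', rightTranslate_K'_mul, ih, rightTranslate_K'_beta, smul_mul_smul_comm,
      pow_succ' q]

theorem rightTranslate_E_beta_pow (h : IsGeneric q) (b : ℕ) :
    rightTranslate (gen q Gen.E) (matCoeff h.ne_zero 1 0 1 ^ (b + 1)) =
      qInt q ((b : ℤ) + 1) • (matCoeff h.ne_zero 1 0 0 * matCoeff h.ne_zero 1 0 1 ^ b) := by
  induction b with
  | zero =>
    simp [rightTranslate_E_beta h, qInt_one h.sub_inv_ne_zero]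
  | succ b ih =>
    have hβα : matCoeff h.ne_zero 1 0 1 * matCoeff h.ne_zero 1 0 0 =
        q⁻¹ • (matCoeff h.ne_zero 1 0 0 * matCoeff h.ne_zero 1 0 1) := by
      rw [alpha_mul_beta _ h.sub_inv_ne_zero, smul_smul, inv_mul_cancel₀ h.ne_zero, one_smul]
    have key := qInt_succ' h.ne_zero h.sub_inv_ne_zero ((b : ℤ) + 1)
    rw [pow_succ', rightTranslate_E_mul, ih, rightTranslate_E_beta h, rightTranslate_K'_beta_pow,
      mul_smul_comm, mul_smul_comm, ← mul_assoc, hβα, smul_mul_assoc, mul_assoc, ← pow_succ',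
      smul_smul, ← add_smul]
    push_cast
    rw [← key, mul_comm (qInt q _)]
    norm_cast

theorem leftTranslate_F_gamma_pow (h : IsGeneric q) (c : ℕ) :
    leftTranslate (gen q Gen.F) (matCoeff h.ne_zero 1 1 0 ^ (c + 1)) =
      (q⁻¹ ^ c * qInt q ((c : ℤ) + 1)) •
        (matCoeff h.ne_zero 1 0 0 * matCoeff h.ne_zero 1 1 0 ^ c) := by
  induction c with
  | zero =>
    simp [leftTranslate_F_gamma h, qInt_one h.sub_inv_ne_zero]
  | succ c ih =>
    have hγα : matCoeff h.ne_zero 1 1 0 * matCoeff h.ne_zero 1 0 0 =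
        q⁻¹ • (matCoeff h.ne_zero 1 0 0 * matCoeff h.ne_zero 1 1 0) := by
      rw [alpha_mul_gamma _ h.sub_inv_ne_zero, smul_smul, inv_mul_cancel₀ h.ne_zero, one_smul]
    have key := qInt_succ' h.ne_zero h.sub_inv_ne_zero ((c : ℤ) + 1)
    have hq := h.ne_zero
    rw [pow_succ', leftTranslate_F_mul, ih, leftTranslate_F_gamma h, leftTranslate_K_matCoeff,
      smul_mul_smul_comm, ← mul_assoc (matCoeff h.ne_zero 1 1 0), hγα, smul_mul_assoc, mul_assoc,
      ← pow_succ', smul_smul]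
    rw [show ((1 : ℕ) : ℤ) - 2 * ((1 : ℕ) : ℤ) = -1 by norm_num, zpow_neg_one]
    nth_rw 1 [← one_smul k (matCoeff h.ne_zero 1 0 0 * matCoeff h.ne_zero 1 1 0 ^ (c + 1))]
    rw [← add_smul]
    congr 1
    push_cast
    have e : q⁻¹ ^ (c + 1) * q ^ ((c : ℤ) + 1) = 1 := by
      rw [show ((c : ℤ) + 1) = ((c + 1 : ℕ) : ℤ) by push_cast; rfl, zpow_natCast, ← mul_pow,
        inv_mul_cancel₀ hq, one_pow]
    rw [← key, mul_add, e, pow_succ]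
    ring

theorem rightTranslate_E_monomial (h : IsGeneric q) (a c b : ℕ) :
    rightTranslate (gen q Gen.E) (monomial (matCoeff h.ne_zero 1 0 0) (matCoeff h.ne_zero 1 0 1)
      (matCoeff h.ne_zero 1 1 0) (a, c, b + 1)) = (q⁻¹ ^ c * qInt q ((b : ℤ) + 1)) •
        monomial (matCoeff h.ne_zero 1 0 0) (matCoeff h.ne_zero 1 0 1)
          (matCoeff h.ne_zero 1 1 0) (a + 1, c, b) := by
  have hγα : matCoeff h.ne_zero 1 1 0 * matCoeff h.ne_zero 1 0 0 =
      q⁻¹ • (matCoeff h.ne_zero 1 0 0 * matCoeff h.ne_zero 1 1 0) := by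
    rw [alpha_mul_gamma _ h.sub_inv_ne_zero, smul_smul, inv_mul_cancel₀ h.ne_zero, one_smul]
  simp only [monomial]
  rw [rightTranslate_E_mul_of_eq_zero (rightTranslate_E_alpha _),
    rightTranslate_E_mul_of_eq_zero (rightTranslate_E_gamma _), rightTranslate_E_beta_pow h,
    mul_smul_comm, ← mul_assoc (matCoeff h.ne_zero 1 1 0 ^ c), pow_mul_of_mul_eq_smul hγα,
    smul_mul_assoc, smul_smul, mul_smul_comm, pow_succ _ a, mul_comm (qInt q _)]
  simp only [mul_assoc]

theorem rightTranslate_E_monomial_zero (h : IsGeneric q) (a c : ℕ) :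
    rightTranslate (gen q Gen.E) (monomial (matCoeff h.ne_zero 1 0 0) (matCoeff h.ne_zero 1 0 1)
      (matCoeff h.ne_zero 1 1 0) (a, c, 0)) = 0 := by
  simp only [monomial]
  rw [rightTranslate_E_mul_of_eq_zero (rightTranslate_E_alpha _),
    rightTranslate_E_mul_of_eq_zero (rightTranslate_E_gamma _), pow_zero, rightTranslate_E_one,
    mul_zero, mul_zero]

theorem leftTranslate_F_alpha_pow_mul (hq : q ≠ 0) (a : ℕ) (b : Functional q) :
    leftTranslate (gen q Gen.F) (matCoeff hq 1 0 0 ^ a * b) =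
      q ^ a • (matCoeff hq 1 0 0 ^ a * leftTranslate (gen q Gen.F) b) := by
  induction a with
  | zero => simp
  | succ a ih =>
    rw [pow_succ', mul_assoc, leftTranslate_F_mul, leftTranslate_F_low, zero_mul, zero_add, ih,
      leftTranslate_K_matCoeff, smul_mul_smul_comm, pow_succ' q, mul_assoc]
    simp

theorem leftTranslate_F_beta_pow (hq : q ≠ 0) (b : ℕ) :
    leftTranslate (gen q Gen.F) (matCoeff hq 1 0 1 ^ b) = 0 := by
  induction b with
  | zero => rw [pow_zero, leftTranslate_F_one]
  | succ b ih =>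
    rw [pow_succ', leftTranslate_F_mul, leftTranslate_F_low, ih, zero_mul, mul_zero, add_zero]

theorem leftTranslate_F_monomial (h : IsGeneric q) (a c b : ℕ) :
    leftTranslate (gen q Gen.F) (monomial (matCoeff h.ne_zero 1 0 0) (matCoeff h.ne_zero 1 0 1)
      (matCoeff h.ne_zero 1 1 0) (a, c + 1, b)) =
        (q ^ a * (q⁻¹ ^ c * qInt q ((c : ℤ) + 1))) •
          monomial (matCoeff h.ne_zero 1 0 0) (matCoeff h.ne_zero 1 0 1)
            (matCoeff h.ne_zero 1 1 0) (a + 1, c, b) := by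
  simp only [monomial]
  rw [leftTranslate_F_alpha_pow_mul, leftTranslate_F_mul, leftTranslate_F_beta_pow, mul_zero,
    add_zero, leftTranslate_F_gamma_pow h, smul_mul_assoc, mul_smul_comm, smul_smul, pow_succ _ a]
  simp only [mul_assoc]

theorem leftTranslate_F_monomial_zero (h : IsGeneric q) (a b : ℕ) :
    leftTranslate (gen q Gen.F) (monomial (matCoeff h.ne_zero 1 0 0) (matCoeff h.ne_zero 1 0 1)
      (matCoeff h.ne_zero 1 1 0) (a, 0, b)) = 0 := by
  simp only [monomial]
  rw [leftTranslate_F_alpha_pow_mul, pow_zero, one_mul, leftTranslate_F_beta_pow, mul_zero,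
    smul_zero]

theorem mul_apply_K_pow (a b : Functional q) (n : ℕ) :
    (a * b) (gen q Gen.K ^ n) = a (gen q Gen.K ^ n) * b (gen q Gen.K ^ n) := by
  rw [mul_functional_apply, map_pow, coprod_gen]
  simp only [genMap, Algebra.TensorProduct.tmul_pow]
  rfl

theorem pow_apply_K_pow (a : Functional q) (l n : ℕ) :
    (a ^ l) (gen q Gen.K ^ n) = a (gen q Gen.K ^ n) ^ l := by
  induction l with
  | zero =>
    rw [pow_zero, pow_zero, one_functional_apply, map_pow, counitHom_gen]
    exact one_pow n
  | succ l ih => rw [pow_succ, mul_apply_K_pow, ih, pow_succ]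

theorem matCoeff_apply_K_pow (hq : q ≠ 0) (m i j n : ℕ) :
    matCoeff hq m i j (gen q Gen.K ^ n) =
      (q ^ ((m : ℤ) - 2 * j)) ^ n * if i = j ∧ i ≤ m then 1 else 0 := by
  have h : ∀ n, (simpleModule hq m (gen q Gen.K) ^ n) (basisVec k m j) =
      (q ^ ((m : ℤ) - 2 * j)) ^ n • basisVec k m j := by
    intro n
    induction n with
    | zero => simp
    | succ n ih =>
      rw [pow_succ', Module.End.mul_apply, ih, map_smul, simpleModule_K, smul_smul, pow_succ]
  rw [matCoeff, matrixCoeff_apply, map_pow, h, map_smul, coord_basisVec, smul_eq_mul]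

theorem monomial_apply_K_pow (hq : q ≠ 0) (a c b n : ℕ) :
    monomial (matCoeff hq 1 0 0) (matCoeff hq 1 0 1) (matCoeff hq 1 1 0) (a, c, b)
      (gen q Gen.K ^ n) = if c = 0 ∧ b = 0 then (q ^ n) ^ a else 0 := by
  simp only [monomial]
  rw [mul_apply_K_pow, mul_apply_K_pow, pow_apply_K_pow, pow_apply_K_pow, pow_apply_K_pow,
    matCoeff_apply_K_pow, matCoeff_apply_K_pow, matCoeff_apply_K_pow]
  rcases Nat.eq_zero_or_pos c with rfl | hc
  · rcases Nat.eq_zero_or_pos b with rfl | hb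
    · simp
    · simp [hb.ne']
  · simp [hc.ne']

theorem rightTranslate_E_pow_monomial (h : IsGeneric q) (l a c b : ℕ) :
    ∃ r : k, (l ≤ b → r ≠ 0) ∧ (b < l → r = 0) ∧
      (rightTranslate (gen q Gen.E) ^ l) (monomial (matCoeff h.ne_zero 1 0 0)
        (matCoeff h.ne_zero 1 0 1) (matCoeff h.ne_zero 1 1 0) (a, c, b)) =
        r • monomial (matCoeff h.ne_zero 1 0 0) (matCoeff h.ne_zero 1 0 1)
          (matCoeff h.ne_zero 1 1 0) (a + l, c, b - l) := by
  induction l with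
  | zero => exact ⟨1, by simp, by simp, by simp⟩
  | succ l ih =>
    obtain ⟨r, hr, hr', e⟩ := ih
    rcases Nat.lt_or_ge l b with hlb | hlb
    · obtain ⟨d, hd⟩ : ∃ d, b - l = d + 1 := ⟨b - l - 1, by omega⟩
      refine ⟨r * (q⁻¹ ^ c * qInt q ((d : ℤ) + 1)), fun _ => ?_, fun _ => by omega, ?_⟩
      · exact mul_ne_zero (hr hlb.le) (mul_ne_zero (pow_ne_zero _ (inv_ne_zero h.ne_zero))
          (h.qInt_ne_zero (by omega)))
      · rw [pow_succ', Module.End.mul_apply, e, map_smul, hd, rightTranslate_E_monomial h, smul_smul,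
          show b - (l + 1) = d by omega, add_assoc]
    · refine ⟨0, fun _ => by omega, fun _ => rfl, ?_⟩
      rw [pow_succ', Module.End.mul_apply, e, map_smul, show b - l = 0 by omega,
        rightTranslate_E_monomial_zero h, smul_zero, zero_smul]

theorem leftTranslate_F_pow_monomial (h : IsGeneric q) (l a c b : ℕ) :
    ∃ r : k, (l ≤ c → r ≠ 0) ∧ (c < l → r = 0) ∧
      (leftTranslate (gen q Gen.F) ^ l) (monomial (matCoeff h.ne_zero 1 0 0)
        (matCoeff h.ne_zero 1 0 1) (matCoeff h.ne_zero 1 1 0) (a, c, b)) =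
        r • monomial (matCoeff h.ne_zero 1 0 0) (matCoeff h.ne_zero 1 0 1)
          (matCoeff h.ne_zero 1 1 0) (a + l, c - l, b) := by
  induction l with
  | zero => exact ⟨1, by simp, by simp, by simp⟩
  | succ l ih =>
    obtain ⟨r, hr, hr', e⟩ := ih
    rcases Nat.lt_or_ge l c with hlc | hlc
    · obtain ⟨d, hd⟩ : ∃ d, c - l = d + 1 := ⟨c - l - 1, by omega⟩
      refine ⟨r * (q ^ (a + l) * (q⁻¹ ^ d * qInt q ((d : ℤ) + 1))), fun _ => ?_,
        fun _ => by omega, ?_⟩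
      · exact mul_ne_zero (hr hlc.le) (mul_ne_zero (pow_ne_zero _ h.ne_zero)
          (mul_ne_zero (pow_ne_zero _ (inv_ne_zero h.ne_zero)) (h.qInt_ne_zero (by omega))))
      · rw [pow_succ', Module.End.mul_apply, e, map_smul, hd, leftTranslate_F_monomial h, smul_smul,
          show c - (l + 1) = d by omega, add_assoc]
    · refine ⟨0, fun _ => by omega, fun _ => rfl, ?_⟩
      rw [pow_succ', Module.End.mul_apply, e, map_smul, show c - l = 0 by omega,
        leftTranslate_F_monomial_zero h, smul_zero, zero_smul]

/-- The pairing of an ordered monomial with `F^{c'} K^n E^{b'}`: it vanishes unless `c = c'` and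
`b = b'`. -/
theorem exists_monomial_pairing (h : IsGeneric q) (c' b' a c b : ℕ) :
    ∃ r : k, (c = c' ∧ b = b' → r ≠ 0) ∧ ∀ n : ℕ,
      (leftTranslate (gen q Gen.F) ^ c') ((rightTranslate (gen q Gen.E) ^ b')
        (monomial (matCoeff h.ne_zero 1 0 0) (matCoeff h.ne_zero 1 0 1)
          (matCoeff h.ne_zero 1 1 0) (a, c, b))) (gen q Gen.K ^ n) =
        if c = c' ∧ b = b' then r * (q ^ n) ^ (a + b' + c') else 0 := by
  obtain ⟨r, hr, hr', e⟩ := rightTranslate_E_pow_monomial h b' a c b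
  obtain ⟨s, hs, hs', e'⟩ := leftTranslate_F_pow_monomial h c' (a + b') c (b - b')
  refine ⟨r * s, fun hcb => mul_ne_zero (hr hcb.2.ge) (hs hcb.1.ge), fun n => ?_⟩
  rw [e, map_smul, e', smul_smul]
  change r * s * (monomial _ _ _ _ : Functional q) (gen q Gen.K ^ n) = _
  rw [monomial_apply_K_pow]
  by_cases hb : b < b'
  · rw [hr' hb, zero_mul, zero_mul, if_neg (by omega)]
  by_cases hc : c < c'
  · rw [hs' hc, mul_zero, zero_mul, if_neg (by omega)]
  by_cases hcb : c = c' ∧ b = b'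
  · rw [if_pos (by omega), if_pos hcb]
  · rw [if_neg (by omega), if_neg hcb, mul_zero]

/-- The ordered monomials `α^a γ^c β^b` are linearly independent functionals: the pairing with
`F^{c₀} K^n E^{b₀}` isolates the monomials with `c = c₀`, `b = b₀`, and is a polynomial in `q^n`
whose coefficients separate the exponents `a`. -/
theorem linearIndependent_monomial (h : IsGeneric q) :
    LinearIndependent k (monomial (matCoeff h.ne_zero 1 0 0) (matCoeff h.ne_zero 1 0 1)
      (matCoeff h.ne_zero 1 1 0)) := by
  rw [linearIndependent_iff']
  rintro s g hg ⟨a₀, c₀, b₀⟩ hx₀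
  choose r hr hpair using fun x : ℕ × ℕ × ℕ => exists_monomial_pairing h c₀ b₀ x.1 x.2.1 x.2.2
  let p : Polynomial k := ∑ x ∈ s, if x.2.1 = c₀ ∧ x.2.2 = b₀ then
    Polynomial.monomial (x.1 + b₀ + c₀) (g x * r x) else 0
  have hp : ∀ n : ℕ, p.eval (q ^ n) = 0 := by
    intro n
    let Λ : Functional q →ₗ[k] k :=
      { toFun := fun ψ => (leftTranslate (gen q Gen.F) ^ c₀)
          ((rightTranslate (gen q Gen.E) ^ b₀) ψ) (gen q Gen.K ^ n)
        map_add' := fun ψ φ => by rw [map_add, map_add]; rfl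
        map_smul' := fun c ψ => by rw [map_smul, map_smul]; rfl }
    have := congrArg Λ hg
    rw [map_sum, map_zero] at this
    rw [← this, Polynomial.eval_finsetSum]
    refine Finset.sum_congr rfl fun x _ => ?_
    rw [map_smul]
    change _ = g x * _
    rw [show Λ (monomial _ _ _ x) = _ from hpair x n]
    split_ifs
    · rw [Polynomial.eval_monomial, mul_assoc]
    · rw [Polynomial.eval_zero, mul_zero]
  have hp0 : p = 0 := by
    refine Polynomial.eq_zero_of_infinite_isRoot p (Set.infinite_of_injective_forall_mem
      (f := fun n : ℕ => q ^ n) (fun m n hmn => ?_) hp)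
    have := h.zpow_injective (a₁ := (m : ℤ)) (a₂ := n) (by simpa using hmn)
    exact_mod_cast this
  have hcoeff : p.coeff (a₀ + b₀ + c₀) = g (a₀, c₀, b₀) * r (a₀, c₀, b₀) := by
    rw [Polynomial.finsetSum_coeff, Finset.sum_eq_single (a₀, c₀, b₀)]
    · rw [if_pos ⟨rfl, rfl⟩, Polynomial.coeff_monomial, if_pos rfl]
    · rintro ⟨a, c, b⟩ _ hne
      split_ifs with hcb
      · simp only at hcb
        rw [Polynomial.coeff_monomial, if_neg]
        rintro hab
        simp only at hab
        refine hne ?_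
        rw [hcb.1, hcb.2, show a = a₀ by omega]
      · rw [Polynomial.coeff_zero]
    · exact fun hn => absurd hx₀ hn
  rw [hp0, Polynomial.coeff_zero] at hcoeff
  exact (mul_eq_zero.mp hcoeff.symm).resolve_right (hr _ ⟨rfl, rfl⟩)

end independence

/-! ### Operators on `ℓ²(ℕ)` -/

section operators

theorem H_ext {f g : BH} (h : ∀ n, f (e n) = g (e n)) : f = g := by
  refine lp.ext_continuousLinearMap (by norm_num) fun n => ?_
  refine ContinuousLinearMap.ext_ring ?_
  exact h n

theorem inner_e_left (n : ℕ) (x : H) : ⟪e n, x⟫_ℂ = x n := by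
  rw [e, lp.inner_single_left]
  simp

theorem inner_e_e (m n : ℕ) : ⟪e m, e n⟫_ℂ = if m = n then 1 else 0 :=
  orthonormal_iff_ite.mp orthonormal_e m n

theorem H_ext_inner {x y : H} (h : ∀ n, ⟪e n, x⟫_ℂ = ⟪e n, y⟫_ℂ) : x = y := by
  refine lp.ext (funext fun n => ?_)
  rw [← inner_e_left, ← inner_e_left, h]

theorem adjoint_T_e_zero : ContinuousLinearMap.adjoint T (e 0) = 0 := by
  refine H_ext_inner fun n => ?_
  rw [ContinuousLinearMap.adjoint_inner_right, T_e, inner_e_e, inner_zero_right]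
  simp

theorem adjoint_T_e_succ (n : ℕ) : ContinuousLinearMap.adjoint T (e (n + 1)) = e n := by
  refine H_ext_inner fun m => ?_
  rw [ContinuousLinearMap.adjoint_inner_right, T_e, inner_e_e, inner_e_e]
  simp

theorem P₀_e (n : ℕ) : P₀ (e n) = if n = 0 then e n else 0 := by
  rw [P₀, Submodule.starProjection_unit_singleton ℂ (orthonormal_e.norm_eq_one 0), inner_e_e]
  rcases Nat.eq_zero_or_pos n with rfl | hn
  · simp
  · simp [hn.ne, hn.ne']

/-- The diagonal operator `e_n ↦ c_n e_n` with bounded entries. -/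
def diagOp (c : ℕ → ℂ) (C : ℝ) (hc : ∀ n, ‖c n‖ ≤ C) : BH :=
  lp.mapCLM 2 (fun n => c n • ContinuousLinearMap.id ℂ ℂ) ((norm_nonneg _).trans (hc 0))
    fun n => by
      rw [norm_smul]
      exact (mul_le_of_le_one_right (norm_nonneg _) ContinuousLinearMap.norm_id_le).trans (hc n)

theorem norm_diagOp_le {c : ℕ → ℂ} {C : ℝ} (hc : ∀ n, ‖c n‖ ≤ C) : ‖diagOp c C hc‖ ≤ C :=
  lp.norm_mapCLM_le _ _ _ _

theorem diagOp_e {c : ℕ → ℂ} {C : ℝ} (hc : ∀ n, ‖c n‖ ≤ C) (n : ℕ) :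
    diagOp c C hc (e n) = c n • e n := by
  refine lp.ext (funext fun m => ?_)
  change c m * e n m = c n * e n m
  by_cases h : m = n
  · rw [h]
  · have h0 : e n m = 0 := by rw [← inner_e_left, inner_e_e, if_neg h]
    rw [h0, mul_zero, mul_zero]

theorem adjoint_diagOp {c : ℕ → ℂ} {C : ℝ} (hc : ∀ n, ‖c n‖ ≤ C)
    (hreal : ∀ n, starRingEnd ℂ (c n) = c n) :
    ContinuousLinearMap.adjoint (diagOp c C hc) = diagOp c C hc := by
  refine H_ext fun n => H_ext_inner fun m => ?_
  rw [ContinuousLinearMap.adjoint_inner_right, diagOp_e, diagOp_e, inner_smul_left,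
    inner_smul_right, inner_e_e, hreal]
  by_cases h : m = n
  · rw [h]
  · simp [h]

variable (t : Param)

theorem Param.pow_le_one (n : ℕ) : (t : ℝ) ^ n ≤ 1 := pow_le_one₀ t.2.1.le t.2.2.le

/-- The numbers `√(1 - t^{2n})`, with the value at `n = 0` replaced by `1`, so that they are positive
and tend to `1` uniformly in `n` as `t → 0`. The value at `0` does not affect `π_t(α)`, as
`T* e_0 = 0`. -/
def weight (n : ℕ) : ℝ := if n = 0 then 1 else √(1 - (t : ℝ) ^ (2 * n))

theorem weight_zero : weight t 0 = 1 := if_pos rfl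

theorem weight_succ (n : ℕ) : weight t (n + 1) = √(1 - (t : ℝ) ^ (2 * (n + 1))) :=
  if_neg n.succ_ne_zero

theorem weight_nonneg (n : ℕ) : 0 ≤ weight t n := by
  rw [weight]; split_ifs <;> positivity

theorem weight_le_one (n : ℕ) : weight t n ≤ 1 := by
  rw [weight]
  split_ifs
  · exact le_rfl
  · exact Real.sqrt_le_one.mpr (sub_le_self _ (pow_nonneg t.2.1.le _))

theorem weight_pos (n : ℕ) : 0 < weight t n := by
  rw [weight]
  split_ifs with h
  · exact one_pos
  · exact Real.sqrt_pos.mpr (sub_pos.mpr (pow_lt_one₀ t.2.1.le t.2.2 (by omega)))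

theorem norm_weight_le (n : ℕ) : ‖(weight t n : ℂ)‖ ≤ 1 := by
  rw [Complex.norm_real, Real.norm_of_nonneg (weight_nonneg t n)]
  exact weight_le_one t n

theorem norm_pow_le (n : ℕ) : ‖((t : ℝ) ^ n : ℂ)‖ ≤ 1 := by
  rw [norm_pow, Complex.norm_real, Real.norm_of_nonneg t.2.1.le]
  exact t.pow_le_one n

/-- The diagonal operator with the entries `weight t n`. -/
def weightOp : BH := diagOp (fun n => (weight t n : ℂ)) 1 (norm_weight_le t)

/-- The operator `π_t(α)`. -/
def alphaOp : BH := ContinuousLinearMap.adjoint T * weightOp t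

/-- The operator `π_t(δ) = π_t(α)*`. -/
def deltaOp : BH := weightOp t * T

/-- The operator `π_t(γ)`. -/
def gammaOp : BH := diagOp (fun n => ((t : ℝ) ^ n : ℂ)) 1 (norm_pow_le t)

/-- The operator `π_t(β) = -t π_t(γ)*`. -/
def betaOp : BH := -t.c • gammaOp t

theorem weightOp_e (n : ℕ) : weightOp t (e n) = (weight t n : ℂ) • e n := diagOp_e _ n

theorem gammaOp_e (n : ℕ) : gammaOp t (e n) = ((t : ℝ) ^ n : ℂ) • e n := diagOp_e _ n

theorem betaOp_e (n : ℕ) : betaOp t (e n) = (-t.c * (t : ℝ) ^ n : ℂ) • e n := by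
  rw [betaOp, smul_apply, gammaOp_e, smul_smul]

theorem alphaOp_e_zero : alphaOp t (e 0) = 0 := by
  rw [alphaOp, mul_apply_eq_comp, weightOp_e, map_smul, adjoint_T_e_zero, smul_zero]

theorem alphaOp_e_succ (n : ℕ) : alphaOp t (e (n + 1)) = (weight t (n + 1) : ℂ) • e n := by
  rw [alphaOp, mul_apply_eq_comp, weightOp_e, map_smul, adjoint_T_e_succ]

theorem alphaOp_e (n : ℕ) :
    alphaOp t (e n) = (√(1 - (t : ℝ) ^ (2 * n)) : ℂ) • e (n - 1) := by
  cases n with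
  | zero => rw [alphaOp_e_zero]; simp
  | succ n => rw [alphaOp_e_succ, weight_succ]; rfl

theorem deltaOp_e (n : ℕ) : deltaOp t (e n) = (weight t (n + 1) : ℂ) • e (n + 1) := by
  rw [deltaOp, mul_apply_eq_comp, T_e, weightOp_e]

theorem adjoint_gammaOp : ContinuousLinearMap.adjoint (gammaOp t) = gammaOp t :=
  adjoint_diagOp _ fun n => by rw [map_pow, Complex.conj_ofReal]

theorem adjoint_weightOp : ContinuousLinearMap.adjoint (weightOp t) = weightOp t :=
  adjoint_diagOp _ fun _ => Complex.conj_ofReal _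

theorem adjoint_alphaOp : ContinuousLinearMap.adjoint (alphaOp t) = deltaOp t := by
  rw [← ContinuousLinearMap.star_eq_adjoint, alphaOp, star_mul,
    ContinuousLinearMap.star_eq_adjoint, ← ContinuousLinearMap.star_eq_adjoint T, star_star,
    adjoint_weightOp, deltaOp]

theorem adjoint_deltaOp : ContinuousLinearMap.adjoint (deltaOp t) = alphaOp t := by
  rw [← adjoint_alphaOp, ContinuousLinearMap.adjoint_adjoint]

theorem adjoint_betaOp : ContinuousLinearMap.adjoint (betaOp t) = betaOp t := by
  rw [betaOp, ← ContinuousLinearMap.star_eq_adjoint, star_smul,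
    ContinuousLinearMap.star_eq_adjoint, adjoint_gammaOp]
  congr 1
  rw [star_neg]
  exact congrArg _ (Complex.conj_ofReal _)

theorem slRelations_op : SLRelations t.c (alphaOp t) (betaOp t) (gammaOp t) (deltaOp t) where
  beta_alpha := by
    refine H_ext fun n => ?_
    cases n with
    | zero =>
      simp only [smul_apply, mul_apply_eq_comp, alphaOp_e_zero,
        betaOp_e, map_smul, map_zero, smul_zero]
    | succ n =>
      simp only [smul_apply, mul_apply_eq_comp, alphaOp_e_succ,
        betaOp_e, map_smul, smul_smul]
      congr 1
      have := t.c_ne_zero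
      field_simp
      ring
  gamma_alpha := by
    refine H_ext fun n => ?_
    cases n with
    | zero =>
      simp only [smul_apply, mul_apply_eq_comp, alphaOp_e_zero,
        gammaOp_e, map_smul, map_zero, smul_zero]
    | succ n =>
      simp only [smul_apply, mul_apply_eq_comp, alphaOp_e_succ,
        gammaOp_e, map_smul, smul_smul]
      congr 1
      have := t.c_ne_zero
      field_simp
      ring
  beta_gamma := by
    rw [betaOp, smul_mul_assoc, mul_smul_comm]
  delta_alpha := by
    have h0 := t.c_ne_zero
    refine H_ext fun n => ?_
    simp only [smul_apply, add_apply,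
      one_apply_eq_self, mul_apply_eq_comp, betaOp_e, gammaOp_e, map_smul,
      smul_smul]
    cases n with
    | zero =>
      rw [alphaOp_e_zero, map_zero, pow_zero, mul_one, mul_one, mul_neg, inv_mul_cancel₀ h0]
      simp
    | succ n =>
      rw [alphaOp_e_succ, map_smul, deltaOp_e, smul_smul, ← Complex.ofReal_mul, weight_succ,
        Real.mul_self_sqrt (sub_nonneg.mpr (t.pow_le_one _))]
      nth_rw 2 [← one_smul ℂ (e (n + 1))]
      rw [← add_smul]
      congr 1
      push_cast
      field_simp
      ring

theorem alphaOp_pow_e (N n : ℕ) : ∃ r : ℂ, r ≠ 0 ∧ (alphaOp t ^ N) (e (n + N)) = r • e n := by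
  induction N with
  | zero => exact ⟨1, one_ne_zero, by simp⟩
  | succ N ih =>
    obtain ⟨r, hr, hN⟩ := ih
    refine ⟨weight t (n + N + 1) * r, mul_ne_zero ?_ hr, ?_⟩
    · exact Complex.ofReal_ne_zero.mpr (weight_pos t _).ne'
    · rw [pow_succ, mul_apply_eq_comp, ← add_assoc, alphaOp_e_succ, map_smul, hN,
        smul_smul]

end operators

/-! ### The standard representation -/

section standardRep

variable (t : Param)

theorem Param.c_mul_self_add_one_ne_zero : t.c * t.c + 1 ≠ 0 := by
  have : (0 : ℝ) < (t : ℝ) * t + 1 := by nlinarith [t.2.1]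
  exact_mod_cast this.ne'

/-- The graph of the standard representation: the algebra of pairs generated by the generators of
the coordinate ring together with their operators. -/
def repGraph : Subalgebra ℂ (Functional t.c × BH) :=
  Algebra.adjoin ℂ {(matCoeff t.c_ne_zero 1 0 0, alphaOp t), (matCoeff t.c_ne_zero 1 0 1, betaOp t),
    (matCoeff t.c_ne_zero 1 1 0, gammaOp t), (matCoeff t.c_ne_zero 1 1 1, deltaOp t)}

theorem slRelations_graph : SLRelations t.c (R := Functional t.c × BH)
    (matCoeff t.c_ne_zero 1 0 0, alphaOp t) (matCoeff t.c_ne_zero 1 0 1, betaOp t)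
    (matCoeff t.c_ne_zero 1 1 0, gammaOp t) (matCoeff t.c_ne_zero 1 1 1, deltaOp t) := by
  have h1 := slRelations_matCoeff t.isGeneric t.c_mul_self_add_one_ne_zero
  have h2 := slRelations_op t
  exact ⟨Prod.ext h1.beta_alpha h2.beta_alpha, Prod.ext h1.gamma_alpha h2.gamma_alpha,
    Prod.ext h1.beta_gamma h2.beta_gamma, Prod.ext h1.delta_alpha h2.delta_alpha⟩

/-- The graph is the graph of a map: after multiplication by a power of `α` an element of the graph
is a combination of ordered monomials, which are determined by their first components; and the
powers of `π_t(α)` have dense range. -/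
theorem eq_zero_of_zero_mem_repGraph {y : BH} (hy : ((0 : Functional t.c), y) ∈ repGraph t) :
    y = 0 := by
  obtain ⟨N, hN⟩ := (slRelations_graph t).exists_mul_alpha_pow_mem hy
  obtain ⟨l, hl⟩ := Finsupp.mem_span_range_iff_exists_finsupp.mp hN
  have hmono : ∀ x, (monomial (R := Functional t.c × BH) (matCoeff t.c_ne_zero 1 0 0, alphaOp t)
      (matCoeff t.c_ne_zero 1 0 1, betaOp t) (matCoeff t.c_ne_zero 1 1 0, gammaOp t) x).1 =
      monomial (matCoeff t.c_ne_zero 1 0 0) (matCoeff t.c_ne_zero 1 0 1)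
        (matCoeff t.c_ne_zero 1 1 0) x := fun x => rfl
  have hl0 : l = 0 := by
    refine linearIndependent_iff.mp (linearIndependent_monomial t.isGeneric) l ?_
    have := congrArg (LinearMap.fst ℂ (Functional t.c) BH) hl
    rw [Finsupp.sum, map_sum] at this
    rw [Finsupp.linearCombination_apply, Finsupp.sum]
    refine Eq.trans ?_ (this.trans (zero_mul _))
    exact Finset.sum_congr rfl fun x _ => by
      rw [map_smul, LinearMap.fst_apply, hmono]
  rw [hl0, Finsupp.sum_zero_index] at hl
  have hyN : y * alphaOp t ^ N = 0 := (congrArg Prod.snd hl).symm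
  refine H_ext fun n => ?_
  obtain ⟨r, hr, hrn⟩ := alphaOp_pow_e t N n
  have := congrArg (fun f : BH => f (e (n + N))) hyN
  simp only [mul_apply_eq_comp, hrn, map_smul, zero_apply] at this
  exact (smul_eq_zero.mp this).resolve_left hr

theorem map_fst_repGraph :
    (repGraph t).map (AlgHom.fst ℂ (Functional t.c) BH) = OSU t := by
  rw [repGraph, AlgHom.map_adjoin, OSU, coordRing_eq_adjoin t.isGeneric, generators]
  simp [Set.image_insert_eq]

/-- The projection of the graph to the coordinate ring. -/
def graphProj : repGraph t →ₐ[ℂ] OSU t :=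
  ((AlgHom.fst ℂ (Functional t.c) BH).comp (repGraph t).val).codRestrict (OSU t) fun x => by
    rw [← map_fst_repGraph]
    exact ⟨x, x.2, rfl⟩

theorem graphProj_bijective : Function.Bijective (graphProj t) := by
  constructor
  · rw [injective_iff_map_eq_zero]
    rintro ⟨⟨a, y⟩, hx⟩ h
    have ha : a = 0 := congrArg Subtype.val h
    subst ha
    have hy := eq_zero_of_zero_mem_repGraph t hx
    subst hy
    rfl
  · rintro ⟨a, ha⟩
    have ha' := ha
    rw [← map_fst_repGraph] at ha'
    obtain ⟨x, hx, hxa⟩ := ha'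
    exact ⟨⟨x, hx⟩, Subtype.ext hxa⟩

/-- The standard representation of `O[SU_t(2)]`: the map whose graph is `repGraph t`. -/
def standardRep : OSU t →ₐ[ℂ] BH :=
  ((AlgHom.snd ℂ (Functional t.c) BH).comp (repGraph t).val).comp
    (AlgEquiv.ofBijective (graphProj t) (graphProj_bijective t)).symm.toAlgHom

theorem mem_repGraph (a : OSU t) : ((a : Functional t.c), standardRep t a) ∈ repGraph t := by
  set x := (AlgEquiv.ofBijective (graphProj t) (graphProj_bijective t)).symm a with hx
  have h1 : graphProj t x = a :=
    (AlgEquiv.ofBijective (graphProj t) (graphProj_bijective t)).apply_symm_apply a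
  have h2 : ((x : Functional t.c × BH)).1 = a := congrArg Subtype.val h1
  have h3 : ((x : Functional t.c × BH)).2 = standardRep t a := rfl
  rw [← h2, ← h3]
  exact x.2

theorem standardRep_eq {a : OSU t} {y : BH} (h : ((a : Functional t.c), y) ∈ repGraph t) :
    standardRep t a = y := by
  have := Subalgebra.sub_mem _ (mem_repGraph t a) h
  rw [Prod.mk_sub_mk, sub_self] at this
  exact sub_eq_zero.mp (eq_zero_of_zero_mem_repGraph t this)

/-- The graph is stable under the involution in both components. -/
theorem star_mem_repGraph {x : Functional t.c × BH} (hx : x ∈ repGraph t) :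
    (starFunctional t x.1, ContinuousLinearMap.adjoint x.2) ∈ repGraph t := by
  have hmem : ∀ y ∈ ({(matCoeff t.c_ne_zero 1 0 0, alphaOp t),
      (matCoeff t.c_ne_zero 1 0 1, betaOp t), (matCoeff t.c_ne_zero 1 1 0, gammaOp t),
      (matCoeff t.c_ne_zero 1 1 1, deltaOp t)} : Set (Functional t.c × BH)), y ∈ repGraph t :=
    fun y hy => Algebra.subset_adjoin hy
  induction hx using Algebra.adjoin_induction with
  | mem x hx =>
    rcases hx with rfl | rfl | rfl | rfl
    · simp only [starFunctional_alpha, adjoint_alphaOp]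
      exact hmem _ (by simp)
    · simp only [starFunctional_beta, adjoint_betaOp]
      rw [betaOp, ← Prod.smul_mk]
      exact Subalgebra.smul_mem _ (hmem _ (by simp)) _
    · have h0 : -t.c ≠ 0 := neg_ne_zero.mpr t.c_ne_zero
      have hγ : gammaOp t = (-t.c)⁻¹ • betaOp t := by
        rw [betaOp, smul_smul, inv_mul_cancel₀ h0, one_smul]
      simp only [starFunctional_gamma, adjoint_gammaOp]
      rw [hγ, ← Prod.smul_mk]
      exact Subalgebra.smul_mem _ (hmem _ (by simp)) _
    · simp only [starFunctional_delta, adjoint_deltaOp]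
      exact hmem _ (by simp)
  | algebraMap r =>
    have h1 : starFunctional t (algebraMap ℂ (Functional t.c) r) =
        algebraMap ℂ (Functional t.c) (starRingEnd ℂ r) := by
      rw [Algebra.algebraMap_eq_smul_one, starFunctional_smul, starFunctional_one,
        ← Algebra.algebraMap_eq_smul_one]
    have h2 : ContinuousLinearMap.adjoint (algebraMap ℂ BH r) =
        algebraMap ℂ BH (starRingEnd ℂ r) := by
      rw [← ContinuousLinearMap.star_eq_adjoint, Algebra.algebraMap_eq_smul_one, star_smul,
        star_one, Algebra.algebraMap_eq_smul_one, starRingEnd_apply]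
    rw [Prod.algebraMap_apply]
    simp only [h1, h2]
    exact Subalgebra.algebraMap_mem _ (starRingEnd ℂ r)
  | add x y _ _ hx hy =>
    simp only [Prod.fst_add, Prod.snd_add, starFunctional_add, map_add]
    exact Subalgebra.add_mem _ hx hy
  | mul x y _ _ hx hy =>
    have h2 : ContinuousLinearMap.adjoint (x.2 * y.2) =
        ContinuousLinearMap.adjoint y.2 * ContinuousLinearMap.adjoint x.2 :=
      star_mul x.2 y.2
    rw [Prod.fst_mul, Prod.snd_mul, starFunctional_mul, h2, ← Prod.mk_mul_mk]
    exact Subalgebra.mul_mem _ hy hx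

theorem isStandardRep_standardRep : IsStandardRep t (standardRep t) where
  map_star a b hab := by
    refine standardRep_eq t ?_
    rw [hab]
    exact star_mem_repGraph t (mem_repGraph t a)
  map_alpha a ha n := by
    have : standardRep t a = alphaOp t := by
      refine standardRep_eq t ?_
      rw [ha, uCoeff_eq]
      exact Algebra.subset_adjoin (by simp)
    rw [this, alphaOp_e]
  map_gamma a ha n := by
    have : standardRep t a = gammaOp t := by
      refine standardRep_eq t ?_
      rw [ha, uCoeff_eq]
      exact Algebra.subset_adjoin (by simp)
    rw [this, gammaOp_e]

/-- The matrix coefficient `u^m_{ij}` as an element of the coordinate ring. -/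
def ringCoeff (m i j : ℕ) : OSU t :=
  ⟨matCoeff t.c_ne_zero m i j, matCoeff_mem_coordRing t.c_ne_zero m i j⟩

variable {t}

namespace IsStandardRep

variable {π : OSU t →ₐ[ℂ] BH}

theorem apply_alpha (h : IsStandardRep t π) : π (ringCoeff t 1 0 0) = alphaOp t :=
  H_ext fun n => by
    rw [alphaOp_e]
    exact h.map_alpha _ (uCoeff_eq t.c_ne_zero 1 0 0).symm n

theorem apply_gamma (h : IsStandardRep t π) : π (ringCoeff t 1 1 0) = gammaOp t :=
  H_ext fun n => by
    rw [gammaOp_e]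
    exact h.map_gamma _ (uCoeff_eq t.c_ne_zero 1 1 0).symm n

theorem apply_delta (h : IsStandardRep t π) : π (ringCoeff t 1 1 1) = deltaOp t := by
  rw [h.map_star (ringCoeff t 1 0 0) (ringCoeff t 1 1 1) (starFunctional_alpha t).symm,
    h.apply_alpha, adjoint_alphaOp]

theorem apply_beta (h : IsStandardRep t π) : π (ringCoeff t 1 0 1) = betaOp t := by
  have h0 : -t.c ≠ 0 := neg_ne_zero.mpr t.c_ne_zero
  have h1 := h.map_star (ringCoeff t 1 1 0) ((-t.c)⁻¹ • ringCoeff t 1 0 1)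
    (starFunctional_gamma t).symm
  rw [map_smul, h.apply_gamma, adjoint_gammaOp, inv_smul_eq_iff₀ h0] at h1
  exact h1

/-- The standard representation is unique, as `α, β, γ, δ` generate the coordinate ring. -/
theorem unique {π' : OSU t →ₐ[ℂ] BH} (h : IsStandardRep t π) (h' : IsStandardRep t π') :
    π = π' := by
  refine AlgHom.ext fun a => ?_
  have ha : (a : Functional t.c) ∈ (AlgHom.equalizer π π').map (OSU t).val := by
    have hle : OSU t ≤ (AlgHom.equalizer π π').map (OSU t).val := by
      conv_lhs => rw [OSU, coordRing_eq_adjoin t.isGeneric]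
      refine Algebra.adjoin_le ?_
      rintro x (rfl | rfl | rfl | rfl)
      · exact ⟨ringCoeff t 1 0 0, h.apply_alpha.trans h'.apply_alpha.symm, rfl⟩
      · exact ⟨ringCoeff t 1 0 1, h.apply_beta.trans h'.apply_beta.symm, rfl⟩
      · exact ⟨ringCoeff t 1 1 0, h.apply_gamma.trans h'.apply_gamma.symm, rfl⟩
      · exact ⟨ringCoeff t 1 1 1, h.apply_delta.trans h'.apply_delta.symm, rfl⟩
    exact hle a.2
  obtain ⟨b, hb, hba⟩ := ha
  obtain rfl : b = a := Subtype.ext hba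
  exact hb

end IsStandardRep

theorem existsUnique_isStandardRep (t : Param) :
    ∃! π : OSU t →ₐ[ℂ] BH, IsStandardRep t π :=
  ⟨standardRep t, isStandardRep_standardRep t,
    fun _ h => h.unique (isStandardRep_standardRep t)⟩

end standardRep

/-! ### Crystal lattices -/

section crystal

theorem isGeneric_qX : IsGeneric qX := by
  refine ⟨RatFunc.X_ne_zero, fun n hn h => ?_⟩
  have h1 : algebraMap (Polynomial ℂ) Cq (Polynomial.X ^ n) = algebraMap (Polynomial ℂ) Cq 1 := by
    rw [map_pow, map_one, RatFunc.algebraMap_X]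
    exact h
  have h2 := congrArg Polynomial.natDegree (IsFractionRing.injective (Polynomial ℂ) Cq h1)
  rw [Polynomial.natDegree_X_pow, Polynomial.natDegree_one] at h2
  omega

variable {V : Type} [AddCommGroup V] [Module Cq V] {ρ : Uq qX →ₐ[Cq] Module.End Cq V}

theorem IsKashiwaraE.pow_apply {S : Module.End Cq V} (hS : IsKashiwaraE ρ S) {u : V}
    (hu : IsSingular ρ u) (i : ℕ) (hi : u ≠ 0 → divPowF ρ i u ≠ 0) :
    (S ^ i) (divPowF ρ i u) = u := by
  induction i with
  | zero => simp [divPowF_zero]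
  | succ i ih =>
    by_cases h0 : u = 0
    · rw [h0, map_zero, map_zero]
    · rw [pow_succ, Module.End.mul_apply, (hS u hu).2 i (hi h0)]
      refine ih fun _ hz => hi h0 ?_
      have := F_divPowF isGeneric_qX ρ i u
      rw [hz, map_zero] at this
      exact (smul_eq_zero.mp this.symm).resolve_left (isGeneric_qX.qInt_ne_zero (by omega))

theorem IsKashiwaraE.pow_apply_of_lt {S : Module.End Cq V} (hS : IsKashiwaraE ρ S) {u : V}
    (hu : IsSingular ρ u) {i N : ℕ} (hi : u ≠ 0 → divPowF ρ i u ≠ 0) (hN : i < N) :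
    (S ^ N) (divPowF ρ i u) = 0 := by
  obtain ⟨d, rfl⟩ := Nat.exists_eq_add_of_lt hN
  rw [show i + d + 1 = d + 1 + i by ring, pow_add, Module.End.mul_apply, hS.pow_apply hu i hi,
    pow_succ, Module.End.mul_apply, (hS u hu).1, map_zero]

theorem pow_apply_mem {L : Submodule A₀ V} {S : Module.End Cq V} (hS : ∀ v ∈ L, S v ∈ L) {v : V}
    (hv : v ∈ L) (N : ℕ) : (S ^ N) v ∈ L := by
  induction N with
  | zero => simpa using hv
  | succ N ih => rw [pow_succ', Module.End.mul_apply]; exact hS _ ih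

theorem IsKashiwaraF.pow_apply {S : Module.End Cq V} (hS : IsKashiwaraF ρ S) {u : V}
    (hu : IsSingular ρ u) (i : ℕ) : (S ^ i) u = divPowF ρ i u := by
  induction i with
  | zero => simp [divPowF_zero]
  | succ i ih => rw [pow_succ', Module.End.mul_apply, ih, hS u hu i]

/-- A crystal lattice containing `∑ F⁽ⁱ⁾ u_i` contains all the singular vectors `u_i`. -/
theorem IsCrystalLattice.singular_mem {L : Submodule A₀ V} (hL : IsCrystalLattice ρ L)
    {u : ℕ → V} (hu : ∀ i, IsSingular ρ (u i)) (hne : ∀ i, u i ≠ 0 → divPowF ρ i (u i) ≠ 0)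
    (N : ℕ) (hsum : ∑ i ∈ Finset.range N, divPowF ρ i (u i) ∈ L) : ∀ i < N, u i ∈ L := by
  obtain ⟨S, hS, hSL⟩ := hL.kashiwaraE
  obtain ⟨S', hS', hSL'⟩ := hL.kashiwaraF
  induction N with
  | zero => exact fun i hi => absurd hi (Nat.not_lt_zero i)
  | succ N ih =>
    -- `Ẽ^N` maps the sum to `u_N`.
    have hN : u N ∈ L := by
      have := pow_apply_mem hSL hsum N
      rw [Finset.sum_range_succ, map_add, map_sum, Finset.sum_eq_zero fun i hi =>
        hS.pow_apply_of_lt (hu i) (hne i) (Finset.mem_range.mp hi), zero_add,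
        hS.pow_apply (hu N) N (hne N)] at this
      exact this
    have hFN : divPowF ρ N (u N) ∈ L := by
      rw [← hS'.pow_apply (hu N)]
      exact pow_apply_mem hSL' hN N
    intro i hi
    rcases Nat.lt_succ_iff_lt_or_eq.mp hi with h | rfl
    · refine ih ?_ i h
      rw [Finset.sum_range_succ] at hsum
      simpa using Submodule.sub_mem _ hsum hFN
    · exact hN

theorem IsCrystalLattice.divPowF_mem {L : Submodule A₀ V} (hL : IsCrystalLattice ρ L) {u : V}
    (hu : IsSingular ρ u) (huL : u ∈ L) (i : ℕ) : divPowF ρ i u ∈ L := by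
  obtain ⟨S, hS, hSL⟩ := hL.kashiwaraF
  rw [← hS.pow_apply hu]
  exact pow_apply_mem hSL huL i

/-- The matrix coefficient `u^m_{ij}` of `V(m)` over `ℂ(q)`, indexed by `x = (m, i, j)`. -/
abbrev crystalCoeff (x : ℕ × ℕ × ℕ) : Functional qX :=
  matCoeff (q := qX) RatFunc.X_ne_zero x.1 x.2.1 x.2.2

theorem matrixCoeff_mem_span_crystalCoeff (hρ : IsIntegrable ρ) {L : Submodule A₀ V}
    (hL : IsCrystalLattice ρ L) {f : Module.Dual Cq V} (hf : ∀ w ∈ L, f w ∈ A₀) {v : V}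
    (hv : v ∈ L) : matrixCoeff ρ f v ∈ Submodule.span A₀ (Set.range crystalCoeff) := by
  have := hρ.finite
  rw [hL.weight] at hv
  induction hv using Submodule.iSup_induction' with
  | zero => rw [matrixCoeff_zero_right]; exact Submodule.zero_mem _
  | add x y _ _ hx hy => rw [matrixCoeff_add_right]; exact Submodule.add_mem _ hx hy
  | mem n v hv =>
    obtain ⟨hvL, hvn⟩ := Submodule.mem_inf.mp hv
    obtain ⟨N, u, hu, hsum⟩ := exists_string_decomposition isGeneric_qX (v := v) hvn
    have hsing : ∀ i, IsSingular ρ (u i) := fun i => ⟨⟨_, (hu i).1⟩, (hu i).2.1⟩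
    have huL := hL.singular_mem hsing (fun i => (hu i).2.2) N (hsum ▸ hvL)
    have key : ∀ M ≤ N, matrixCoeff ρ f (∑ i ∈ Finset.range M, divPowF ρ i (u i)) ∈
        Submodule.span A₀ (Set.range crystalCoeff) := by
      intro M hM
      induction M with
      | zero => rw [Finset.sum_range_zero, matrixCoeff_zero_right]; exact Submodule.zero_mem _
      | succ M ih =>
        rw [Finset.sum_range_succ, matrixCoeff_add_right]
        refine Submodule.add_mem _ (ih (by omega)) ?_
        obtain ⟨m, hm⟩ := matrixCoeff_divPowF isGeneric_qX (hu M).1 (hu M).2.1 f M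
        rw [hm]
        refine Submodule.sum_mem _ fun i _ => ?_
        exact Submodule.smul_mem _
          (⟨f (divPowF ρ i (u M)), hf _ (hL.divPowF_mem (hsing M) (huL M (by omega)) i)⟩ : A₀)
          (Submodule.subset_span ⟨(m, i, M), rfl⟩)
    rw [hsum]
    exact key N le_rfl

/-- The matrix coefficients `u^m_{ij}` span the form over `A₀`. -/
theorem crystalForm_le : crystalForm ≤ Submodule.span A₀ (Set.range crystalCoeff) := by
  refine Submodule.span_le.mpr ?_
  rintro _ ⟨V, _, _, ρ, L, f, v, hρ, hL, hv, hf, rfl⟩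
  exact matrixCoeff_mem_span_crystalCoeff hρ hL hf hv

/-- The standard lattice `⨁ A₀ v_j` in `V(m)`. -/
def standardLattice (m : ℕ) : Submodule A₀ (Fin (m + 1) → Cq) where
  carrier := {w | ∀ i, w i ∈ A₀}
  zero_mem' _ := A₀.zero_mem
  add_mem' hv hw i := A₀.add_mem (hv i) (hw i)
  smul_mem' c _ hw i := A₀.mul_mem c.2 (hw i)

theorem basisVec_mem_standardLattice (m j : ℕ) : basisVec Cq m j ∈ standardLattice m := by
  intro i
  rw [basisVec]
  split_ifs
  · exact A₀.one_mem
  · exact A₀.zero_mem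

theorem coord_mem {m : ℕ} {w : Fin (m + 1) → Cq} (hw : w ∈ standardLattice m) (i : ℕ) :
    coord Cq m i w ∈ A₀ := by
  rw [coord]
  split_ifs with h
  · exact hw ⟨i, h⟩
  · exact A₀.zero_mem

theorem sum_smul_mem {V : Type} [AddCommGroup V] [Module Cq V] {L : Submodule A₀ V} {c : ℕ → Cq}
    {x : ℕ → V} (hc : ∀ i, c i ∈ A₀) (hx : ∀ i, x i ∈ L) (s : Finset ℕ) :
    ∑ i ∈ s, c i • x i ∈ L :=
  Submodule.sum_mem _ fun i _ => Submodule.smul_mem L (⟨c i, hc i⟩ : A₀) (hx i)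

theorem stringMap_mem_standardLattice {m : ℕ} {x : ℕ → Fin (m + 1) → Cq}
    (hx : ∀ i, x i ∈ standardLattice m) {w : Fin (m + 1) → Cq} (hw : w ∈ standardLattice m) :
    stringMap m x w ∈ standardLattice m := by
  rw [stringMap, LinearMap.sum_apply]
  exact sum_smul_mem (fun i => coord_mem hw i) hx _

theorem eq_smul_of_isSingular {m : ℕ} {u : Fin (m + 1) → Cq}
    (hu : IsSingular (simpleModule (q := qX) RatFunc.X_ne_zero m) u) :
    u = coord Cq m 0 u • basisVec Cq m 0 := by
  have hE : ∀ i < m, coord Cq m i (simpleModule (q := qX) RatFunc.X_ne_zero m (gen qX Gen.E) u) =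
      qInt qX ((m : ℤ) - i) * coord Cq m (i + 1) u := by
    intro i hi
    rw [simpleModule_gen]
    have h1 : i < m + 1 := by omega
    have h2 : i + 1 < m + 1 := by omega
    simp only [coord, h1, h2, dif_pos, LinearMap.proj_apply, genMap]
    exact simpleE_apply_pos qX m u ⟨i, h1⟩ h2
  have h0 : ∀ i < m, coord Cq m (i + 1) u = 0 := by
    intro i hi
    have := hE i hi
    rw [hu.2, map_zero] at this
    exact (mul_eq_zero.mp this.symm).resolve_left (isGeneric_qX.qInt_ne_zero (by omega))
  conv_lhs => rw [← sum_coord_smul_basisVec m u, Finset.sum_range_succ']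
  rw [Finset.sum_eq_zero, zero_add]
  intro i hi
  rw [h0 i (Finset.mem_range.mp hi), zero_smul]

theorem divPowF_basisVec_zero (m n : ℕ) :
    divPowF (simpleModule (q := qX) RatFunc.X_ne_zero m) n (basisVec Cq m 0) = basisVec Cq m n := by
  induction n with
  | zero => rw [divPowF_zero]
  | succ n ih =>
    have := F_divPowF isGeneric_qX (simpleModule (q := qX) RatFunc.X_ne_zero m) n (basisVec Cq m 0)
    rw [ih, simpleModule_F] at this
    exact (smul_right_injective _ (isGeneric_qX.qInt_ne_zero (n := (n : ℤ) + 1) (by omega)) this).symm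

theorem isCrystalLattice_standardLattice (m : ℕ) :
    IsCrystalLattice (simpleModule (q := qX) RatFunc.X_ne_zero m) (standardLattice m) where
  fg := by
    classical
    refine ⟨(Finset.range (m + 1)).image (basisVec Cq m), le_antisymm (Submodule.span_le.mpr ?_) ?_⟩
    · intro x hx
      obtain ⟨j, -, rfl⟩ := Finset.mem_image.mp (Finset.mem_coe.mp hx)
      exact basisVec_mem_standardLattice m j
    · intro w hw
      rw [← sum_coord_smul_basisVec m w]
      refine Submodule.sum_mem _ fun i hi => ?_
      exact Submodule.smul_mem _ (⟨coord Cq m i w, coord_mem hw i⟩ : A₀)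
        (Submodule.subset_span (Finset.mem_coe.mpr (Finset.mem_image_of_mem _ hi)))
  span_eq_top := by
    refine eq_top_iff.mpr fun w _ => ?_
    rw [← sum_coord_smul_basisVec m w]
    exact Submodule.sum_mem _ fun i _ => Submodule.smul_mem _ _
      (Submodule.subset_span (basisVec_mem_standardLattice m i))
  weight := by
    refine le_antisymm (fun w hw => ?_) (iSup_le fun n => inf_le_left)
    rw [← sum_coord_smul_basisVec m w]
    refine Submodule.sum_mem _ fun i _ => ?_
    refine Submodule.smul_mem _ (⟨coord Cq m i w, coord_mem hw i⟩ : A₀) ?_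
    refine Submodule.mem_iSup_of_mem ((m : ℤ) - 2 * i) ⟨basisVec_mem_standardLattice m i, ?_⟩
    exact mem_weightSpace.mpr (simpleModule_K _ m i)
  kashiwaraE := by
    refine ⟨stringMap m fun j => Nat.casesOn j 0 (basisVec Cq m), fun u hu => ?_,
      fun v hv => stringMap_mem_standardLattice (fun i => ?_) hv⟩
    · rw [eq_smul_of_isSingular hu]
      refine ⟨?_, fun n hn => ?_⟩
      · rw [map_smul, stringMap_basisVec _ _ (Nat.zero_le m)]
        exact smul_zero _
      · simp only [map_smul, divPowF_basisVec_zero] at hn ⊢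
        have hnm : n + 1 ≤ m := by
          by_contra h
          exact hn (by rw [basisVec_of_lt (by omega), smul_zero])
        rw [stringMap_basisVec _ _ hnm]
    · cases i with
      | zero => exact Submodule.zero_mem _
      | succ i => exact basisVec_mem_standardLattice m i
  kashiwaraF := by
    refine ⟨stringMap m fun j => basisVec Cq m (j + 1), fun u hu n => ?_,
      fun v hv => stringMap_mem_standardLattice (fun i => basisVec_mem_standardLattice m _) hv⟩
    rw [eq_smul_of_isSingular hu]
    simp only [map_smul, divPowF_basisVec_zero]
    by_cases hnm : n ≤ m
    · rw [stringMap_basisVec _ _ hnm]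
    · rw [basisVec_of_lt (j := n) (by omega), basisVec_of_lt (j := n + 1) (by omega), map_zero]

theorem crystalCoeff_mem_crystalForm (m i j : ℕ) : crystalCoeff (m, i, j) ∈ crystalForm :=
  Submodule.subset_span ⟨_, inferInstance, inferInstance, simpleModule RatFunc.X_ne_zero m,
    standardLattice m, coord Cq m i, basisVec Cq m j, isIntegrable_simpleModule _ m,
    isCrystalLattice_standardLattice m, basisVec_mem_standardLattice m j,
    fun _ hw => coord_mem hw i, rfl⟩

end crystal

/-! ### Specialization -/

section specialization

/-- The rational function `x` is regular at `t` with value `y`. Any representation `g / h` with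
`h(t) ≠ 0` is allowed, not only the reduced one. -/
def RegularAt (t : ℂ) (x : Cq) (y : ℂ) : Prop :=
  ∃ g h : Polynomial ℂ, h.eval t ≠ 0 ∧ x * algebraMap (Polynomial ℂ) Cq h =
    algebraMap (Polynomial ℂ) Cq g ∧ y * h.eval t = g.eval t

namespace RegularAt

variable {t : ℂ} {x x' : Cq} {y y' : ℂ}

theorem iff_denom : RegularAt t x y ↔
    x.denom.eval t ≠ 0 ∧ y = x.eval (RingHom.id ℂ) t := by
  constructor
  · rintro ⟨g, h, hh, hx, hy⟩
    have h0 : h ≠ 0 := fun h0 => hh (by rw [h0, Polynomial.eval_zero])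
    have h0' : algebraMap (Polynomial ℂ) Cq h ≠ 0 :=
      (map_ne_zero_iff _ (IsFractionRing.injective (Polynomial ℂ) Cq)).mpr h0
    have hx' : x = algebraMap (Polynomial ℂ) Cq g / algebraMap (Polynomial ℂ) Cq h := by
      rw [eq_div_iff h0', hx]
    have hd : x.denom.eval t ≠ 0 := by
      obtain ⟨r, hr⟩ := hx' ▸ RatFunc.denom_div_dvd g h
      intro hz
      exact hh (by rw [hr, Polynomial.eval_mul, hz, zero_mul])
    refine ⟨hd, ?_⟩
    have hxe := congrArg (RatFunc.eval (RingHom.id ℂ) t) hx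
    rw [RatFunc.eval_mul (RingHom.id ℂ) t hd (by simp), RatFunc.eval_algebraMap,
      RatFunc.eval_algebraMap] at hxe
    exact mul_right_cancel₀ hh (hy.trans hxe.symm)
  · rintro ⟨hd, rfl⟩
    refine ⟨x.num, x.denom, hd, ?_, ?_⟩
    · have h0 : algebraMap (Polynomial ℂ) Cq x.denom ≠ 0 :=
        (map_ne_zero_iff _ (IsFractionRing.injective (Polynomial ℂ) Cq)).mpr x.denom_ne_zero
      exact (eq_div_iff h0).mp (RatFunc.num_div_denom x).symm
    · rw [RatFunc.eval]
      exact div_mul_cancel₀ _ hd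

theorem add (h : RegularAt t x y) (h' : RegularAt t x' y') : RegularAt t (x + x') (y + y') := by
  obtain ⟨g, d, hd, hx, hy⟩ := h
  obtain ⟨g', d', hd', hx', hy'⟩ := h'
  refine ⟨g * d' + g' * d, d * d', ?_, ?_, ?_⟩
  · rw [Polynomial.eval_mul]; exact mul_ne_zero hd hd'
  · rw [map_mul, map_add, map_mul, map_mul, ← hx, ← hx']; ring
  · rw [Polynomial.eval_mul, Polynomial.eval_add, Polynomial.eval_mul, Polynomial.eval_mul, ← hy,
      ← hy']
    ring

theorem mul (h : RegularAt t x y) (h' : RegularAt t x' y') : RegularAt t (x * x') (y * y') := by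
  obtain ⟨g, d, hd, hx, hy⟩ := h
  obtain ⟨g', d', hd', hx', hy'⟩ := h'
  refine ⟨g * g', d * d', ?_, ?_, ?_⟩
  · rw [Polynomial.eval_mul]; exact mul_ne_zero hd hd'
  · rw [map_mul, map_mul, ← hx, ← hx']; ring
  · rw [Polynomial.eval_mul, Polynomial.eval_mul, ← hy, ← hy']
    ring

theorem neg (h : RegularAt t x y) : RegularAt t (-x) (-y) := by
  obtain ⟨g, d, hd, hx, hy⟩ := h
  exact ⟨-g, d, hd, by rw [map_neg, ← hx, neg_mul], by rw [Polynomial.eval_neg, ← hy, neg_mul]⟩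

theorem sub (h : RegularAt t x y) (h' : RegularAt t x' y') : RegularAt t (x - x') (y - y') := by
  rw [sub_eq_add_neg, sub_eq_add_neg]
  exact h.add h'.neg

theorem zero : RegularAt t 0 0 := ⟨0, 1, by simp, by simp, by simp⟩

theorem one : RegularAt t 1 1 := ⟨1, 1, by simp, by simp, by simp⟩

theorem inv (h : RegularAt t x y) (hy0 : y ≠ 0) : RegularAt t x⁻¹ y⁻¹ := by
  obtain ⟨g, d, hd, hx, hy⟩ := h
  have hg : g.eval t ≠ 0 := by rw [← hy]; exact mul_ne_zero hy0 hd
  have hg0 : g ≠ 0 := fun h0 => hg (by rw [h0, Polynomial.eval_zero])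
  have hx0 : x ≠ 0 := by
    rintro rfl
    rw [zero_mul] at hx
    exact hg0 ((map_eq_zero_iff _ (IsFractionRing.injective (Polynomial ℂ) Cq)).mp hx.symm)
  refine ⟨d, g, hg, ?_, ?_⟩
  · rw [← hx, inv_mul_cancel_left₀ hx0]
  · rw [← hy, inv_mul_cancel_left₀ hy0]

theorem qX : RegularAt t qX t :=
  ⟨Polynomial.X, 1, by simp, by simp, by simp⟩

theorem pow (h : RegularAt t x y) (n : ℕ) : RegularAt t (x ^ n) (y ^ n) := by
  induction n with
  | zero => simpa using one
  | succ n ih => rw [pow_succ, pow_succ]; exact ih.mul h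

theorem zpow (h : RegularAt t x y) (hy0 : y ≠ 0) (n : ℤ) : RegularAt t (x ^ n) (y ^ n) := by
  obtain ⟨m, rfl | rfl⟩ := n.eq_nat_or_neg
  · rw [zpow_natCast, zpow_natCast]; exact h.pow m
  · rw [zpow_neg, zpow_neg, zpow_natCast, zpow_natCast]
    exact (h.pow m).inv (pow_ne_zero m hy0)

theorem qInt (h : IsGeneric t) (n : ℤ) : RegularAt t (qInt QSL2.qX n) (QSL2.qInt t n) := by
  have hX : ∀ n : ℤ, RegularAt t (QSL2.qX ^ n) (t ^ n) := fun n => qX.zpow h.ne_zero n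
  rw [QSL2.qInt, QSL2.qInt, div_eq_mul_inv, div_eq_mul_inv]
  refine ((hX n).sub (hX (-n))).mul (inv ?_ h.sub_inv_ne_zero)
  exact qX.sub (qX.inv h.ne_zero)

end RegularAt

variable {t : ℂ}

theorem isSpecialization_iff {u : Functional qX} {a : Functional t} :
    IsSpecialization t u a ↔ ∀ w : List Gen, RegularAt t (u (word qX w)) (a (word t w)) :=
  forall_congr' fun _ => RegularAt.iff_denom.symm

theorem IsSpecialization.add {u u' : Functional qX} {a a' : Functional t}
    (h : IsSpecialization t u a) (h' : IsSpecialization t u' a') :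
    IsSpecialization t (u + u') (a + a') := by
  rw [isSpecialization_iff] at *
  exact fun w => (h w).add (h' w)

theorem IsSpecialization.smul {c : Cq} {c' : ℂ} (hc : RegularAt t c c') {u : Functional qX}
    {a : Functional t} (h : IsSpecialization t u a) : IsSpecialization t (c • u) (c' • a) := by
  rw [isSpecialization_iff] at *
  exact fun w => hc.mul (h w)

theorem IsSpecialization.zero : IsSpecialization t 0 0 := by
  rw [isSpecialization_iff]
  exact fun w => RegularAt.zero

theorem mem_span_word (X : Uq t) : X ∈ Submodule.span ℂ (Set.range (word t)) := by
  suffices H : ∀ Y ∈ Submodule.span ℂ (Set.range (word t)),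
      X * Y ∈ Submodule.span ℂ (Set.range (word t)) by
    simpa using H 1 (Submodule.subset_span ⟨[], rfl⟩)
  induction X using Uq_induction with
  | hgen g =>
    intro Y hY
    induction hY using Submodule.span_induction with
    | mem Y hY =>
      obtain ⟨w, rfl⟩ := hY
      exact Submodule.subset_span ⟨g :: w, by simp [word]⟩
    | zero => rw [mul_zero]; exact Submodule.zero_mem _
    | add Y Z _ _ hY hZ => rw [mul_add]; exact Submodule.add_mem _ hY hZ
    | smul c Y _ hY => rw [mul_smul_comm]; exact Submodule.smul_mem _ _ hY
  | hscal c => intro Y hY; rw [← Algebra.smul_def]; exact Submodule.smul_mem _ _ hY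
  | hadd X X' hX hX' => intro Y hY; rw [add_mul]; exact Submodule.add_mem _ (hX Y hY) (hX' Y hY)
  | hmul X X' hX hX' => intro Y hY; rw [mul_assoc]; exact hX _ (hX' Y hY)

theorem IsSpecialization.unique {u : Functional qX} {a b : Functional t}
    (ha : IsSpecialization t u a) (hb : IsSpecialization t u b) : a = b := by
  refine functional_ext fun X => ?_
  have := mem_span_word X
  induction this using Submodule.span_induction with
  | mem X hX =>
    obtain ⟨w, rfl⟩ := hX
    rw [(ha w).2, (hb w).2]
  | zero => exact (map_zero a.ofConv).trans (map_zero b.ofConv).symm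
  | add X Y _ _ hX hY =>
    exact (map_add a.ofConv X Y).trans ((congrArg₂ (· + ·) hX hY).trans (map_add b.ofConv X Y).symm)
  | smul c X _ hX =>
    exact (map_smul a.ofConv c X).trans ((congrArg (c • ·) hX).trans (map_smul b.ofConv c X).symm)

theorem regularAt_simpleModule_gen (h : IsGeneric t) (m : ℕ) (g : Gen) {v : Fin (m + 1) → Cq}
    {w : Fin (m + 1) → ℂ} (hvw : ∀ i, RegularAt t (v i) (w i)) (i : Fin (m + 1)) :
    RegularAt t (simpleModule (q := qX) RatFunc.X_ne_zero m (gen qX g) v i)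
      (simpleModule h.ne_zero m (gen t g) w i) := by
  rw [simpleModule_gen, simpleModule_gen]
  cases g with
  | E =>
    simp only [genMap]
    by_cases hi : (i : ℕ) + 1 < m + 1
    · rw [simpleE_apply_pos _ _ _ _ hi, simpleE_apply_pos _ _ _ _ hi]
      exact (RegularAt.qInt h _).mul (hvw _)
    · rw [simpleE_apply_neg _ _ _ _ hi, simpleE_apply_neg _ _ _ _ hi]
      exact RegularAt.zero
  | F =>
    simp only [genMap]
    by_cases hi : 0 < (i : ℕ)
    · rw [simpleF_apply_pos _ _ _ _ hi, simpleF_apply_pos _ _ _ _ hi]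
      exact (RegularAt.qInt h _).mul (hvw _)
    · rw [simpleF_apply_neg _ _ _ _ hi, simpleF_apply_neg _ _ _ _ hi]
      exact RegularAt.zero
  | K => exact (RegularAt.qX.zpow h.ne_zero _).mul (hvw i)
  | K' => exact (RegularAt.qX.zpow h.ne_zero _).mul (hvw i)

/-- The generators act on `V(m)` by matrices with entries regular at `t`, whose values at `t` are
the entries of the corresponding matrices at the parameter `t`. -/
theorem isSpecialization_matCoeff (h : IsGeneric t) (m i j : ℕ) :
    IsSpecialization t (matCoeff (q := qX) RatFunc.X_ne_zero m i j) (matCoeff h.ne_zero m i j) := by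
  rw [isSpecialization_iff]
  intro w
  have key : ∀ l : Fin (m + 1), RegularAt t
      (simpleModule (q := qX) RatFunc.X_ne_zero m (word qX w) (basisVec Cq m j) l)
      (simpleModule h.ne_zero m (word t w) (basisVec ℂ m j) l) := by
    induction w with
    | nil =>
      intro l
      simp only [word, List.map_nil, List.prod_nil, map_one, Module.End.one_apply, basisVec]
      split_ifs
      · exact RegularAt.one
      · exact RegularAt.zero
    | cons g w ih =>
      have hw : ∀ {k : Type} [Field k] (q : k), word q (g :: w) = gen q g * word q w :=
        fun q => by simp [word]
      intro l
      rw [hw, hw, map_mul, map_mul, Module.End.mul_apply, Module.End.mul_apply]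
      exact regularAt_simpleModule_gen h m g ih l
  rw [matCoeff, matCoeff, matrixCoeff_apply, matrixCoeff_apply, coord, coord]
  split_ifs with hi
  · exact key _
  · exact RegularAt.zero

end specialization

/-! ### The limit `q → 0⁺` -/

section crystalLimit

open Filter Topology

/-- The filter `t → 0⁺` on the interval of parameters. -/
def toZero : Filter Param := comap (fun t : Param => (t : ℝ)) (𝓝 0)

theorem tendsto_param : Tendsto (fun t : Param => (t : ℝ)) toZero (𝓝 0) := tendsto_comap

theorem tendsto_param_c : Tendsto (fun t : Param => t.c) toZero (𝓝 0) := by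
  have := (Complex.continuous_ofReal.tendsto 0).comp tendsto_param
  rwa [Complex.ofReal_zero] at this

theorem exists_param_lt {δ : ℝ} (hδ : 0 < δ) : ∃ t : Param, (t : ℝ) < δ := by
  refine ⟨⟨min (δ / 2) (1 / 2), ?_, ?_⟩, ?_⟩
  · positivity
  · exact (min_le_right _ _).trans_lt (by norm_num)
  · exact (min_le_left _ _).trans_lt (half_lt_self hδ)

theorem exists_forall_of_eventually {p : Param → Prop} (h : ∀ᶠ t in toZero, p t) :
    ∃ δ > 0, ∀ t : Param, (t : ℝ) < δ → p t := by
  obtain ⟨δ, hδ, H⟩ := (Metric.nhds_basis_ball.comap _).eventually_iff.mp h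
  refine ⟨δ, hδ, fun t ht => H ?_⟩
  rw [Set.mem_preimage, Metric.mem_ball, Real.dist_eq, sub_zero, abs_of_pos t.2.1]
  exact ht

theorem norm_sub_le_of_diagonal {A B : BH} {c : ℕ → ℂ} {C : ℝ} (hc : ∀ n, ‖c n‖ ≤ C)
    (h : ∀ n, A (e n) - B (e n) = c n • e n) : ‖A - B‖ ≤ C := by
  have : A - B = diagOp c C hc := H_ext fun n => by rw [diagOp_e, ← h n]; rfl
  rw [this]
  exact norm_diagOp_le hc

theorem tendsto_of_norm_sub_le {A : Param → BH} {B : BH} (h : ∀ t : Param, ‖A t - B‖ ≤ t) :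
    Tendsto A toZero (𝓝 B) :=
  tendsto_iff_norm_sub_tendsto_zero.mpr
    (squeeze_zero (fun _ => norm_nonneg _) h tendsto_param)

theorem tendsto_weightOp : Tendsto weightOp toZero (𝓝 1) := by
  refine tendsto_of_norm_sub_le fun t =>
    norm_sub_le_of_diagonal (c := fun n => ((weight t n - 1 : ℝ) : ℂ)) (fun n => ?_) fun n => ?_
  · rw [Complex.norm_real, Real.norm_eq_abs, abs_sub_comm,
      abs_of_nonneg (sub_nonneg.mpr (weight_le_one t n))]
    cases n with
    | zero => rw [weight_zero, sub_self]; exact t.2.1.le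
    | succ n =>
      -- `1 - √(1 - x) ≤ x` for `0 ≤ x ≤ 1`.
      have h1 : (t : ℝ) ^ (2 * (n + 1)) ≤ t :=
        (pow_le_pow_of_le_one t.2.1.le t.2.2.le (by omega : 1 ≤ 2 * (n + 1))).trans_eq (pow_one _)
      have h2 : 1 - (t : ℝ) ^ (2 * (n + 1)) ≤ weight t (n + 1) := by
        rw [weight_succ]
        refine Real.le_sqrt_of_sq_le ?_
        have h3 := t.pow_le_one (2 * (n + 1))
        have h4 : 0 ≤ (t : ℝ) ^ (2 * (n + 1)) := pow_nonneg t.2.1.le _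
        nlinarith
      linarith
  · rw [weightOp_e, one_apply_eq_self, Complex.ofReal_sub, Complex.ofReal_one, sub_smul, one_smul]

theorem tendsto_alphaOp : Tendsto alphaOp toZero (𝓝 (ContinuousLinearMap.adjoint T)) := by
  have := tendsto_weightOp.const_mul (ContinuousLinearMap.adjoint T)
  rwa [mul_one] at this

theorem tendsto_deltaOp : Tendsto deltaOp toZero (𝓝 T) := by
  have := tendsto_weightOp.mul_const T
  rwa [one_mul] at this

theorem tendsto_gammaOp : Tendsto gammaOp toZero (𝓝 P₀) := by
  refine tendsto_of_norm_sub_le fun t =>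
    norm_sub_le_of_diagonal (c := fun n => if n = 0 then 0 else ((t : ℝ) ^ n : ℂ))
      (fun n => ?_) fun n => ?_
  · cases n with
    | zero => rw [if_pos rfl, norm_zero]; exact t.2.1.le
    | succ n =>
      rw [if_neg n.succ_ne_zero, norm_pow, Complex.norm_real, Real.norm_of_nonneg t.2.1.le]
      exact (pow_le_pow_of_le_one t.2.1.le t.2.2.le (by omega : 1 ≤ n + 1)).trans_eq (pow_one _)
  · rw [gammaOp_e, P₀_e]
    split_ifs with h
    · rw [h, pow_zero, one_smul, sub_self, zero_smul]
    · rw [sub_zero]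

theorem tendsto_betaOp : Tendsto betaOp toZero (𝓝 0) := by
  have := tendsto_param_c.neg.smul tendsto_gammaOp
  rwa [neg_zero, zero_smul] at this

theorem P₀_mul_P₀ : P₀ * P₀ = P₀ := Submodule.isIdempotentElem_starProjection _

/-- The limit of `π_t(u^m_{ij})` for `0 ≤ i, j ≤ m`. -/
def limitOp (m i j : ℕ) : BH :=
  if j < i then T ^ j * P₀ * ContinuousLinearMap.adjoint T ^ (m - i)
  else if i = j then T ^ i * ContinuousLinearMap.adjoint T ^ (m - i)
  else 0

theorem limitOp_zero_zero (m : ℕ) : limitOp m 0 0 = ContinuousLinearMap.adjoint T ^ m := by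
  simp [limitOp]

theorem limitOp_zero_succ (m j : ℕ) : limitOp m 0 (j + 1) = 0 := by
  simp [limitOp]

theorem limitOp_succ_zero (m i : ℕ) : limitOp (m + 1) (i + 1) 0 = P₀ * limitOp m i 0 := by
  cases i with
  | zero => simp [limitOp]
  | succ i => simp [limitOp, ← mul_assoc, P₀_mul_P₀]

theorem limitOp_succ_succ (m i j : ℕ) :
    limitOp (m + 1) (i + 1) (j + 1) = T * limitOp m i j := by
  simp only [limitOp, Nat.add_lt_add_iff_right, Nat.add_right_cancel_iff, Nat.add_sub_add_right,
    pow_succ', mul_assoc, mul_ite, mul_zero]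

variable {π : (t : Param) → OSU t →ₐ[ℂ] BH}

theorem tendsto_ringCoeff (hπ : ∀ t, IsStandardRep t (π t)) (m : ℕ) :
    ∀ i ≤ m, ∀ j ≤ m,
      Tendsto (fun t => π t (ringCoeff t m i j)) toZero (𝓝 (limitOp m i j)) := by
  induction m with
  | zero =>
    intro i hi j hj
    obtain rfl := Nat.le_zero.mp hi
    obtain rfl := Nat.le_zero.mp hj
    have h1 : ∀ t, ringCoeff t 0 0 0 = 1 := fun t => Subtype.ext (matCoeff_zero _)
    simp only [h1, map_one, limitOp_zero_zero, pow_zero]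
    exact tendsto_const_nhds
  | succ m ih =>
    -- The recursions also involve `u^m_{i,j+1}` with `j = m`, which is zero; as its factor tends
    -- to zero, only the existence of a limit matters.
    have hbd : ∀ i ≤ m, ∀ j,
        ∃ L, Tendsto (fun t => π t (ringCoeff t m i j)) toZero (𝓝 L) := by
      intro i hi j
      by_cases hj : j ≤ m
      · exact ⟨_, ih i hi j hj⟩
      · have h0 : ∀ t, ringCoeff t m i j = 0 :=
          fun t => Subtype.ext (matCoeff_of_lt_right _ i (by omega))
        exact ⟨0, by simp only [h0, map_zero]; exact tendsto_const_nhds⟩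
    have hpow : ∀ j : ℕ, Tendsto (fun t : Param => t.c ^ (j + 1)) toZero (𝓝 0) := fun j => by
      have := tendsto_param_c.pow (j + 1)
      rwa [zero_pow j.succ_ne_zero] at this
    have h2 : ∀ t : Param, t.c - t.c⁻¹ ≠ 0 := fun t => t.isGeneric.sub_inv_ne_zero
    intro i hi j hj
    cases i with
    | zero =>
      cases j with
      | zero =>
        have hrec : ∀ t, ringCoeff t (m + 1) 0 0 = ringCoeff t 1 0 0 * ringCoeff t m 0 0 :=
          fun t => Subtype.ext (by
            have := matCoeff_low_zero t.c_ne_zero (h2 t) (Nat.zero_le m)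
            rwa [pow_zero, one_smul] at this)
        simp only [hrec, map_mul, (hπ _).apply_alpha]
        have := tendsto_alphaOp.mul (ih 0 (Nat.zero_le m) 0 (Nat.zero_le m))
        rwa [limitOp_zero_zero, ← pow_succ', ← limitOp_zero_zero] at this
      | succ j =>
        have hrec : ∀ t, ringCoeff t (m + 1) 0 (j + 1) =
            t.c ^ (j + 1) • (ringCoeff t 1 0 0 * ringCoeff t m 0 (j + 1)) +
              ringCoeff t 1 0 1 * ringCoeff t m 0 j :=
          fun t => Subtype.ext (by
            have := matCoeff_low_succ t.c_ne_zero (h2 t) (Nat.zero_le m)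
              (show j ≤ m by omega)
            rwa [pow_zero, one_smul] at this)
        simp only [hrec, map_add, map_smul, map_mul, (hπ _).apply_alpha, (hπ _).apply_beta]
        obtain ⟨L, hL⟩ := hbd 0 (Nat.zero_le m) (j + 1)
        have := ((hpow j).smul (tendsto_alphaOp.mul hL)).add
          (tendsto_betaOp.mul (ih 0 (Nat.zero_le m) j (by omega)))
        rwa [zero_smul, zero_mul, add_zero, ← limitOp_zero_succ (m + 1) j] at this
    | succ i =>
      cases j with
      | zero =>
        have hrec : ∀ t, ringCoeff t (m + 1) (i + 1) 0 = ringCoeff t 1 1 0 * ringCoeff t m i 0 :=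
          fun t => Subtype.ext (matCoeff_succ_zero t.c_ne_zero (h2 t) (by omega))
        simp only [hrec, map_mul, (hπ _).apply_gamma, limitOp_succ_zero]
        exact tendsto_gammaOp.mul (ih i (by omega) 0 (Nat.zero_le m))
      | succ j =>
        have hrec : ∀ t, ringCoeff t (m + 1) (i + 1) (j + 1) =
            t.c ^ (j + 1) • (ringCoeff t 1 1 0 * ringCoeff t m i (j + 1)) +
              ringCoeff t 1 1 1 * ringCoeff t m i j :=
          fun t => Subtype.ext (matCoeff_succ_succ t.c_ne_zero (h2 t) (by omega) (by omega))
        simp only [hrec, map_add, map_smul, map_mul, (hπ _).apply_gamma, (hπ _).apply_delta,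
          limitOp_succ_succ]
        obtain ⟨L, hL⟩ := hbd i (by omega) (j + 1)
        have := ((hpow j).smul (tendsto_gammaOp.mul hL)).add
          (tendsto_deltaOp.mul (ih i (by omega) j (by omega)))
        rwa [zero_smul, zero_add] at this

/-- The elements `a t`, which specialize `u` for small `t`, have operators `π_t(a t)` that converge
to `L`. In contrast with `HasCrystalLimit`, the family `a` does not depend on the precision. -/
def SpecializationTendsto (π : (t : Param) → OSU t →ₐ[ℂ] BH) (u : Functional qX) (L : BH) : Prop :=
  ∃ a : (t : Param) → OSU t, (∀ᶠ t in toZero, IsSpecialization t.c u (a t : Functional t.c)) ∧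
    Tendsto (fun t => π t (a t)) toZero (𝓝 L)

namespace SpecializationTendsto

theorem hasCrystalLimit {u : Functional qX} {L : BH} (h : SpecializationTendsto π u L) :
    HasCrystalLimit π u L := by
  obtain ⟨a, ha, haL⟩ := h
  intro ε hε
  have h1 := (tendsto_iff_norm_sub_tendsto_zero.mp haL).eventually_lt_const hε
  obtain ⟨δ, hδ, H⟩ := exists_forall_of_eventually (ha.and h1)
  exact ⟨δ, hδ, fun t ht => ⟨a t, H t ht⟩⟩

theorem zero : SpecializationTendsto π 0 0 :=
  ⟨fun _ => 0, .of_forall fun _ => IsSpecialization.zero, by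
    simp only [map_zero]; exact tendsto_const_nhds⟩

theorem add {u u' : Functional qX} {L L' : BH} (h : SpecializationTendsto π u L)
    (h' : SpecializationTendsto π u' L') : SpecializationTendsto π (u + u') (L + L') := by
  obtain ⟨a, ha, hL⟩ := h
  obtain ⟨a', ha', hL'⟩ := h'
  refine ⟨fun t => a t + a' t, ?_, ?_⟩
  · filter_upwards [ha, ha'] with t h1 h2 using h1.add h2
  · simp only [map_add]
    exact hL.add hL'

theorem smul {u : Functional qX} {L : BH} (h : SpecializationTendsto π u L) (c : A₀) :
    ∃ L', SpecializationTendsto π (c • u) L' := by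
  obtain ⟨a, ha, hL⟩ := h
  obtain ⟨_, g, d, hd, rfl⟩ := c
  have hev : ∀ p : Polynomial ℂ, Tendsto (fun t : Param => p.eval t.c) toZero (𝓝 (p.eval 0)) :=
    fun p => (p.continuous.tendsto 0).comp tendsto_param_c
  refine ⟨(g.eval 0 / d.eval 0) • L, fun t => (g.eval t.c / d.eval t.c) • a t, ?_, ?_⟩
  · filter_upwards [ha, (hev d).eventually_ne hd] with t h1 h2
    refine IsSpecialization.smul ⟨g, d, h2, ?_, div_mul_cancel₀ _ h2⟩ h1
    refine div_mul_cancel₀ _ fun h0 => h2 ?_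
    rw [(map_eq_zero_iff _ (IsFractionRing.injective (Polynomial ℂ) Cq)).mp h0,
      Polynomial.eval_zero]
  · simp only [map_smul]
    exact ((hev g).div (hev d) hd).smul hL

theorem crystalCoeff (hπ : ∀ t, IsStandardRep t (π t)) {m i j : ℕ} (hi : i ≤ m) (hj : j ≤ m) :
    SpecializationTendsto π (crystalCoeff (m, i, j)) (limitOp m i j) :=
  ⟨fun t => ringCoeff t m i j,
    .of_forall fun t => isSpecialization_matCoeff t.isGeneric m i j,
    tendsto_ringCoeff hπ m i hi j hj⟩

end SpecializationTendsto

/-- The `u^m_{ij}` have limits, and these span the form over `A₀`. -/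
theorem exists_specializationTendsto (hπ : ∀ t, IsStandardRep t (π t)) {u : Functional qX}
    (hu : u ∈ crystalForm) : ∃ L, SpecializationTendsto π u L := by
  replace hu := crystalForm_le hu
  induction hu using Submodule.span_induction with
  | mem u hu =>
    obtain ⟨⟨m, i, j⟩, rfl⟩ := hu
    by_cases h : i ≤ m ∧ j ≤ m
    · exact ⟨_, .crystalCoeff hπ h.1 h.2⟩
    · have h0 : QSL2.crystalCoeff (m, i, j) = 0 := by
        rcases not_and_or.mp h with h | h
        · exact matCoeff_of_lt_left _ j (Nat.lt_of_not_le h)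
        · exact matCoeff_of_lt_right _ i (Nat.lt_of_not_le h)
      rw [h0]
      exact ⟨0, .zero⟩
  | zero => exact ⟨0, .zero⟩
  | add u u' _ _ h h' =>
    obtain ⟨L, hL⟩ := h
    obtain ⟨L', hL'⟩ := h'
    exact ⟨_, hL.add hL'⟩
  | smul c u _ h =>
    obtain ⟨L, hL⟩ := h
    exact hL.smul c

theorem HasCrystalLimit.unique {u : Functional qX} {L L' : BH} (h : HasCrystalLimit π u L)
    (h' : HasCrystalLimit π u L') : L = L' := by
  refine eq_of_forall_dist_le fun ε hε => ?_
  obtain ⟨δ, hδ, H⟩ := h (ε / 2) (half_pos hε)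
  obtain ⟨δ', hδ', H'⟩ := h' (ε / 2) (half_pos hε)
  obtain ⟨t, ht⟩ := exists_param_lt (lt_min hδ hδ')
  obtain ⟨a, ha, haL⟩ := H t (ht.trans_le (min_le_left _ _))
  obtain ⟨a', ha', haL'⟩ := H' t (ht.trans_le (min_le_right _ _))
  obtain rfl : a = a' := Subtype.ext (ha.unique ha')
  rw [← dist_eq_norm] at haL haL'
  exact (dist_triangle_left L L' (π t a)).trans (by linarith)

end crystalLimit

end

end QSL2

theorem mainTheorem10 :
    (∀ t : QSL2.Param, ∃! π : QSL2.OSU t →ₐ[ℂ] QSL2.BH, QSL2.IsStandardRep t π) ∧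
    ∀ π : (t : QSL2.Param) → QSL2.OSU t →ₐ[ℂ] QSL2.BH, (∀ t, QSL2.IsStandardRep t (π t)) →
      (∀ u ∈ QSL2.crystalForm, ∃! L : QSL2.BH, QSL2.HasCrystalLimit π u L) ∧
      ∀ (m : ℕ) (i j : Fin (m + 1)),
        QSL2.uCoeff (q := QSL2.qX) RatFunc.X_ne_zero m i j ∈ QSL2.crystalForm ∧
        QSL2.HasCrystalLimit π (QSL2.uCoeff (q := QSL2.qX) RatFunc.X_ne_zero m i j)
          (if (j : ℕ) < (i : ℕ) then
            QSL2.T ^ (j : ℕ) * QSL2.P₀ * ContinuousLinearMap.adjoint QSL2.T ^ (m - (i : ℕ))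
          else if (i : ℕ) = (j : ℕ) then
            QSL2.T ^ (i : ℕ) * ContinuousLinearMap.adjoint QSL2.T ^ (m - (i : ℕ))
          else 0) := by
  refine ⟨QSL2.existsUnique_isStandardRep, fun π hπ => ⟨fun u hu => ?_, fun m i j => ?_⟩⟩
  · obtain ⟨L, hL⟩ := QSL2.exists_specializationTendsto hπ hu
    exact ⟨L, hL.hasCrystalLimit, fun L' hL' => hL'.unique hL.hasCrystalLimit⟩
  · rw [QSL2.uCoeff_eq]
    exact ⟨QSL2.crystalCoeff_mem_crystalForm m i j,
      (QSL2.SpecializationTendsto.crystalCoeff hπ (Nat.le_of_lt_succ i.2)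
        (Nat.le_of_lt_succ j.2)).hasCrystalLimit⟩
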